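/- **Setting.** Let $\Gamma=(\mathbb R/L_1\mathbb Z)\times(\mathbb R/L_2\mathbb Z)$, $L_1,L_2>0$, be a flat two-dimensional torus, let $\gamma>3$, $\mu>0$, $\lambda\ge 0$, and put $\mathbb S(A)=\mu\big(A+A^{\tau}-\tfrac23(\operatorname{tr}A)\mathbb I\big)+\lambda(\operatorname{tr}A)\mathbb I$. For $h:\Gamma\to[0,\infty)$ let $\Omega^h=\{(x,y,z):(x,y)\in\Gamma,\ 0<z<h(x,y)\}$. Write $\Omega^\eta(t)=\Omega^{\eta(t)}$ and $Q_T^\eta=\bigcup_{0<t<T}\{t\}\times\Omega^\eta(t)$ for $0<T\le\infty$. **Initial data** $(\eta_0,v_0,\rho_0,(\rho\mathbf u)_0)$ satisfy: $\eta_0\in H^2(\Gamma)$, $\eta_0>0$ a.e., $\ln\eta_0\in L^1(\Gamma)$, $v_0\in L^2(\Gamma)$, $0\le\rho_0\in L^\gamma(\Omega^{\eta_0})$, $(\rho\mathbf u)_0\in L^{2\gamma/(\gamma+1)}(\Omega^{\eta_0})$, $|(\rho\mathbf u)_0|^2/\rho_0\in L^1(\Omega^{\eta_0})$, $\rho_0>0$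 a.e. where $(\rho\mathbf u)_0\ne0$, and $m:=\int_{\Omega^{\eta_0}}\rho_0>0$. **Weak solution.** Given a force $F$ on $(0,\infty)\times\Gamma$, $(\rho,\mathbf u,\eta)$ is a weak solution on $(0,\infty)$ if, for every $T>0$: (i) $\eta(0)=\eta_0$; for all $t\ge 0$, $\int_{\Omega^\eta(t)}\rho(t)=m$ and $\eta(t)>0$ a.e. on $\Gamma$; $0\le\rho\in L^\infty(0,T;L^\gamma(\Omega^\eta(t)))$; $\mathbf u\in L^2(0,T;H^1(\Omega^\eta(t)))$ and, for a.a. $t$, $\mathbf u(t)$ has zero trace on $O\times\{0\}$ for every closed $O\subset\{\eta(t)>0\}$; $\rho|\mathbf u|^2\in L^\infty(0,T;L^1(\Omega^\eta(t)))$; $\rho^\gamma/\eta,\ \rho|u_3|^2/\eta\in L^1(Q_T^\eta)$; $\eta\in W^{1,\infty}(0,T;L^2(\Gamma))\cap L^\infty(0,T;H^2(\Gamma))$ (with its continuous representative); $\ln\eta\in C([0,T];L^1(\Gamma))$. (ii) The trace of $\mathbf u$ (extended by zero to $-1<z\le0$) on the graph of $\eta$ equals $\partial_t\eta\,\mathbf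 e_z$ a.e. (iii) For all $\varphi\in C_c^\infty([0,\infty)\times\Gamma\times\mathbb R)$, all bounded $b\in C[0,\infty)$ with $b(0)=0$ and every primitive $B$ of $b(r)/r^2$ on $(0,\infty)$, $$\int_{Q_\infty^\eta}\rho B(\rho)(\partial_t\varphi+\mathbf u\cdot\nabla\varphi)=\int_{Q_\infty^\eta}b(\rho)(\nabla\cdot\mathbf u)\varphi-\int_{\Omega^{\eta_0}}\rho_0B(\rho_0)\varphi(0).$$ (iv) For all $\boldsymbol\varphi\in C_c^\infty([0,\infty)\times\Gamma\times\mathbb R)^3$, $\psi\in C_c^\infty([0,\infty)\times\Gamma)$ with $\boldsymbol\varphi(t,x,y,\eta(t,x,y))=\psi(t,x,y)\mathbf e_z$ and $\boldsymbol\varphi=0$ on $\{z=0\}$, $$\int_{Q_\infty^\eta}\!\big(\rho\mathbf u\cdot\partial_t\boldsymbol\varphi+\rho\mathbf u\otimes\mathbf u:\nabla\boldsymbol\varphi+\rho^\gamma\nabla\cdot\boldsymbol\varphi-\mathbb S(\nabla\mathbf u):\nabla\boldsymbol\varphi\big)+\int_0^\infty\!\!\int_\Gamma(\partial_t\eta\,\partial_t\psi-\Delta\eta\,\Delta\psi+F\psi)=-\int_{\Omega^{\eta_0}}(\rho\mathbf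 u)_0\cdot\boldsymbol\varphi(0)-\int_\Gamma v_0\psi(0).$$ (v) Contact inequality: for a.a. $t>0$, $$\int_0^t\!\!\int_\Gamma F+\int_0^t\!\!\int_{\Omega^\eta}\frac{\rho^\gamma+\rho|u_3|^2}{\eta}-\Big(\frac{4\mu}3+\lambda\Big)\int_\Gamma\ln\eta(t)\le\int_0^t\!\!\int_{\Omega^\eta}\rho u_3\frac{z}{\eta^2}\big(\partial_t\eta+u_1\partial_x\eta+u_2\partial_y\eta\big)$$ $$-\mu\int_0^t\!\!\int_{\Omega^\eta}\frac{z}{\eta^2}\big[(\partial_zu_1+\partial_xu_3)\partial_x\eta+(\partial_zu_2+\partial_yu_3)\partial_y\eta\big]+\Big(\lambda-\frac{2\mu}3\Big)\int_0^t\!\!\int_{\Omega^\eta}\frac{u_1\partial_x\eta+u_2\partial_y\eta}{\eta^2}$$ $$-\Big(\frac{4\mu}3+\lambda\Big)\int_\Gamma\ln\eta_0+\int_{\Omega^\eta(t)}\rho(t)u_3(t)\frac z{\eta(t)}-\int_{\Omega^{\eta_0}}(\rho u_3)_0\frac z{\eta_0}+\int_\Gamma\partial_t\eta(t)-\int_\Gamma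 v_0.$$ (vi) Energy inequality: for a.a. $t>0$, $$\int_{\Omega^\eta(t)}\Big(\frac12\rho|\mathbf u|^2+\frac{\rho^\gamma}{\gamma-1}\Big)(t)+\int_\Gamma\Big(\frac12|\partial_t\eta|^2+\frac12|\Delta\eta|^2\Big)(t)+\int_0^t\!\!\int_{\Omega^\eta}\mathbb S(\nabla\mathbf u):\nabla\mathbf u\le\int_{\Omega^{\eta_0}}\Big(\frac{|(\rho\mathbf u)_0|^2}{2\rho_0}+\frac{\rho_0^\gamma}{\gamma-1}\Big)+\int_\Gamma\Big(\frac12|v_0|^2+\frac12|\Delta\eta_0|^2\Big)+\int_0^t\!\!\int_\Gamma F\,\partial_t\eta,$$ where, if $F\in L^1(\Gamma)$ is time-independent, the last term is read as $\int_\Gamma F\eta(t)-\int_\Gamma F\eta_0$. **Theorem (detachment of all contact by pressure).** Let the initial data be as above, $\gamma>3$. 1. If $F\in L^1(0,\infty;L^2(\Gamma))$ and $(\rho,\mathbf u,\eta)$ is any weak solution on $(0,\infty)$ with force $F$, then there is $T>0$ with $\eta(T)>0$ everywhere on $\Gamma$. 2. For every $M\ge 0$ there is $A>0$, depending only on $\Gamma$,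 $\gamma$, the initial data and $M$, such that for every time-independent $F\in L^1(\Gamma)$ with $\|F\|_{L^1(\Gamma)}\le M$ and $\int_\Gamma F>-A$, and every weak solution $(\rho,\mathbf u,\eta)$ on $(0,\infty)$ with force $F$ (for any $\mu>0$, $\lambda\ge0$), there is $T>0$ with $\eta(T)>0$ everywhere on $\Gamma$. -/

import Mathlib

open MeasureTheory Set Filter Topology
open scoped ContDiff ENNReal NNReal

namespace FluidPlate

/-- The flat two-dimensional torus `Γ` with periods `L₁`, `L₂`. -/
abbrev Torus (L₁ L₂ : ℝ) : Type := AddCircle L₁ × AddCircle L₂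

/-- The ambient space `Γ × ℝ` of the fluid; the last coordinate is the height `z`. -/
abbrev Space (L₁ L₂ : ℝ) : Type := Torus L₁ L₂ × ℝ

noncomputable section

/-! ### Classical derivatives and test functions -/

section Classical

variable {L₁ L₂ : ℝ}

/-- Classical partial derivative (index `0` is `x`, index `1` is `y`) on the torus. -/
def pdT (i : Fin 2) (f : Torus L₁ L₂ → ℝ) (p : Torus L₁ L₂) : ℝ :=
  deriv (fun s : ℝ =>
    f (![(p.1 + (s : AddCircle L₁), p.2), (p.1, p.2 + (s : AddCircle L₂))] i)) 0

/-- Classical partial derivative (indices `0, 1, 2` are `x, y, z`) on `Γ × ℝ`. -/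
def pdS (i : Fin 3) (f : Space L₁ L₂ → ℝ) (p : Space L₁ L₂) : ℝ :=
  deriv (fun s : ℝ =>
    f (![((p.1.1 + (s : AddCircle L₁), p.1.2), p.2),
         ((p.1.1, p.1.2 + (s : AddCircle L₂)), p.2),
         (p.1, p.2 + s)] i)) 0

/-- The classical Laplacian on the torus. -/
def lapT (f : Torus L₁ L₂ → ℝ) (p : Torus L₁ L₂) : ℝ :=
  ∑ i, pdT i (pdT i f) p

/-- `C^∞(Γ)`. -/
def SmoothT (ψ : Torus L₁ L₂ → ℝ) : Prop :=
  ContDiff ℝ ∞ (fun q : ℝ × ℝ => ψ ((q.1 : AddCircle L₁), (q.2 : AddCircle L₂)))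

/-- `C^k(Γ × ℝ)`. -/
def ContDiffS (k : ℕ∞) (φ : Space L₁ L₂ → ℝ) : Prop :=
  ContDiff ℝ k (fun q : ℝ × ℝ × ℝ =>
    φ (((q.1 : AddCircle L₁), (q.2.1 : AddCircle L₂)), q.2.2))

/-- Smooth compactly supported functions on `ℝ × Γ`. Their restrictions to nonnegative times
are the elements of `C_c^∞([0,∞) × Γ)`. -/
def IsTestT (ψ : ℝ → Torus L₁ L₂ → ℝ) : Prop :=
  ContDiff ℝ ∞ (fun q : ℝ × ℝ × ℝ =>
    ψ q.1 ((q.2.1 : AddCircle L₁), (q.2.2 : AddCircle L₂))) ∧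
  HasCompactSupport (fun q : ℝ × Torus L₁ L₂ => ψ q.1 q.2)

/-- Smooth compactly supported functions on `ℝ × Γ × ℝ`. Their restrictions to nonnegative
times are the elements of `C_c^∞([0,∞) × Γ × ℝ)`. -/
def IsTestS (φ : ℝ → Space L₁ L₂ → ℝ) : Prop :=
  ContDiff ℝ ∞ (fun q : ℝ × ℝ × ℝ × ℝ =>
    φ q.1 (((q.2.1 : AddCircle L₁), (q.2.2.1 : AddCircle L₂)), q.2.2.2)) ∧
  HasCompactSupport (fun q : ℝ × Space L₁ L₂ => φ q.1 q.2)

end Classical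

/-! ### Fluid domains -/

section Domains

variable {L₁ L₂ : ℝ}

/-- `Ω^h = {(x,y,z) : 0 < z < h(x,y)}`. -/
def fluidDomain (h : Torus L₁ L₂ → ℝ) : Set (Space L₁ L₂) :=
  {p | 0 < p.2 ∧ p.2 < h p.1}

/-- The extended domain `{(x,y,z) : -1 < z < h(x,y)}`. -/
def extDomain (h : Torus L₁ L₂ → ℝ) : Set (Space L₁ L₂) :=
  {p | -1 < p.2 ∧ p.2 < h p.1}

/-- The space-time fluid domain over the time set `I`. -/
def cylinder (η : ℝ → Torus L₁ L₂ → ℝ) (I : Set ℝ) : Set (ℝ × Space L₁ L₂) :=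
  {q | q.1 ∈ I ∧ q.2 ∈ fluidDomain (η q.1)}

end Domains

section Model

variable {L₁ L₂ : ℝ} [Fact (0 < L₁)] [Fact (0 < L₂)]

/-! ### Sobolev spaces and traces -/

/-- `g` is the weak `i`-th partial derivative of `f` on the torus. -/
def IsWeakPdT (i : Fin 2) (f g : Torus L₁ L₂ → ℝ) : Prop :=
  ∀ ψ : Torus L₁ L₂ → ℝ, SmoothT ψ → ∫ p, f p * pdT i ψ p = -∫ p, g p * ψ p

/-- `f ∈ H²(Γ)` with weak gradient `Df` and weak Hessian `D2f`. -/
structure IsH2 (f : Torus L₁ L₂ → ℝ) (Df : Torus L₁ L₂ → Fin 2 → ℝ)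
    (D2f : Torus L₁ L₂ → Fin 2 → Fin 2 → ℝ) : Prop where
  memLp : MemLp f 2 volume
  grad_memLp : ∀ i, MemLp (fun p => Df p i) 2 volume
  hess_memLp : ∀ i j, MemLp (fun p => D2f p i j) 2 volume
  grad : ∀ i, IsWeakPdT i f (fun p => Df p i)
  hess : ∀ i j, IsWeakPdT j (fun p => Df p i) (fun p => D2f p i j)

/-- `f ∈ H¹(U)` with weak gradient `G`, for an open set `U ⊆ Γ × ℝ`. -/
structure IsH1 (U : Set (Space L₁ L₂)) (f : Space L₁ L₂ → ℝ)
    (G : Space L₁ L₂ → Fin 3 → ℝ) : Prop where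
  memLp : MemLp f 2 (volume.restrict U)
  grad_memLp : ∀ i, MemLp (fun p => G p i) 2 (volume.restrict U)
  grad : ∀ φ : Space L₁ L₂ → ℝ, ContDiffS ⊤ φ → HasCompactSupport φ → tsupport φ ⊆ U →
    ∀ i, ∫ p in U, f p * pdS i φ p = -∫ p in U, G p i * φ p

/-- `f` has the trace `g` on `O × {0}`: the averages of `|f - g|` over the thin layers
`O × (0,ε)` tend to zero. -/
def HasBottomTrace (O : Set (Torus L₁ L₂)) (f : Space L₁ L₂ → ℝ)
    (g : Torus L₁ L₂ → ℝ) : Prop :=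
  Tendsto (fun ε : ℝ => ε⁻¹ * ∫ p in O ×ˢ Ioo (0 : ℝ) ε, |f p - g p.1|) (𝓝[>] 0) (𝓝 0)

/-- `f ∈ H¹_{0z}(Ω^h)`, with weak gradient `G`. -/
structure IsH1Zero (h : Torus L₁ L₂ → ℝ) (f : Space L₁ L₂ → ℝ)
    (G : Space L₁ L₂ → Fin 3 → ℝ) : Prop where
  isH1 : IsH1 (fluidDomain h) f G
  bottom : ∀ O : Set (Torus L₁ L₂), IsClosed O → O ⊆ {p | 0 < h p} →
    HasBottomTrace O f (fun _ => 0)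

/-- The Lagrangian trace on the graph of `h` of `f ∈ H¹_{0z}(Ω^h)` (with weak gradient `G`)
equals `g`. Here `f` is extended by zero to `{-1 < z < h}`, and the trace is the continuous
extension of `w ↦ w(x,y,h(x,y))` from `C¹` functions `w`: the zero extension is the `H¹`-limit
of `C¹` functions whose values on the graph converge to `g` in `L²(Γ)`. -/
def HasGraphTrace (h : Torus L₁ L₂ → ℝ) (f : Space L₁ L₂ → ℝ)
    (G : Space L₁ L₂ → Fin 3 → ℝ) (g : Torus L₁ L₂ → ℝ) : Prop :=
  ∃ w : ℕ → Space L₁ L₂ → ℝ,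
    (∀ n, ContDiffS 1 (w n)) ∧
    Tendsto (fun n => eLpNorm (fun p => w n p - (fluidDomain h).indicator f p) 2
      (volume.restrict (extDomain h))) atTop (𝓝 0) ∧
    (∀ i, Tendsto (fun n => eLpNorm
      (fun p => pdS i (w n) p - (fluidDomain h).indicator (fun p' => G p' i) p) 2
      (volume.restrict (extDomain h))) atTop (𝓝 0)) ∧
    Tendsto (fun n => eLpNorm (fun q => w n (q, h q) - g q) 2 volume) atTop (𝓝 0)

/-! ### Initial data -/

/-- Initial displacement, plate velocity, density and momentum. -/
structure InitialData (L₁ L₂ : ℝ) where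
  η₀ : Torus L₁ L₂ → ℝ
  v₀ : Torus L₁ L₂ → ℝ
  ρ₀ : Space L₁ L₂ → ℝ
  q₀ : Space L₁ L₂ → Fin 3 → ℝ

/-- The initial fluid domain. -/
def InitialData.dom (d : InitialData L₁ L₂) : Set (Space L₁ L₂) := fluidDomain d.η₀

/-- The total mass. -/
def InitialData.mass (d : InitialData L₁ L₂) : ℝ := ∫ p in d.dom, d.ρ₀ p

/-- The regularity and compatibility conditions on the initial data. The displacement is
represented by its continuous representative. -/
structure InitialData.Admissible (d : InitialData L₁ L₂) (γ : ℝ) : Prop where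
  η_cont : Continuous d.η₀
  η_pos : ∀ᵐ p : Torus L₁ L₂, 0 < d.η₀ p
  η_H2 : ∃ Dη₀ D2η₀, IsH2 d.η₀ Dη₀ D2η₀
  log_η : Integrable (fun p : Torus L₁ L₂ => Real.log (d.η₀ p))
  v_L2 : MemLp d.v₀ 2 volume
  ρ_Lγ : MemLp d.ρ₀ (ENNReal.ofReal γ) (volume.restrict d.dom)
  q_Lp : ∀ i, MemLp (fun p => d.q₀ p i) (ENNReal.ofReal (2 * γ / (γ + 1)))
    (volume.restrict d.dom)
  kinetic : IntegrableOn (fun p => (∑ i, d.q₀ p i ^ 2) / d.ρ₀ p) d.dom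
  ρ_pos : ∀ᵐ p ∂(volume.restrict d.dom), d.q₀ p ≠ 0 → 0 < d.ρ₀ p
  ρ_nonneg : ∀ᵐ p ∂(volume.restrict d.dom), 0 ≤ d.ρ₀ p
  mass_pos : 0 < d.mass

/-! ### Weak solutions on `(0,∞)` -/

/-- Newtonian stress `𝕊(A) = μ (A + Aᵀ - (2/3) tr A I) + λ tr A I`. -/
def stress (μ lam : ℝ) (A : Fin 3 → Fin 3 → ℝ) (i j : Fin 3) : ℝ :=
  μ * (A i j + A j i - 2 / 3 * (∑ k, A k k) * (if i = j then 1 else 0))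
    + lam * (∑ k, A k k) * (if i = j then 1 else 0)

/-- The regularity class of a weak solution together with the kinematic coupling.
`Du`, `v`, `Dη`, `D2η` are `∇u` (`Du t p i j = ∂_j u_i`), `∂_t η`, `∇η` and `∇²η`;
"on `(0,∞)`" means on `(0,T)` for every `T > 0`. -/
structure RegularityClass (γ : ℝ) (d : InitialData L₁ L₂)
    (ρ : ℝ → Space L₁ L₂ → ℝ) (u : ℝ → Space L₁ L₂ → Fin 3 → ℝ)
    (η : ℝ → Torus L₁ L₂ → ℝ)
    (Du : ℝ → Space L₁ L₂ → Fin 3 → Fin 3 → ℝ) (v : ℝ → Torus L₁ L₂ → ℝ)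
    (Dη : ℝ → Torus L₁ L₂ → Fin 2 → ℝ)
    (D2η : ℝ → Torus L₁ L₂ → Fin 2 → Fin 2 → ℝ) : Prop where
  /-- `η` is represented by its continuous representative and starts from `η₀`. -/
  η_cont : ContinuousOn (fun q : ℝ × Torus L₁ L₂ => η q.1 q.2) (Ici 0 ×ˢ univ)
  η_init : η 0 = d.η₀
  η_pos : ∀ t, 0 ≤ t → ∀ᵐ p : Torus L₁ L₂, 0 < η t p
  /-- Conservation of mass. -/
  mass : ∀ t, 0 ≤ t → ∫ p in fluidDomain (η t), ρ t p = d.mass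
  /-- `ρ ∈ L^∞(0,T; L^γ)`, `ρ ≥ 0`. -/
  ρ_meas : AEStronglyMeasurable (fun q : ℝ × Space L₁ L₂ => ρ q.1 q.2)
    (volume.restrict (cylinder η (Ioi 0)))
  ρ_nonneg : ∀ᵐ q ∂(volume.restrict (cylinder η (Ioi 0))), 0 ≤ ρ q.1 q.2
  ρ_bound : ∀ T, 0 < T → ∃ C : ℝ≥0, ∀ᵐ t ∂(volume.restrict (Ioo 0 T)),
    eLpNorm (ρ t) (ENNReal.ofReal γ) (volume.restrict (fluidDomain (η t))) ≤ C
  /-- `u ∈ L²(0,T; H¹_{0z})`. -/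
  u_L2 : ∀ T, 0 < T → ∀ i, MemLp (fun q : ℝ × Space L₁ L₂ => u q.1 q.2 i) 2
    (volume.restrict (cylinder η (Ioo 0 T)))
  Du_L2 : ∀ T, 0 < T → ∀ i j, MemLp (fun q : ℝ × Space L₁ L₂ => Du q.1 q.2 i j) 2
    (volume.restrict (cylinder η (Ioo 0 T)))
  u_H1 : ∀ᵐ t ∂(volume.restrict (Ioi (0 : ℝ))), ∀ i,
    IsH1Zero (η t) (fun p => u t p i) (fun p => Du t p i)
  /-- `ρ|u|² ∈ L^∞(0,T; L¹)`. -/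
  kinetic_bound : ∀ T, 0 < T → ∃ C : ℝ≥0, ∀ᵐ t ∂(volume.restrict (Ioo 0 T)),
    eLpNorm (fun p => ρ t p * ∑ i, u t p i ^ 2) 1 (volume.restrict (fluidDomain (η t))) ≤ C
  /-- `ρ^γ/η, ρ|u₃|²/η ∈ L¹(Q_T^η)`. -/
  pressure_int : ∀ T, 0 < T → IntegrableOn
    (fun q : ℝ × Space L₁ L₂ => ρ q.1 q.2 ^ γ / η q.1 q.2.1) (cylinder η (Ioo 0 T))
  vertical_int : ∀ T, 0 < T → IntegrableOn
    (fun q : ℝ × Space L₁ L₂ => ρ q.1 q.2 * u q.1 q.2 2 ^ 2 / η q.1 q.2.1)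
    (cylinder η (Ioo 0 T))
  /-- `η ∈ W^{1,∞}(0,T; L²)`. -/
  v_meas : AEStronglyMeasurable (fun q : ℝ × Torus L₁ L₂ => v q.1 q.2)
    (volume.restrict (Ioi 0 ×ˢ univ))
  v_bound : ∀ T, 0 < T → ∃ C : ℝ≥0, ∀ᵐ t ∂(volume.restrict (Ioo 0 T)),
    eLpNorm (v t) 2 volume ≤ C
  v_deriv : ∀ ψ : ℝ → Torus L₁ L₂ → ℝ, IsTestT ψ →
    tsupport (fun q : ℝ × Torus L₁ L₂ => ψ q.1 q.2) ⊆ Ioi 0 ×ˢ univ →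
    ∫ q in Ioi (0 : ℝ) ×ˢ (univ : Set (Torus L₁ L₂)),
        η q.1 q.2 * deriv (fun s => ψ s q.2) q.1
      = -∫ q in Ioi (0 : ℝ) ×ˢ (univ : Set (Torus L₁ L₂)), v q.1 q.2 * ψ q.1 q.2
  /-- `η ∈ L^∞(0,T; H²)`. -/
  Dη_meas : ∀ i, AEStronglyMeasurable (fun q : ℝ × Torus L₁ L₂ => Dη q.1 q.2 i)
    (volume.restrict (Ioi 0 ×ˢ univ))
  D2η_meas : ∀ i j, AEStronglyMeasurable (fun q : ℝ × Torus L₁ L₂ => D2η q.1 q.2 i j)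
    (volume.restrict (Ioi 0 ×ˢ univ))
  η_H2 : ∀ᵐ t ∂(volume.restrict (Ioi (0 : ℝ))), IsH2 (η t) (Dη t) (D2η t)
  η_bound : ∀ T, 0 < T → ∃ C : ℝ≥0, ∀ᵐ t ∂(volume.restrict (Ioo 0 T)),
    eLpNorm (η t) 2 volume ≤ C ∧
    (∀ i, eLpNorm (fun p => Dη t p i) 2 volume ≤ C) ∧
    (∀ i j, eLpNorm (fun p => D2η t p i j) 2 volume ≤ C)
  /-- `ln η ∈ C([0,T]; L¹)`. -/
  log_int : ∀ t, 0 ≤ t → Integrable (fun p : Torus L₁ L₂ => Real.log (η t p))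
  log_cont : ∀ t, 0 ≤ t → Tendsto
    (fun s => ∫ p, |Real.log (η s p) - Real.log (η t p)|) (𝓝[Ici 0] t) (𝓝 0)
  /-- Kinematic coupling: the trace of `u` on the plate is `∂_t η e_z`. -/
  coupling : ∀ᵐ t ∂(volume.restrict (Ioi (0 : ℝ))), ∀ i,
    HasGraphTrace (η t) (fun p => u t p i) (fun p => Du t p i)
      (fun p => (![0, 0, v t p] : Fin 3 → ℝ) i)

/-- The renormalized continuity equation. -/
def RenormalizedContinuity (d : InitialData L₁ L₂)
    (ρ : ℝ → Space L₁ L₂ → ℝ) (u : ℝ → Space L₁ L₂ → Fin 3 → ℝ)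
    (η : ℝ → Torus L₁ L₂ → ℝ) (Du : ℝ → Space L₁ L₂ → Fin 3 → Fin 3 → ℝ) : Prop :=
  ∀ φ : ℝ → Space L₁ L₂ → ℝ, IsTestS φ →
  ∀ b B : ℝ → ℝ, ContinuousOn b (Ici 0) → (∃ C, ∀ r, 0 ≤ r → |b r| ≤ C) → b 0 = 0 →
    (∀ r, 0 < r → HasDerivAt B (b r / r ^ 2) r) →
    ∫ q in cylinder η (Ioi 0), ρ q.1 q.2 * B (ρ q.1 q.2) *
        (deriv (fun s => φ s q.2) q.1 + ∑ i, u q.1 q.2 i * pdS i (φ q.1) q.2)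
      = (∫ q in cylinder η (Ioi 0), b (ρ q.1 q.2) * (∑ i, Du q.1 q.2 i i) * φ q.1 q.2)
        - ∫ p in d.dom, d.ρ₀ p * B (d.ρ₀ p) * φ 0 p

/-- The coupled momentum equation, with outer force `F`. -/
def CoupledMomentum (μ lam γ : ℝ) (d : InitialData L₁ L₂) (F : ℝ → Torus L₁ L₂ → ℝ)
    (ρ : ℝ → Space L₁ L₂ → ℝ) (u : ℝ → Space L₁ L₂ → Fin 3 → ℝ)
    (η : ℝ → Torus L₁ L₂ → ℝ)
    (Du : ℝ → Space L₁ L₂ → Fin 3 → Fin 3 → ℝ) (v : ℝ → Torus L₁ L₂ → ℝ)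
    (D2η : ℝ → Torus L₁ L₂ → Fin 2 → Fin 2 → ℝ) : Prop :=
  ∀ (φ : ℝ → Space L₁ L₂ → Fin 3 → ℝ) (ψ : ℝ → Torus L₁ L₂ → ℝ),
    (∀ i, IsTestS (fun t p => φ t p i)) → IsTestT ψ →
    (∀ t, 0 < t → ∀ p, φ t (p, η t p) = ![0, 0, ψ t p]) →
    (∀ t, 0 < t → ∀ p, φ t (p, 0) = 0) →
    (∫ q in cylinder η (Ioi 0),
        ρ q.1 q.2 * ∑ i, u q.1 q.2 i * deriv (fun s => φ s q.2 i) q.1)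
      + (∫ q in cylinder η (Ioi 0),
          ∑ i, ∑ j, ρ q.1 q.2 * u q.1 q.2 i * u q.1 q.2 j
            * pdS j (fun p => φ q.1 p i) q.2)
      + (∫ q in cylinder η (Ioi 0),
          ρ q.1 q.2 ^ γ * ∑ i, pdS i (fun p => φ q.1 p i) q.2)
      - (∫ q in cylinder η (Ioi 0),
          ∑ i, ∑ j, stress μ lam (Du q.1 q.2) i j * pdS j (fun p => φ q.1 p i) q.2)
      + (∫ q in Ioi (0 : ℝ) ×ˢ (univ : Set (Torus L₁ L₂)),
          v q.1 q.2 * deriv (fun s => ψ s q.2) q.1)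
      - (∫ q in Ioi (0 : ℝ) ×ˢ (univ : Set (Torus L₁ L₂)),
          (∑ i, D2η q.1 q.2 i i) * lapT (ψ q.1) q.2)
      + (∫ q in Ioi (0 : ℝ) ×ˢ (univ : Set (Torus L₁ L₂)), F q.1 q.2 * ψ q.1 q.2)
    = -(∫ p in d.dom, ∑ i, d.q₀ p i * φ 0 p i) - ∫ p, d.v₀ p * ψ 0 p

/-- The contact inequality at time `t`. -/
def ContactInequality (μ lam γ : ℝ) (d : InitialData L₁ L₂) (F : ℝ → Torus L₁ L₂ → ℝ)
    (ρ : ℝ → Space L₁ L₂ → ℝ) (u : ℝ → Space L₁ L₂ → Fin 3 → ℝ)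
    (η : ℝ → Torus L₁ L₂ → ℝ)
    (Du : ℝ → Space L₁ L₂ → Fin 3 → Fin 3 → ℝ) (v : ℝ → Torus L₁ L₂ → ℝ)
    (Dη : ℝ → Torus L₁ L₂ → Fin 2 → ℝ) (t : ℝ) : Prop :=
  (∫ q in Ioo 0 t ×ˢ (univ : Set (Torus L₁ L₂)), F q.1 q.2)
    + (∫ q in cylinder η (Ioo 0 t), ρ q.1 q.2 ^ γ / η q.1 q.2.1)
    + (∫ q in cylinder η (Ioo 0 t), ρ q.1 q.2 * u q.1 q.2 2 ^ 2 / η q.1 q.2.1)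
    - (4 * μ / 3 + lam) * ∫ p, Real.log (η t p)
  ≤ (∫ q in cylinder η (Ioo 0 t),
        ρ q.1 q.2 * u q.1 q.2 2 * q.2.2 * (v q.1 q.2.1 / η q.1 q.2.1 ^ 2))
    + (∫ q in cylinder η (Ioo 0 t),
        ρ q.1 q.2 * u q.1 q.2 0 * u q.1 q.2 2 * (q.2.2 * Dη q.1 q.2.1 0 / η q.1 q.2.1 ^ 2))
    + (∫ q in cylinder η (Ioo 0 t),
        ρ q.1 q.2 * u q.1 q.2 1 * u q.1 q.2 2 * (q.2.2 * Dη q.1 q.2.1 1 / η q.1 q.2.1 ^ 2))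
    - μ * (∫ q in cylinder η (Ioo 0 t),
        (Du q.1 q.2 0 2 + Du q.1 q.2 2 0) * (q.2.2 * Dη q.1 q.2.1 0 / η q.1 q.2.1 ^ 2))
    - μ * (∫ q in cylinder η (Ioo 0 t),
        (Du q.1 q.2 1 2 + Du q.1 q.2 2 1) * (q.2.2 * Dη q.1 q.2.1 1 / η q.1 q.2.1 ^ 2))
    + (lam - 2 * μ / 3) * (∫ q in cylinder η (Ioo 0 t),
        (u q.1 q.2 0 * (Dη q.1 q.2.1 0 / η q.1 q.2.1 ^ 2)
          + u q.1 q.2 1 * (Dη q.1 q.2.1 1 / η q.1 q.2.1 ^ 2)))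
    - (4 * μ / 3 + lam) * (∫ p, Real.log (d.η₀ p))
    + (∫ p in fluidDomain (η t), ρ t p * u t p 2 * (p.2 / η t p.1))
    - (∫ p in d.dom, d.q₀ p 2 * (p.2 / d.η₀ p.1))
    + (∫ p, v t p) - ∫ p, d.v₀ p

/-- The energy inequality at time `t`; `D2η₀` is the weak Hessian of `η₀`, and `W` is the work
of the outer force on `(0,t)`. -/
def EnergyInequality (μ lam γ : ℝ) (d : InitialData L₁ L₂)
    (D2η₀ : Torus L₁ L₂ → Fin 2 → Fin 2 → ℝ)
    (ρ : ℝ → Space L₁ L₂ → ℝ) (u : ℝ → Space L₁ L₂ → Fin 3 → ℝ)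
    (η : ℝ → Torus L₁ L₂ → ℝ)
    (Du : ℝ → Space L₁ L₂ → Fin 3 → Fin 3 → ℝ) (v : ℝ → Torus L₁ L₂ → ℝ)
    (D2η : ℝ → Torus L₁ L₂ → Fin 2 → Fin 2 → ℝ) (W t : ℝ) : Prop :=
  (∫ p in fluidDomain (η t),
      (1 / 2 * ρ t p * (∑ i, u t p i ^ 2) + ρ t p ^ γ / (γ - 1)))
    + (∫ p, (1 / 2 * v t p ^ 2 + 1 / 2 * (∑ i, D2η t p i i) ^ 2))
    + (∫ q in cylinder η (Ioo 0 t),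
        ∑ i, ∑ j, stress μ lam (Du q.1 q.2) i j * Du q.1 q.2 i j)
  ≤ (∫ p in d.dom,
      ((∑ i, d.q₀ p i ^ 2) / (2 * d.ρ₀ p) + d.ρ₀ p ^ γ / (γ - 1)))
    + (∫ p, (1 / 2 * d.v₀ p ^ 2 + 1 / 2 * (∑ i, D2η₀ p i i) ^ 2))
    + W

/-- `(ρ,u,η)` is a weak solution on `(0,∞)` for the outer force `F`. The work done by the
force in the energy inequality is `∫₀ᵗ ∫_Γ F ∂_t η`. -/
def IsWeakSolution (μ lam γ : ℝ) (d : InitialData L₁ L₂) (F : ℝ → Torus L₁ L₂ → ℝ)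
    (ρ : ℝ → Space L₁ L₂ → ℝ) (u : ℝ → Space L₁ L₂ → Fin 3 → ℝ)
    (η : ℝ → Torus L₁ L₂ → ℝ) : Prop :=
  ∃ Du v Dη D2η Dη₀ D2η₀,
    RegularityClass γ d ρ u η Du v Dη D2η ∧
    IsH2 d.η₀ Dη₀ D2η₀ ∧
    RenormalizedContinuity d ρ u η Du ∧
    CoupledMomentum μ lam γ d F ρ u η Du v D2η ∧
    (∀ᵐ t ∂(volume.restrict (Ioi (0 : ℝ))),
      ContactInequality μ lam γ d F ρ u η Du v Dη t) ∧
    (∀ᵐ t ∂(volume.restrict (Ioi (0 : ℝ))),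
      EnergyInequality μ lam γ d D2η₀ ρ u η Du v D2η
        (∫ q in Ioo 0 t ×ˢ (univ : Set (Torus L₁ L₂)), F q.1 q.2 * v q.1 q.2) t)

/-- `(ρ,u,η)` is a weak solution on `(0,∞)` for the time-independent outer force `F`, which is
only integrable. As `F ∂_t η` need not be integrable, the work `∫₀ᵗ ∫_Γ F ∂_t η` is read as
`∫_Γ F η(t) - ∫_Γ F η₀`. -/
def IsWeakSolutionStatic (μ lam γ : ℝ) (d : InitialData L₁ L₂) (F : Torus L₁ L₂ → ℝ)
    (ρ : ℝ → Space L₁ L₂ → ℝ) (u : ℝ → Space L₁ L₂ → Fin 3 → ℝ)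
    (η : ℝ → Torus L₁ L₂ → ℝ) : Prop :=
  ∃ Du v Dη D2η Dη₀ D2η₀,
    RegularityClass γ d ρ u η Du v Dη D2η ∧
    IsH2 d.η₀ Dη₀ D2η₀ ∧
    RenormalizedContinuity d ρ u η Du ∧
    CoupledMomentum μ lam γ d (fun _ => F) ρ u η Du v D2η ∧
    (∀ᵐ t ∂(volume.restrict (Ioi (0 : ℝ))),
      ContactInequality μ lam γ d (fun _ => F) ρ u η Du v Dη t) ∧
    (∀ᵐ t ∂(volume.restrict (Ioi (0 : ℝ))),
      EnergyInequality μ lam γ d D2η₀ ρ u η Du v D2η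
        ((∫ p, F p * η t p) - ∫ p, F p * d.η₀ p) t)

/-- `F ∈ L¹(0,∞; L²(Γ))`. -/
def MemL1L2 (F : ℝ → Torus L₁ L₂ → ℝ) : Prop :=
  AEStronglyMeasurable (fun q : ℝ × Torus L₁ L₂ => F q.1 q.2)
    (volume.restrict (Ioi 0 ×ˢ univ)) ∧
  ∫⁻ t in Ioi (0 : ℝ), eLpNorm (F t) 2 volume < (⊤ : ℝ≥0∞)

end Model

end

end FluidPlate

/-! Suppose that contact persists: at every positive time the plate touches the bottom somewhere.
Suppose also that the energy stays below a constant `E` for all times. The elastic energy controls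
the Hessian of η and hence, in two dimensions, its oscillation (`IsH2.abs_sub_le`), so a single
contact point bounds the whole plate by a height `H` (`contactHeight`). The fixed mass is then
confined to a bounded volume, and at each time ∫ ρ^γ/η is at least a positive constant `c₀`
(`pressureRate_le`). The pressure term in the contact inequality therefore grows at least like `c₀ *
t`.

All terms against it grow more slowly. The terms at times 0 and `t` are bounded by mass, energy and
log x ≤ x. The total dissipation ∫∫|∇u|² is at most `E / μ`, by Korn's inequality with constant one
(`integral_stress_ge`): the horizontal velocity vanishes on the graph, so products of first
derivatives may be exchanged under the integral. The viscous terms contain ∇η/η, which is singular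
at contact. However ∫|∂ᵢh|²/h is bounded for nonnegative h in H² (`integral_grad_sq_div_le`), and
Cauchy–Schwarz and Poincaré on vertical fibres supply the missing √η. At each time these terms are
of the order of the square root of the dissipation, hence at most δt + C(δ) after integration in
time.

The convective terms behave like ∫ ρ|u|²(1+|∇η|)/η and are bounded at each time by a constant times
the dissipation (`exists_convective_bound`), hence bounded uniformly in time. This is where γ > 3
enters. Interpolation on a fibre cancels all powers of η and leaves the exponent 1/γ on the
pressure, 1/2 + 1/(2γ) on the fibre dissipation, and powers of |∇η| and of the fibre integral of
|u|². The first two exponents sum to less than one exactly when γ > 3. The remaining room suffices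
because |∇η| and the fibre integral of |u|² lie in every L^p with p finite; both facts come from one
Loomis–Whitney argument (`lintegral_pow_le_of_hasPd`).

For large times this is contradictory (`contact_absurd`). The energy bound for a force in L¹(0,∞;L²)
follows from a quadratic inequality for the supremum of the plate velocity. For a static force,
contact bounds η by the square root of the elastic energy, which absorbs the work. In the static
case `E`, hence `c₀`, depends only on the data and `M`, and half of `c₀` serves as the threshold
`A`. -/

namespace FluidPlate

noncomputable section

/-! ### Directional derivatives along one-parameter subgroups -/

section Direction

variable {X : Type*} [TopologicalSpace X] [AddCommGroup X]

/-- `f` is continuous and has the continuous directional derivative `f'` along the one-parameter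
subgroup `d`. -/
structure HasPd (d : ℝ →ₜ+ X) (f f' : X → ℝ) : Prop where
  cont : Continuous f
  cont' : Continuous f'
  deriv : ∀ p, HasDerivAt (fun s : ℝ => f (p + d s)) (f' p) 0

namespace HasPd

variable {d : ℝ →ₜ+ X} {f f' g g' : X → ℝ}

/-- The homomorphism law lets the base point move along the line, so the derivative at parameter
zero at every point determines the derivative along the whole line. -/
theorem hasDerivAt (h : HasPd d f f') (p : X) (s : ℝ) :
    HasDerivAt (fun r : ℝ => f (p + d r)) (f' (p + d s)) s := by
  have h1 := h.deriv (p + d s)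
  have h2 : HasDerivAt (fun r : ℝ => f (p + d s + d (r - s))) (f' (p + d s)) s := by
    have h3 : HasDerivAt (fun r : ℝ => r - s) 1 s := (hasDerivAt_id s).sub_const s
    have h1' : HasDerivAt (fun r : ℝ => f (p + d s + d r)) (f' (p + d s)) (s - s) := by
      simpa using h1
    exact (HasDerivAt.comp (h := fun r : ℝ => r - s) s h1' h3).congr_deriv (by simp)
  refine h2.congr_of_eventuallyEq (Eventually.of_forall fun r => ?_)
  simp only [map_sub]
  congr 1
  abel

theorem add (h : HasPd d f f') (k : HasPd d g g') :
    HasPd d (fun p => f p + g p) (fun p => f' p + g' p) :=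
  ⟨h.cont.add k.cont, h.cont'.add k.cont', fun p => (h.deriv p).add (k.deriv p)⟩

theorem mul (h : HasPd d f f') (k : HasPd d g g') :
    HasPd d (fun p => f p * g p) (fun p => f' p * g p + f p * g' p) :=
  ⟨h.cont.mul k.cont, (h.cont'.mul k.cont).add (h.cont.mul k.cont'), fun p => by
    refine HasDerivAt.congr_deriv ((h.deriv p).mul (k.deriv p)) ?_
    simp⟩

theorem const_mul (h : HasPd d f f') (c : ℝ) :
    HasPd d (fun p => c * f p) (fun p => c * f' p) :=
  ⟨continuous_const.mul h.cont, continuous_const.mul h.cont',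
    fun p => (h.deriv p).const_mul c⟩

theorem add_const (h : HasPd d f f') (c : ℝ) : HasPd d (fun p => f p + c) f' :=
  ⟨h.cont.add continuous_const, h.cont', fun p => (h.deriv p).add_const c⟩

theorem pow (h : HasPd d f f') (n : ℕ) :
    HasPd d (fun p => f p ^ n) (fun p => n * f p ^ (n - 1) * f' p) :=
  ⟨h.cont.pow n, (continuous_const.mul (h.cont.pow _)).mul h.cont', fun p => by
    refine HasDerivAt.congr_deriv ((h.deriv p).pow n) ?_
    simp⟩

theorem inv (h : HasPd d f f') (h0 : ∀ p, f p ≠ 0) :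
    HasPd d (fun p => (f p)⁻¹) (fun p => -f' p / f p ^ 2) :=
  ⟨h.cont.inv₀ h0, h.cont'.neg.div (h.cont.pow 2) (fun p => pow_ne_zero 2 (h0 p)), fun p => by
    refine HasDerivAt.congr_deriv ((h.deriv p).inv (by simpa using h0 p)) ?_
    simp⟩

theorem continuous_line [ContinuousAdd X] (h : Continuous f) (d : ℝ →ₜ+ X) (p : X) :
    Continuous fun s : ℝ => f (p + d s) :=
  h.comp (continuous_const.add d.continuous_toFun)

theorem integral_line [ContinuousAdd X] (h : HasPd d f f') (p : X) (a b : ℝ) :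
    ∫ s in a..b, f' (p + d s) = f (p + d b) - f (p + d a) :=
  intervalIntegral.integral_eq_sub_of_hasDerivAt (fun s _ => h.hasDerivAt p s)
    ((continuous_line h.cont' d p).intervalIntegrable _ _)

theorem translate [ContinuousAdd X] (h : HasPd d f f') (a : X) :
    HasPd d (fun p => f (p + a)) (fun p => f' (p + a)) :=
  ⟨h.cont.comp (continuous_add_const a), h.cont'.comp (continuous_add_const a), fun p => by
    have := h.deriv (p + a)
    simp only [add_right_comm p a] at this
    exact this⟩

end HasPd

end Direction

/-! ### Coordinate directions and lifts to Euclidean space -/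

variable {L₁ L₂ : ℝ}

/-- The coordinate directions of the torus. -/
def dirT (i : Fin 2) : ℝ →ₜ+ Torus L₁ L₂ where
  toFun s := (((if i = 0 then s else 0 : ℝ) : AddCircle L₁),
    ((if i = 1 then s else 0 : ℝ) : AddCircle L₂))
  map_zero' := by simp
  map_add' a b := by
    ext
    · dsimp only [Prod.fst_add]; split_ifs <;> simp
    · dsimp only [Prod.snd_add]; split_ifs <;> simp
  continuous_toFun := by
    refine Continuous.prodMk ?_ ?_
    · exact (AddCircle.continuous_mk' L₁).comp (by split_ifs <;> fun_prop)
    · exact (AddCircle.continuous_mk' L₂).comp (by split_ifs <;> fun_prop)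

/-- The coordinate directions of `Γ × ℝ`. -/
def dirS (i : Fin 3) : ℝ →ₜ+ Space L₁ L₂ where
  toFun s := ((((if i = 0 then s else 0 : ℝ) : AddCircle L₁),
    ((if i = 1 then s else 0 : ℝ) : AddCircle L₂)), if i = 2 then s else 0)
  map_zero' := by simp
  map_add' a b := by
    refine Prod.ext (Prod.ext ?_ ?_) ?_
    · dsimp only [Prod.fst_add]; split_ifs <;> simp
    · dsimp only [Prod.fst_add, Prod.snd_add]; split_ifs <;> simp
    · dsimp only [Prod.snd_add]; split_ifs <;> simp
  continuous_toFun := by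
    refine Continuous.prodMk (Continuous.prodMk ?_ ?_) ?_
    · exact (AddCircle.continuous_mk' L₁).comp (by split_ifs <;> fun_prop)
    · exact (AddCircle.continuous_mk' L₂).comp (by split_ifs <;> fun_prop)
    · split_ifs <;> fun_prop

theorem dirT_apply (i : Fin 2) (s : ℝ) : (dirT i s : Torus L₁ L₂) =
    (((if i = 0 then s else 0 : ℝ) : AddCircle L₁),
      ((if i = 1 then s else 0 : ℝ) : AddCircle L₂)) := rfl

theorem dirS_apply (i : Fin 3) (s : ℝ) : (dirS i s : Space L₁ L₂) =
    ((((if i = 0 then s else 0 : ℝ) : AddCircle L₁),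
      ((if i = 1 then s else 0 : ℝ) : AddCircle L₂)), if i = 2 then s else 0) := rfl

theorem dirS_castSucc (i : Fin 2) (s : ℝ) :
    (dirS i.castSucc s : Space L₁ L₂) = (dirT i s, 0) := by
  fin_cases i <;> simp [dirS_apply, dirT_apply]

theorem dirS_two (s : ℝ) : (dirS 2 s : Space L₁ L₂) = (0, s) := by
  simp [dirS_apply]

theorem pdT_eq (i : Fin 2) (f : Torus L₁ L₂ → ℝ) (p : Torus L₁ L₂) :
    pdT i f p = deriv (fun s : ℝ => f (p + dirT i s)) 0 := by
  unfold pdT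
  congr 1
  funext s
  congr 1
  fin_cases i <;> ext <;> simp [dirT_apply]

theorem pdS_eq (i : Fin 3) (f : Space L₁ L₂ → ℝ) (p : Space L₁ L₂) :
    pdS i f p = deriv (fun s : ℝ => f (p + dirS i s)) 0 := by
  unfold pdS
  congr 1
  funext s
  congr 1
  fin_cases i <;> refine Prod.ext (Prod.ext ?_ ?_) ?_ <;> simp [dirS_apply]

theorem HasPd.pdT_eq {i : Fin 2} {f f' : Torus L₁ L₂ → ℝ} (h : HasPd (dirT i) f f') :
    pdT i f = f' :=
  funext fun p => by rw [FluidPlate.pdT_eq]; exact (h.deriv p).deriv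

/-- The projection of the plane to the torus. -/
def projT (q : ℝ × ℝ) : Torus L₁ L₂ := ((q.1 : AddCircle L₁), (q.2 : AddCircle L₂))

/-- The projection `ℝ³ → Γ × ℝ`. -/
def projS (q : ℝ × ℝ × ℝ) : Space L₁ L₂ :=
  (((q.1 : AddCircle L₁), (q.2.1 : AddCircle L₂)), q.2.2)

theorem isOpenQuotientMap_coe (L : ℝ) :
    IsOpenQuotientMap (fun x : ℝ => (x : AddCircle L)) :=
  QuotientAddGroup.isOpenQuotientMap_mk

theorem isOpenQuotientMap_projT : IsOpenQuotientMap (projT : ℝ × ℝ → Torus L₁ L₂) :=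
  (isOpenQuotientMap_coe L₁).prodMap (isOpenQuotientMap_coe L₂)

theorem isOpenQuotientMap_projS : IsOpenQuotientMap (projS : ℝ × ℝ × ℝ → Space L₁ L₂) := by
  have h : IsOpenQuotientMap (Prod.map (projT : ℝ × ℝ → Torus L₁ L₂) (id : ℝ → ℝ)) :=
    isOpenQuotientMap_projT.prodMap .id
  exact h.comp (Homeomorph.prodAssoc ℝ ℝ ℝ).symm.isOpenQuotientMap

/-- Coordinate vectors of the plane. -/
def vecT (i : Fin 2) : ℝ × ℝ := (if i = 0 then 1 else 0, if i = 1 then 1 else 0)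

/-- Coordinate vectors of `ℝ³`. -/
def vecS (i : Fin 3) : ℝ × ℝ × ℝ :=
  (if i = 0 then 1 else 0, if i = 1 then 1 else 0, if i = 2 then 1 else 0)

theorem projT_add_dir (i : Fin 2) (q : ℝ × ℝ) (s : ℝ) :
    (projT q + dirT i s : Torus L₁ L₂) = projT (q + s • vecT i) := by
  ext <;> simp [projT, dirT_apply, vecT]

theorem projS_add_dir (i : Fin 3) (q : ℝ × ℝ × ℝ) (s : ℝ) :
    (projS q + dirS i s : Space L₁ L₂) = projS (q + s • vecS i) := by
  refine Prod.ext (Prod.ext ?_ ?_) ?_ <;> simp [projS, dirS_apply, vecS]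

/-- Regularity is defined through lifts. The projection is an open quotient map compatible with the
one-parameter subgroups, so continuity and directional derivatives descend. -/
theorem hasPd_of_contDiff_lift {X E : Type*} [TopologicalSpace X] [AddCommGroup X]
    [NormedAddCommGroup E] [NormedSpace ℝ E] {π : E → X} (hπ : IsOpenQuotientMap π)
    {d : ℝ →ₜ+ X} {e : E} (hd : ∀ q s, π q + d s = π (q + s • e))
    {f f' : X → ℝ} (hf : ContDiff ℝ 1 (f ∘ π)) (hf' : ∀ q, f' (π q) = fderiv ℝ (f ∘ π) q e) :
    HasPd d f f' where
  cont := hπ.isQuotientMap.continuous_iff.2 hf.continuous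
  cont' := by
    refine hπ.isQuotientMap.continuous_iff.2 ?_
    have : f' ∘ π = fun q => fderiv ℝ (f ∘ π) q e := funext hf'
    rw [this]
    exact (hf.continuous_fderiv one_ne_zero).clm_apply continuous_const
  deriv p := by
    obtain ⟨q, rfl⟩ := hπ.surjective p
    simp only [hd, hf']
    have h1 : HasDerivAt (fun s : ℝ => q + s • e) e 0 := by
      simpa using ((hasDerivAt_id (0 : ℝ)).smul_const e).const_add q
    have h2 : HasFDerivAt (f ∘ π) (fderiv ℝ (f ∘ π) q) (q + (0 : ℝ) • e) := by
      simpa using (hf.differentiable one_ne_zero q).hasFDerivAt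
    exact h2.comp_hasDerivAt 0 h1

theorem lift_pd_eq {X E : Type*} [TopologicalSpace X] [AddCommGroup X]
    [NormedAddCommGroup E] [NormedSpace ℝ E] {π : E → X}
    {d : ℝ →ₜ+ X} {e : E} (hd : ∀ q s, π q + d s = π (q + s • e))
    {f : X → ℝ} (hf : ContDiff ℝ 1 (f ∘ π)) (q : E) :
    deriv (fun s : ℝ => f (π q + d s)) 0 = fderiv ℝ (f ∘ π) q e := by
  simp only [hd]
  have h1 : HasDerivAt (fun s : ℝ => q + s • e) e 0 := by
    simpa using ((hasDerivAt_id (0 : ℝ)).smul_const e).const_add q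
  have h2 : HasFDerivAt (f ∘ π) (fderiv ℝ (f ∘ π) q) (q + (0 : ℝ) • e) := by
    simpa using (hf.differentiable one_ne_zero q).hasFDerivAt
  exact (h2.comp_hasDerivAt 0 h1).deriv

theorem SmoothT.contDiff {ψ : Torus L₁ L₂ → ℝ} (h : SmoothT ψ) : ContDiff ℝ ∞ (ψ ∘ projT) := h

theorem SmoothT.pdT_lift {ψ : Torus L₁ L₂ → ℝ} (h : SmoothT ψ) (i : Fin 2) (q : ℝ × ℝ) :
    pdT i ψ (projT q) = fderiv ℝ (ψ ∘ projT) q (vecT i) := by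
  rw [pdT_eq]
  exact lift_pd_eq (projT_add_dir i) (h.contDiff.of_le (by exact_mod_cast le_top)) q

theorem SmoothT.hasPd {ψ : Torus L₁ L₂ → ℝ} (h : SmoothT ψ) (i : Fin 2) :
    HasPd (dirT i) ψ (pdT i ψ) :=
  hasPd_of_contDiff_lift isOpenQuotientMap_projT (projT_add_dir i)
    (h.contDiff.of_le (by exact_mod_cast le_top)) (h.pdT_lift i)

theorem SmoothT.pdT {ψ : Torus L₁ L₂ → ℝ} (h : SmoothT ψ) (i : Fin 2) : SmoothT (pdT i ψ) := by
  have h1 : (FluidPlate.pdT i ψ) ∘ projT = fun q => fderiv ℝ (ψ ∘ projT) q (vecT i) :=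
    funext (h.pdT_lift i)
  have h2 : ContDiff ℝ ∞ (fun q => fderiv ℝ (ψ ∘ projT) q (vecT i)) :=
    (h.contDiff.fderiv_right (m := ∞) (by simp)).clm_apply contDiff_const
  rw [← h1] at h2
  exact h2

/-- Both sides lift to the second Fréchet derivative of `ψ ∘ projT`, which is symmetric. -/
theorem SmoothT.pdT_comm {ψ : Torus L₁ L₂ → ℝ} (h : SmoothT ψ) (i j : Fin 2) :
    FluidPlate.pdT i (FluidPlate.pdT j ψ) = FluidPlate.pdT j (FluidPlate.pdT i ψ) := by
  funext p
  obtain ⟨q, rfl⟩ := isOpenQuotientMap_projT.surjective p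
  have key : ∀ i j : Fin 2, FluidPlate.pdT i (FluidPlate.pdT j ψ) (projT q)
      = fderiv ℝ (fderiv ℝ (ψ ∘ projT)) q (vecT i) (vecT j) := by
    intro i j
    rw [(h.pdT j).pdT_lift]
    have h1 : (FluidPlate.pdT j ψ) ∘ projT = fun q => fderiv ℝ (ψ ∘ projT) q (vecT j) :=
      funext (h.pdT_lift j)
    rw [h1, fderiv_clm_apply]
    · simp
    · exact ((h.contDiff.fderiv_right (m := ∞) (by simp)).differentiable (by simp)) q
    · fun_prop
  rw [key, key]
  have hs : IsSymmSndFDerivAt ℝ (ψ ∘ projT) q :=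
    (h.contDiff.contDiffAt).isSymmSndFDerivAt (by
      rw [minSmoothness_of_isRCLikeNormedField]; exact WithTop.coe_le_coe.2 le_top)
  exact hs _ _

theorem ContDiffS.hasPd {w : Space L₁ L₂ → ℝ} (h : ContDiffS 1 w) (i : Fin 3) :
    HasPd (dirS i) w (pdS i w) := by
  have h' : ContDiff ℝ 1 (w ∘ projS) := h
  refine hasPd_of_contDiff_lift isOpenQuotientMap_projS (projS_add_dir i) h' fun q => ?_
  rw [pdS_eq]
  exact lift_pd_eq (projS_add_dir i) h' q

end

end FluidPlate

namespace FluidPlate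

set_option linter.unusedSectionVars false

noncomputable section

/-! ### Quadratic means -/

theorem eLpNorm_two_sq {α E : Type*} [MeasurableSpace α] [NormedAddCommGroup E] (f : α → E)
    (μ : Measure α) : eLpNorm f 2 μ ^ 2 = ∫⁻ x, ‖f x‖ₑ ^ 2 ∂μ := by
  have h := eLpNorm_nnreal_eq_lintegral (μ := μ) (f := f) (p := 2) two_ne_zero
  have h2 : ((2 : ℝ≥0) : ℝ≥0∞) = 2 := rfl
  rw [h2] at h
  rw [h, ← ENNReal.rpow_natCast, ← ENNReal.rpow_mul]
  simp

theorem lintegral_enorm_sq_eq {α : Type*} [MeasurableSpace α] {f : α → ℝ}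
    {μ : Measure α} (hf : MemLp f 2 μ) :
    ∫⁻ x, ‖f x‖ₑ ^ 2 ∂μ = ENNReal.ofReal (∫ x, f x ^ 2 ∂μ) := by
  rw [ofReal_integral_eq_lintegral_ofReal hf.integrable_sq
    (Eventually.of_forall fun x => sq_nonneg _)]
  refine lintegral_congr fun x => ?_
  rw [Real.enorm_eq_ofReal_abs, ← ENNReal.ofReal_pow (abs_nonneg _), sq_abs]

theorem tendsto_eLpNorm_two_iff {α : Type*} [MeasurableSpace α] {f : ℕ → α → ℝ} {μ : Measure α} :
    Tendsto (fun n => eLpNorm (f n) 2 μ) atTop (𝓝 0) ↔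
      Tendsto (fun n => ∫⁻ x, ‖f n x‖ₑ ^ 2 ∂μ) atTop (𝓝 0) := by
  simp only [← eLpNorm_two_sq]
  constructor
  · intro h
    simpa using ENNReal.Tendsto.pow (n := 2) h
  · intro h
    have := (ENNReal.continuous_rpow_const (y := (1 / 2 : ℝ))).tendsto _ |>.comp h
    have h2 : ((fun a : ℝ≥0∞ => a ^ (1 / 2 : ℝ)) ∘ fun n => eLpNorm (f n) 2 μ ^ 2)
        = fun n => eLpNorm (f n) 2 μ := by
      funext n
      simp only [Function.comp]
      rw [← ENNReal.rpow_natCast, ← ENNReal.rpow_mul]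
      simp
    rw [h2] at this
    simpa using this

/-! ### The torus as a compact group -/

variable {L₁ L₂ : ℝ} [Fact (0 < L₁)] [Fact (0 < L₂)]

instance : (volume : Measure (Torus L₁ L₂)).IsAddLeftInvariant :=
  inferInstanceAs (((volume : Measure (AddCircle L₁)).prod
    (volume : Measure (AddCircle L₂))).IsAddLeftInvariant)

instance : (volume : Measure (Torus L₁ L₂)).IsAddHaarMeasure :=
  inferInstanceAs (((volume : Measure (AddCircle L₁)).prod
    (volume : Measure (AddCircle L₂))).IsAddHaarMeasure)

instance : (volume : Measure (Torus L₁ L₂)).IsNegInvariant :=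
  Measure.IsAddHaarMeasure.isNegInvariant_of_regular _

theorem exists_bound_of_continuous {X : Type*} [TopologicalSpace X] [CompactSpace X]
    {f : X → ℝ} (hf : Continuous f) : ∃ C : ℝ, 0 ≤ C ∧ ∀ x, |f x| ≤ C := by
  obtain ⟨C, hC⟩ := isCompact_univ.exists_bound_of_continuousOn hf.continuousOn
  exact ⟨max C 0, le_max_right _ _, fun x => (hC x (mem_univ x)).trans (le_max_left _ _)⟩

theorem integrable_of_continuous {f : Torus L₁ L₂ → ℝ} (hf : Continuous f) : Integrable f :=
  hf.integrable_of_hasCompactSupport (HasCompactSupport.of_compactSpace f)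

theorem memLp_of_continuous {f : Torus L₁ L₂ → ℝ} (hf : Continuous f) (p : ℝ≥0∞) : MemLp f p :=
  hf.memLp_of_hasCompactSupport (HasCompactSupport.of_compactSpace f)

/-- Differentiation under the integral, with compactness giving the dominating constant. The map `σ`
is left free so that one proof serves convolutions (`σ = id`) and translations (`σ = -id`). -/
theorem HasPd.integral_mul_eq {d : ℝ →ₜ+ Torus L₁ L₂} {κ κ' : Torus L₁ L₂ → ℝ}
    (h : HasPd d κ κ') {g : Torus L₁ L₂ → ℝ} (hg : Integrable g) (p : Torus L₁ L₂) (σ : Torus L₁ L₂ → Torus L₁ L₂) (hσ : Continuous σ) :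
    HasDerivAt (fun s : ℝ => ∫ q, g q * κ (p + d s - σ q)) (∫ q, g q * κ' (p - σ q)) 0 := by
  obtain ⟨C, hC, hκ⟩ := exists_bound_of_continuous h.cont'
  have key := (hasDerivAt_integral_of_dominated_loc_of_deriv_le (μ := volume) (x₀ := (0 : ℝ))
    (s := univ) (F := fun s q => g q * κ (p + d s - σ q))
    (F' := fun s q => g q * κ' (p + d s - σ q)) (bound := fun q => |g q| * C) univ_mem
    (Eventually.of_forall fun s => ?_) ?_ ?_ ?_ ?_ ?_).2
  · simpa using key
  · exact hg.aestronglyMeasurable.mul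
      (h.cont.comp (continuous_const.sub hσ)).aestronglyMeasurable
  · obtain ⟨C', -, hC'⟩ := exists_bound_of_continuous h.cont
    exact Integrable.mul_bdd (c := C') hg
      (h.cont.comp (continuous_const.sub hσ)).aestronglyMeasurable
      (Eventually.of_forall fun q => hC' _)
  · exact hg.aestronglyMeasurable.mul
      (h.cont'.comp (continuous_const.sub hσ)).aestronglyMeasurable
  · refine Eventually.of_forall fun q s _ => ?_
    rw [norm_mul, Real.norm_eq_abs, Real.norm_eq_abs]
    exact mul_le_mul_of_nonneg_left (hκ _) (abs_nonneg _)
  · exact hg.abs.mul_const C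
  · refine Eventually.of_forall fun q s _ => ?_
    have h1 := (h.hasDerivAt (p - σ q) s).const_mul (g q)
    have e : ∀ r : ℝ, p - σ q + d r = p + d r - σ q := fun r => by abel
    simpa only [e] using h1

/-- The integral of a directional derivative over the torus vanishes. -/
theorem HasPd.integral_eq_zero {d : ℝ →ₜ+ Torus L₁ L₂} {f f' : Torus L₁ L₂ → ℝ}
    (h : HasPd d f f') : ∫ p, f' p = 0 := by
  -- With this choice the parameter integral is that of a translate of `f`; it is constant by
  -- invariance of the measure, so its derivative vanishes.
  have h1 := h.integral_mul_eq (g := fun _ => 1) (integrable_const _) 0 (fun q => -q)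
    continuous_neg
  have h2 : (fun s : ℝ => ∫ q : Torus L₁ L₂, 1 * f (0 + d s - -q)) = fun _ => ∫ q, f q := by
    funext s
    simp only [one_mul, sub_neg_eq_add, zero_add]
    exact integral_add_left_eq_self f (d s)
  rw [h2] at h1
  simpa using (h1.unique (hasDerivAt_const _ _))

theorem HasPd.integral_mul_deriv {d : ℝ →ₜ+ Torus L₁ L₂} {f f' g g' : Torus L₁ L₂ → ℝ}
    (h : HasPd d f f') (k : HasPd d g g') : ∫ p, f' p * g p = -∫ p, f p * g' p := by
  have h1 := (h.mul k).integral_eq_zero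
  rw [integral_add] at h1
  · linarith
  · exact integrable_of_continuous (h.cont'.mul k.cont)
  · exact integrable_of_continuous (h.cont.mul k.cont')

/-! ### Convolution -/

/-- Convolution on the torus. -/
def conv (g κ : Torus L₁ L₂ → ℝ) (p : Torus L₁ L₂) : ℝ := ∫ q, g q * κ (p - q)

theorem conv_eq (g κ : Torus L₁ L₂ → ℝ) (p : Torus L₁ L₂) :
    conv g κ p = ∫ r, g (p - r) * κ r := by
  unfold conv
  rw [← integral_sub_left_eq_self (fun q => g q * κ (p - q)) volume p]
  simp

theorem integrable_conv_aux {g κ : Torus L₁ L₂ → ℝ} (hg : Integrable g) (hκ : Continuous κ)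
    (p : Torus L₁ L₂) : Integrable fun q => g q * κ (p - q) := by
  obtain ⟨C, -, hC⟩ := exists_bound_of_continuous hκ
  exact Integrable.mul_bdd (c := C) hg (hκ.comp (continuous_const.sub continuous_id)).aestronglyMeasurable
      (Eventually.of_forall fun q => hC _)

theorem continuous_conv {g κ : Torus L₁ L₂ → ℝ} (hg : Integrable g) (hκ : Continuous κ) :
    Continuous (conv g κ) := by
  obtain ⟨C, -, hC⟩ := exists_bound_of_continuous hκ
  refine continuous_of_dominated (bound := fun q => |g q| * C) (fun p => ?_) (fun p => ?_)
    (hg.abs.mul_const C) ?_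
  · exact (integrable_conv_aux hg hκ p).aestronglyMeasurable
  · refine Eventually.of_forall fun q => ?_
    rw [norm_mul, Real.norm_eq_abs, Real.norm_eq_abs]
    exact mul_le_mul_of_nonneg_left (hC _) (abs_nonneg _)
  · exact Eventually.of_forall fun q => by fun_prop

theorem HasPd.conv {d : ℝ →ₜ+ Torus L₁ L₂} {g κ κ' : Torus L₁ L₂ → ℝ} (hg : Integrable g)
    (h : HasPd d κ κ') : HasPd d (conv g κ) (FluidPlate.conv g κ') :=
  ⟨continuous_conv hg h.cont, continuous_conv hg h.cont', fun p =>
    h.integral_mul_eq hg p id continuous_id⟩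

/-- Makes the reflected kernel available as a test function for weak derivatives. The sign from the
reflection later cancels the sign in the definition. -/
theorem SmoothT.reflect {κ : Torus L₁ L₂ → ℝ} (h : SmoothT κ) (p : Torus L₁ L₂) :
    SmoothT (fun q => κ (p - q)) ∧ ∀ i, FluidPlate.pdT i (fun q => κ (p - q))
      = fun q => -FluidPlate.pdT i κ (p - q) := by
  constructor
  · obtain ⟨a, rfl⟩ := isOpenQuotientMap_projT.surjective p
    have h1 : ContDiff ℝ ∞ (fun q : ℝ × ℝ => (κ ∘ projT) (a - q)) :=
      h.contDiff.comp (contDiff_const.sub contDiff_id)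
    have e : (fun q : ℝ × ℝ => (κ ∘ projT) (a - q))
        = fun q => κ (projT a - ((q.1 : AddCircle L₁), (q.2 : AddCircle L₂))) := by
      funext q
      simp only [Function.comp, projT, Prod.fst_sub, Prod.snd_sub, AddCircle.coe_sub]
      rfl
    rw [e] at h1
    exact h1
  · intro i
    refine HasPd.pdT_eq ⟨(h.hasPd i).cont.comp (continuous_const.sub continuous_id),
      ((h.hasPd i).cont'.comp (continuous_const.sub continuous_id)).neg, fun q => ?_⟩
    have h2 : HasDerivAt (fun s : ℝ => κ (p - q + dirT i s)) (FluidPlate.pdT i κ (p - q)) (-0) := by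
      simpa using (h.hasPd i).deriv (p - q)
    have h3 := HasDerivAt.comp (h := fun r : ℝ => -r) 0 h2 (hasDerivAt_neg 0)
    refine (h3.congr_deriv (by simp)).congr_of_eventuallyEq (Eventually.of_forall fun s => ?_)
    simp only [Function.comp, map_neg]
    congr 1
    abel

theorem IsWeakPdT.conv {i : Fin 2} {f g : Torus L₁ L₂ → ℝ} (h : IsWeakPdT i f g)
    {κ : Torus L₁ L₂ → ℝ} (hκ : SmoothT κ) :
    FluidPlate.conv f (pdT i κ) = FluidPlate.conv g κ := by
  funext p
  have h1 := h _ (hκ.reflect p).1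
  rw [(hκ.reflect p).2] at h1
  simp only [mul_neg, integral_neg, neg_inj] at h1
  exact h1

/-- Jensen's inequality: the variance of `g` under the probability density κ(p − ·) is nonnegative.
-/
theorem conv_sq_le {g κ : Torus L₁ L₂ → ℝ} (hg : MemLp g 2) (hκ : Continuous κ)
    (h0 : ∀ p, 0 ≤ κ p) (h1 : ∫ p, κ p = 1) (p : Torus L₁ L₂) :
    conv g κ p ^ 2 ≤ conv (fun q => g q ^ 2) κ p := by
  have hgi : Integrable g := hg.integrable (by norm_num)
  set a := conv g κ p with ha
  have i1 := integrable_conv_aux hgi hκ p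
  have i2 := integrable_conv_aux hg.integrable_sq hκ p
  have i3 : Integrable fun q => κ (p - q) :=
    integrable_of_continuous (hκ.comp (continuous_const.sub continuous_id))
  have hk : ∫ q, κ (p - q) = 1 := by rw [integral_sub_left_eq_self κ, h1]
  have h2 : 0 ≤ ∫ q, (g q - a) ^ 2 * κ (p - q) :=
    integral_nonneg fun q => mul_nonneg (sq_nonneg _) (h0 _)
  have h3 : ∫ q, (g q - a) ^ 2 * κ (p - q) = conv (fun q => g q ^ 2) κ p - 2 * a * a + a ^ 2 := by
    have e : ∀ q, (g q - a) ^ 2 * κ (p - q)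
        = (g q ^ 2 * κ (p - q) - 2 * a * (g q * κ (p - q))) + a ^ 2 * κ (p - q) :=
      fun q => by ring
    simp_rw [e]
    rw [integral_add (f := fun q => g q ^ 2 * κ (p - q) - 2 * a * (g q * κ (p - q)))
        (i2.sub (i1.const_mul _)) (i3.const_mul _),
      integral_sub i2 (i1.const_mul _), integral_const_mul, integral_const_mul, hk]
    simp only [conv, ha, mul_one]
  nlinarith

theorem integral_conv {g κ : Torus L₁ L₂ → ℝ} (hg : Integrable g) (hκ : Continuous κ)
    (h1 : ∫ p, κ p = 1) : ∫ p, conv g κ p = ∫ p, g p := by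
  unfold conv
  obtain ⟨C, -, hC⟩ := exists_bound_of_continuous hκ
  rw [integral_integral_swap]
  · simp only [integral_const_mul, integral_sub_right_eq_self κ, h1, mul_one]
  · refine Integrable.mul_bdd (c := C) (hg.comp_snd volume)
      (hκ.comp (continuous_fst.sub continuous_snd)).aestronglyMeasurable
      (Eventually.of_forall fun q => hC _)

theorem integral_conv_sq_le {g κ : Torus L₁ L₂ → ℝ} (hg : MemLp g 2) (hκ : Continuous κ)
    (h0 : ∀ p, 0 ≤ κ p) (h1 : ∫ p, κ p = 1) :
    ∫ p, conv g κ p ^ 2 ≤ ∫ p, g p ^ 2 := by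
  rw [← integral_conv hg.integrable_sq hκ h1]
  exact integral_mono
    (integrable_of_continuous ((continuous_conv (hg.integrable (by norm_num)) hκ).pow 2))
    (integrable_of_continuous (continuous_conv hg.integrable_sq hκ))
    fun p => conv_sq_le hg hκ h0 h1 p

theorem eLpNorm_conv_le {g κ : Torus L₁ L₂ → ℝ} (hg : MemLp g 2) (hκ : Continuous κ)
    (h0 : ∀ p, 0 ≤ κ p) (h1 : ∫ p, κ p = 1) :
    eLpNorm (conv g κ) 2 ≤ eLpNorm g 2 := by
  rw [← ENNReal.pow_le_pow_left_iff two_ne_zero, eLpNorm_two_sq, eLpNorm_two_sq,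
    lintegral_enorm_sq_eq hg, lintegral_enorm_sq_eq
      (memLp_of_continuous (continuous_conv (hg.integrable (by norm_num)) hκ) 2)]
  exact ENNReal.ofReal_le_ofReal (integral_conv_sq_le hg hκ h0 h1)

theorem conv_sub {g g' κ : Torus L₁ L₂ → ℝ} (hg : Integrable g) (hg' : Integrable g')
    (hκ : Continuous κ) (p : Torus L₁ L₂) :
    conv (g - g') κ p = conv g κ p - conv g' κ p := by
  unfold conv
  rw [← integral_sub (integrable_conv_aux hg hκ p) (integrable_conv_aux hg' hκ p)]
  simp [sub_mul]

/-! ### An explicit approximate identity -/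

/-- A function on the circle with a strict maximum at `0`. -/
def circleBump (L : ℝ) (x : AddCircle L) : ℝ := (1 + (AddCircle.toCircle x : ℂ).re) / 2

theorem circleBump_zero (L : ℝ) : circleBump L 0 = 1 := by simp [circleBump]

theorem circleBump_nonneg (L : ℝ) (x : AddCircle L) : 0 ≤ circleBump L x := by
  have h := (abs_le.1 (Complex.abs_re_le_norm (AddCircle.toCircle x : ℂ))).1
  rw [Circle.norm_coe] at h
  unfold circleBump
  linarith

theorem circleBump_le_one (L : ℝ) (x : AddCircle L) : circleBump L x ≤ 1 := by
  have h := (abs_le.1 (Complex.abs_re_le_norm (AddCircle.toCircle x : ℂ))).2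
  rw [Circle.norm_coe] at h
  unfold circleBump
  linarith

theorem circleBump_lt_one {L : ℝ} (hL : L ≠ 0) {x : AddCircle L} (hx : x ≠ 0) :
    circleBump L x < 1 := by
  refine lt_of_le_of_ne (circleBump_le_one L x) fun h => hx ?_
  have h1 : (AddCircle.toCircle x : ℂ).re = 1 := by unfold circleBump at h; linarith
  have h2 : (AddCircle.toCircle x : ℂ).re ^ 2 + (AddCircle.toCircle x : ℂ).im ^ 2 = 1 := by
    have := Circle.normSq_coe (AddCircle.toCircle x)
    rw [Complex.normSq_apply] at this
    nlinarith
  have h3 : (AddCircle.toCircle x : ℂ).im = 0 := by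
    rw [h1] at h2; nlinarith [sq_nonneg (AddCircle.toCircle x : ℂ).im]
  apply AddCircle.injective_toCircle hL
  ext
  rw [AddCircle.toCircle_zero]
  apply Complex.ext <;> simp [h1, h3]

theorem circleBump_coe (L : ℝ) (x : ℝ) :
    circleBump L (x : AddCircle L) = (1 + Real.cos (2 * Real.pi / L * x)) / 2 := by
  unfold circleBump
  rw [AddCircle.toCircle_apply_mk, Circle.coe_exp, Complex.exp_ofReal_mul_I_re]

theorem continuous_circleBump (L : ℝ) : Continuous (circleBump L) := by
  refine (isOpenQuotientMap_coe L).isQuotientMap.continuous_iff.2 ?_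
  have : circleBump L ∘ (fun x : ℝ => (x : AddCircle L))
      = fun x => (1 + Real.cos (2 * Real.pi / L * x)) / 2 := funext (circleBump_coe L)
  rw [this]
  fun_prop

/-- A smooth function on the torus with a strict maximum at `0`. -/
def bump (p : Torus L₁ L₂) : ℝ := circleBump L₁ p.1 * circleBump L₂ p.2

theorem continuous_bump : Continuous (bump : Torus L₁ L₂ → ℝ) :=
  ((continuous_circleBump L₁).comp continuous_fst).mul
    ((continuous_circleBump L₂).comp continuous_snd)

theorem bump_nonneg (p : Torus L₁ L₂) : 0 ≤ bump p :=
  mul_nonneg (circleBump_nonneg _ _) (circleBump_nonneg _ _)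

theorem bump_zero : bump (0 : Torus L₁ L₂) = 1 := by
  simp [bump, circleBump_zero]

theorem bump_lt_one {p : Torus L₁ L₂} (hp : p ≠ 0) : bump p < 1 := by
  have e1 : L₁ ≠ 0 := (Fact.out : 0 < L₁).ne'
  have e2 : L₂ ≠ 0 := (Fact.out : 0 < L₂).ne'
  unfold bump
  by_cases h : p.1 = 0
  · have h2 : p.2 ≠ 0 := fun h2 => hp (Prod.ext h h2)
    calc _ ≤ 1 * circleBump L₂ p.2 :=
          mul_le_mul_of_nonneg_right (circleBump_le_one _ _) (circleBump_nonneg _ _)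
      _ < 1 := by rw [one_mul]; exact circleBump_lt_one e2 h2
  · calc _ ≤ circleBump L₁ p.1 * 1 :=
          mul_le_mul_of_nonneg_left (circleBump_le_one _ _) (circleBump_nonneg _ _)
      _ < 1 := by rw [mul_one]; exact circleBump_lt_one e1 h

/-- The normalised kernels. -/
def kernel (n : ℕ) (p : Torus L₁ L₂) : ℝ := (∫ q : Torus L₁ L₂, bump q ^ n)⁻¹ * bump p ^ n

theorem smoothT_kernel (n : ℕ) : SmoothT (kernel n : Torus L₁ L₂ → ℝ) := by
  unfold SmoothT kernel bump
  simp only [circleBump_coe]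
  fun_prop

theorem continuous_kernel (n : ℕ) : Continuous (kernel n : Torus L₁ L₂ → ℝ) :=
  continuous_const.mul (continuous_bump.pow n)

theorem integral_bump_pow_pos (n : ℕ) : 0 < ∫ q : Torus L₁ L₂, bump q ^ n := by
  refine (continuous_bump.pow n).integral_pos_of_hasCompactSupport_nonneg_nonzero
    (HasCompactSupport.of_compactSpace _) (fun p => pow_nonneg (bump_nonneg p) n) (x := 0) ?_
  simp [bump_zero]

theorem kernel_nonneg (n : ℕ) (p : Torus L₁ L₂) : 0 ≤ kernel n p :=
  mul_nonneg (inv_nonneg.2 (integral_bump_pow_pos n).le) (pow_nonneg (bump_nonneg p) n)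

theorem integral_kernel (n : ℕ) : ∫ p : Torus L₁ L₂, kernel n p = 1 := by
  unfold kernel
  rw [integral_const_mul, inv_mul_cancel₀ (integral_bump_pow_pos n).ne']

/-- Normalised powers of a nonnegative function with a strict maximum concentrate at the maximum.
The kernels are trigonometric polynomials, so their smoothness costs nothing. -/
theorem tendsto_integral_kernel {G : Torus L₁ L₂ → ℝ} (hG : Continuous G) :
    Tendsto (fun n => ∫ p, kernel n p * G p) atTop (𝓝 (G 0)) := by
  have h := tendsto_setIntegral_pow_smul_of_unique_maximum_of_isCompact_of_continuousOn
    (μ := (volume : Measure (Torus L₁ L₂))) (s := univ) (x₀ := 0) (c := bump) (g := G)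
    isCompact_univ continuous_bump.continuousOn
    (fun y _ hy => by rw [bump_zero]; exact bump_lt_one hy) (fun x _ => bump_nonneg x)
    (by rw [bump_zero]; exact one_pos) (by simp) hG.continuousOn
  simp only [Measure.restrict_univ, smul_eq_mul] at h
  refine h.congr fun n => ?_
  rw [← integral_const_mul]
  refine integral_congr_ae (Eventually.of_forall fun p => ?_)
  simp only [kernel]
  ring

/-- Mollification converges uniformly on continuous functions. -/
theorem conv_kernel_tendstoUniformly {g : Torus L₁ L₂ → ℝ} (hg : Continuous g) :
    ∃ ε : ℕ → ℝ, Tendsto ε atTop (𝓝 0) ∧ ∀ n p, |conv g (kernel n) p - g p| ≤ ε n := by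
  -- Currying turns translation of `g` into a continuous map with values in the sup norm, zero at
  -- the origin. The uniform error is thus a kernel average of a continuous function.
  let Φ : C(Torus L₁ L₂, C(Torus L₁ L₂, ℝ)) := ContinuousMap.curry
    ⟨fun q : Torus L₁ L₂ × Torus L₁ L₂ => g (q.2 - q.1) - g q.2, by fun_prop⟩
  refine ⟨fun n => ∫ r, kernel n r * ‖Φ r‖, ?_, fun n p => ?_⟩
  · have h := tendsto_integral_kernel (G := fun r => ‖Φ r‖) (by fun_prop)
    have h0 : Φ 0 = 0 := by ext p; simp [Φ]
    simpa [h0] using h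
  · have e : conv g (kernel n) p - g p = ∫ r, (g (p - r) - g p) * kernel n r := by
      simp_rw [sub_mul]
      rw [conv_eq, integral_sub, integral_const_mul, integral_kernel, mul_one]
      · exact integrable_of_continuous ((hg.comp (continuous_const.sub continuous_id)).mul
          (continuous_kernel n))
      · exact integrable_of_continuous (continuous_const.mul (continuous_kernel n))
    rw [e, ← Real.norm_eq_abs]
    refine norm_integral_le_of_norm_le (integrable_of_continuous
      ((continuous_kernel n).mul (by fun_prop))) (Eventually.of_forall fun r => ?_)
    rw [norm_mul, mul_comm, Real.norm_of_nonneg (kernel_nonneg n r)]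
    exact mul_le_mul_of_nonneg_left ((Φ r).norm_coe_le_norm p) (kernel_nonneg n r)

/-- Mollification converges in `L²`. -/
theorem conv_kernel_tendsto_L2 {g : Torus L₁ L₂ → ℝ} (hg : MemLp g 2) :
    Tendsto (fun n => eLpNorm (fun p => FluidPlate.conv g (kernel n) p - g p) 2) atTop (𝓝 0) := by
  rw [ENNReal.tendsto_nhds_zero]
  intro ε hε
  have hε3 : ε / 3 ≠ 0 := (ENNReal.div_pos hε.ne' (by norm_num)).ne'
  -- Three thirds: uniform convergence for the continuous `g'`, and twice the distance from `g` to
  -- `g'`, once after mollification, which does not increase the L² norm.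
  obtain ⟨g', hg1, hg2⟩ := hg.exists_boundedContinuous_eLpNorm_sub_le (by norm_num) hε3
  obtain ⟨δ, hδ, hb⟩ := conv_kernel_tendstoUniformly g'.continuous
  have hlim : Tendsto (fun n => (volume (univ : Set (Torus L₁ L₂))) ^ (2 : ℝ≥0∞).toReal⁻¹ *
      ENNReal.ofReal (δ n)) atTop (𝓝 0) := by
    have := ENNReal.Tendsto.const_mul (a := (volume (univ : Set (Torus L₁ L₂))) ^ (2 : ℝ≥0∞).toReal⁻¹)
      (ENNReal.tendsto_ofReal hδ) (Or.inr (by finiteness))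
    simpa using this
  filter_upwards [(ENNReal.tendsto_nhds_zero.1 hlim) (ε / 3) (pos_iff_ne_zero.2 hε3)] with n hn
  have hgi := hg.integrable (by norm_num : (1 : ℝ≥0∞) ≤ 2)
  have hgi' := hg2.integrable (by norm_num : (1 : ℝ≥0∞) ≤ 2)
  have e : (fun p => FluidPlate.conv g (kernel n) p - g p)
      = (conv (g - ⇑g') (kernel n) + fun p => FluidPlate.conv g' (kernel n) p - g' p) + fun p => -(g - ⇑g') p := by
    funext p
    simp only [Pi.add_apply]
    rw [conv_sub hgi hgi' (continuous_kernel n)]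
    simp
  rw [e]
  have m1 : Continuous (conv (g - ⇑g') (kernel n)) :=
    continuous_conv (hgi.sub hgi') (continuous_kernel n)
  have m2 : Continuous (fun p => FluidPlate.conv g' (kernel n) p - g' p) :=
    (continuous_conv hgi' (continuous_kernel n)).sub g'.continuous
  refine (eLpNorm_add_le (m1.aestronglyMeasurable.add m2.aestronglyMeasurable)
    (hg.aestronglyMeasurable.sub hg2.aestronglyMeasurable).neg (by norm_num)).trans ?_
  have a1 : eLpNorm (conv (g - ⇑g') (kernel n)) 2 ≤ ε / 3 :=
    (eLpNorm_conv_le (hg.sub hg2) (continuous_kernel n) (kernel_nonneg n)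
      (integral_kernel n)).trans hg1
  have a2 : eLpNorm (fun p => FluidPlate.conv g' (kernel n) p - g' p) 2 ≤ ε / 3 :=
    (eLpNorm_le_of_ae_bound (Eventually.of_forall fun p => hb n p)).trans hn
  have a3 : eLpNorm (fun p => -(g - ⇑g') p) 2 ≤ ε / 3 := by
    rw [← Pi.neg_def, eLpNorm_neg]; exact hg1
  calc _ ≤ (ε / 3 + ε / 3) + ε / 3 := add_le_add
        ((eLpNorm_add_le m1.aestronglyMeasurable m2.aestronglyMeasurable
          (by norm_num)).trans (add_le_add a1 a2)) a3
    _ = ε := ENNReal.add_thirds ε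

/-- Weak derivatives are unique. -/
theorem IsWeakPdT.unique {i : Fin 2} {f f' g g' : Torus L₁ L₂ → ℝ} (h : IsWeakPdT i f g)
    (h' : IsWeakPdT i f' g') (hf : f =ᵐ[volume] f') (hg : MemLp g 2) (hg' : MemLp g' 2) :
    g =ᵐ[volume] g' := by
  -- Both mollifications equal that of `f` with the differentiated kernel, and mollifications
  -- determine the function in the L² limit.
  have e : ∀ n, FluidPlate.conv g (kernel n) = FluidPlate.conv g' (kernel n) := fun n => by
    rw [← h.conv (smoothT_kernel n), ← h'.conv (smoothT_kernel n)]
    funext p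
    refine integral_congr_ae (hf.mono fun q hq => ?_)
    simp only [hq]
  have h1 := conv_kernel_tendsto_L2 hg
  have h2 := conv_kernel_tendsto_L2 hg'
  have h3 : eLpNorm (g - g') 2 ≤ 0 := by
    refine ge_of_tendsto' (by simpa using h1.add h2) fun n => ?_
    have e2 : g - g' = (fun p => -(FluidPlate.conv g (kernel n) p - g p))
        + fun p => FluidPlate.conv g' (kernel n) p - g' p := by
      funext p; simp [e n]
    have c1 := continuous_conv (hg.integrable (by norm_num)) (continuous_kernel (L₁ := L₁) (L₂ := L₂) n)
    have c2 := continuous_conv (hg'.integrable (by norm_num)) (continuous_kernel (L₁ := L₁) (L₂ := L₂) n)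
    rw [e2]
    refine (eLpNorm_add_le (c1.aestronglyMeasurable.sub hg.aestronglyMeasurable).neg
      (c2.aestronglyMeasurable.sub hg'.aestronglyMeasurable) (by norm_num)).trans ?_
    gcongr
    · exact (eLpNorm_neg _ _ _).le
    · exact le_rfl
  have h4 := (eLpNorm_eq_zero_iff (hg.sub hg').aestronglyMeasurable (by norm_num)).1
    (le_antisymm h3 zero_le)
  filter_upwards [h4] with p hp
  simpa [sub_eq_zero] using hp

end

end FluidPlate

namespace FluidPlate

set_option linter.unusedSectionVars false

noncomputable section

variable {L₁ L₂ : ℝ} [Fact (0 < L₁)] [Fact (0 < L₂)]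

/-! ### Estimates along coordinate lines -/

/-- The period in the `i`-th direction. -/
def period (L₁ L₂ : ℝ) (i : Fin 2) : ℝ := ![L₁, L₂] i

theorem period_pos (i : Fin 2) : 0 < period L₁ L₂ i := by
  fin_cases i
  · exact (Fact.out : 0 < L₁)
  · exact (Fact.out : 0 < L₂)

theorem dirT_period (i : Fin 2) : (dirT i (period L₁ L₂ i) : Torus L₁ L₂) = 0 := by
  fin_cases i <;> ext <;> simp [dirT_apply, period, AddCircle.coe_period]

theorem exists_add_dirT (p q : Torus L₁ L₂) :
    ∃ s ∈ Icc 0 L₁, ∃ t ∈ Icc 0 L₂, q = p + dirT 0 s + dirT 1 t := by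
  obtain ⟨s, hs, h1⟩ := (AddCircle.coe_image_Icc_eq L₁ 0 ▸ mem_univ (q.1 - p.1) :
    q.1 - p.1 ∈ ((↑) : ℝ → AddCircle L₁) '' Icc 0 (0 + L₁))
  obtain ⟨t, ht, h2⟩ := (AddCircle.coe_image_Icc_eq L₂ 0 ▸ mem_univ (q.2 - p.2) :
    q.2 - p.2 ∈ ((↑) : ℝ → AddCircle L₂) '' Icc 0 (0 + L₂))
  rw [zero_add] at hs ht
  refine ⟨s, hs, t, ht, ?_⟩
  ext <;> simp [dirT_apply, h1, h2]

/-- The integral of `F` over the coordinate line through `p`. -/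
def lineInt (i : Fin 2) (F : Torus L₁ L₂ → ℝ) (p : Torus L₁ L₂) : ℝ :=
  ∫ s in (0 : ℝ)..period L₁ L₂ i, F (p + dirT i s)

/-- By translation invariance on the circle the starting point in the direction of integration is
irrelevant. A line integral thus depends on the other coordinate only. -/
theorem lineInt_zero_eq (F : Torus L₁ L₂ → ℝ) (p : Torus L₁ L₂) :
    lineInt 0 F p = ∫ x, F (x, p.2) := by
  have h := AddCircle.intervalIntegral_preimage L₁ 0 (fun x => F (p.1 + x, p.2))
  rw [zero_add] at h
  have h2 := integral_add_left_eq_self (fun x => F (x, p.2)) p.1 (μ := (volume : Measure (AddCircle L₁)))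
  rw [← h2, ← h]
  unfold lineInt
  simp only [period, Matrix.cons_val_zero]
  congr 1
  funext s
  congr 1
  ext <;> simp [dirT_apply]

theorem lineInt_one_eq (F : Torus L₁ L₂ → ℝ) (p : Torus L₁ L₂) :
    lineInt 1 F p = ∫ y, F (p.1, y) := by
  have h := AddCircle.intervalIntegral_preimage L₂ 0 (fun y => F (p.1, p.2 + y))
  rw [zero_add] at h
  have h2 := integral_add_left_eq_self (fun y => F (p.1, y)) p.2 (μ := (volume : Measure (AddCircle L₂)))
  rw [← h2, ← h]
  unfold lineInt
  simp only [period, Matrix.cons_val_one]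
  congr 1
  funext s
  congr 1
  ext <;> simp [dirT_apply]

theorem continuous_lineInt {F : Torus L₁ L₂ → ℝ} (hF : Continuous F) (i : Fin 2) :
    Continuous (lineInt i F) := by
  unfold lineInt
  refine intervalIntegral.continuous_parametric_intervalIntegral_of_continuous'
    (f := fun (p : Torus L₁ L₂) (s : ℝ) => F (p + dirT i s)) ?_ _ _
  exact hF.comp (continuous_fst.add ((dirT i).continuous_toFun.comp continuous_snd))

theorem integral_lineInt {F : Torus L₁ L₂ → ℝ} (hF : Continuous F) (i : Fin 2) :
    ∫ p, lineInt i F p = period L₁ L₂ i * ∫ p, F p := by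
  unfold lineInt
  simp only [intervalIntegral.integral_of_le (period_pos (L₁ := L₁) (L₂ := L₂) i).le]
  obtain ⟨C, -, hC⟩ := exists_bound_of_continuous hF
  rw [integral_integral_swap]
  · simp only [integral_add_right_eq_self F]
    simp [(period_pos (L₁ := L₁) (L₂ := L₂) i).le]
  · refine Integrable.of_bound (C := C) ?_ (Eventually.of_forall fun q => hC _)
    exact (hF.comp (continuous_fst.add ((dirT i).continuous_toFun.comp
      continuous_snd))).aestronglyMeasurable

section LineBounds

variable {i : Fin 2} {G G' : Torus L₁ L₂ → ℝ}

theorem HasPd.abs_sub_le_lineInt (h : HasPd (dirT i) G G') (p : Torus L₁ L₂) {s : ℝ}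
    (hs : s ∈ Icc 0 (period L₁ L₂ i)) :
    |G (p + dirT i s) - G p| ≤ lineInt i (fun q => |G' q|) p := by
  have h1 := h.integral_line p 0 s
  rw [map_zero, add_zero] at h1
  rw [← h1]
  calc |∫ r in (0 : ℝ)..s, G' (p + dirT i r)| ≤ ∫ r in (0 : ℝ)..s, |G' (p + dirT i r)| :=
        intervalIntegral.abs_integral_le_integral_abs hs.1
    _ ≤ _ := by
      refine intervalIntegral.integral_mono_interval le_rfl hs.1 hs.2
        (Eventually.of_forall fun r => abs_nonneg _) ?_
      exact (HasPd.continuous_line h.cont'.abs (dirT i) p).intervalIntegrable _ _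

/-- The value at `p` differs from the value at each point of the line by at most the line integral
of the derivative; averaging over one period gives the bound. -/
theorem HasPd.abs_le_lineInt (h : HasPd (dirT i) G G') (p : Torus L₁ L₂) :
    |G p| ≤ lineInt i (fun q => (period L₁ L₂ i)⁻¹ * |G q| + |G' q|) p := by
  have hL := period_pos (L₁ := L₁) (L₂ := L₂) i
  have c1 := HasPd.continuous_line h.cont.abs (dirT i) p
  have c2 := HasPd.continuous_line h.cont'.abs (dirT i) p
  have h1 : ∫ _s in (0 : ℝ)..period L₁ L₂ i, |G p| ≤ ∫ s in (0 : ℝ)..period L₁ L₂ i,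
      (|G (p + dirT i s)| + lineInt i (fun q => |G' q|) p) := by
    refine intervalIntegral.integral_mono_on hL.le (by simp)
      ((c1.add continuous_const).intervalIntegrable _ _) fun s hs => ?_
    have h2 := h.abs_sub_le_lineInt p hs
    have h3 := abs_sub_abs_le_abs_sub (G p) (G (p + dirT i s))
    rw [abs_sub_comm] at h3
    linarith
  rw [intervalIntegral.integral_add (c1.intervalIntegrable _ _) (by simp)] at h1
  simp only [intervalIntegral.integral_const, sub_zero, smul_eq_mul] at h1
  unfold lineInt at h1 ⊢
  rw [intervalIntegral.integral_add ((c1.const_mul _).intervalIntegrable _ _)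
    (c2.intervalIntegrable _ _), intervalIntegral.integral_const_mul]
  have h4 := mul_le_mul_of_nonneg_left h1 (inv_nonneg.2 hL.le)
  rwa [inv_mul_cancel_left₀ hL.ne', mul_add, inv_mul_cancel_left₀ hL.ne'] at h4

/-- Poincaré inequality for derivatives of periodic functions. -/
theorem HasPd.integral_sq_le {H : Torus L₁ L₂ → ℝ} (hH : HasPd (dirT i) H G)
    (h : HasPd (dirT i) G G') :
    ∫ p, G p ^ 2 ≤ period L₁ L₂ i ^ 2 * ∫ p, G' p ^ 2 := by
  set L := period L₁ L₂ i with hLdef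
  have hL : 0 < L := period_pos i
  have key : ∀ p, G p ^ 2 ≤ L * lineInt i (fun q => G' q ^ 2) p := by
    intro p
    -- A derivative has mean zero on every closed coordinate line, because moving by a full period
    -- is the identity.
    have h0 : ∫ s in (0 : ℝ)..L, G (p + dirT i s) = 0 := by
      rw [hH.integral_line, hLdef, dirT_period]; simp
    have c1 := HasPd.continuous_line h.cont (dirT i) p
    have c2 := HasPd.continuous_line h.cont' (dirT i) p
    set A := lineInt i (fun q => |G' q|) p with hA
    have h1 : |L * G p| ≤ L * A := by
      have : L * G p = ∫ s in (0 : ℝ)..L, (G p - G (p + dirT i s)) := by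
        rw [intervalIntegral.integral_sub (by simp) (c1.intervalIntegrable _ _), h0]
        simp
      rw [this]
      have h2 := intervalIntegral.norm_integral_le_of_norm_le_const (a := 0) (b := L) (C := A)
        (f := fun s => G p - G (p + dirT i s)) (fun s hs => by
          rw [uIoc_of_le hL.le] at hs
          rw [Real.norm_eq_abs, abs_sub_comm]
          exact h.abs_sub_le_lineInt p ⟨hs.1.le, hs.2⟩)
      rw [sub_zero, abs_of_pos hL, Real.norm_eq_abs] at h2
      linarith
    have h2 : |G p| ≤ A := by
      rw [abs_mul, abs_of_pos hL] at h1
      exact le_of_mul_le_mul_left h1 hL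
    have h3 : A ^ 2 ≤ L * lineInt i (fun q => G' q ^ 2) p := by
      -- Cauchy–Schwarz against the constant function, obtained by expanding a square.
      have h4 : 0 ≤ ∫ s in (0 : ℝ)..L, (L * |G' (p + dirT i s)| - A) ^ 2 :=
        intervalIntegral.integral_nonneg hL.le fun s _ => sq_nonneg _
      have e : ∀ s : ℝ, (L * |G' (p + dirT i s)| - A) ^ 2
          = (L ^ 2 * G' (p + dirT i s) ^ 2 - 2 * L * A * |G' (p + dirT i s)|) + A ^ 2 := by
        intro s; rw [← sq_abs (G' _)]; ring
      simp_rw [e] at h4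
      have d1 : Continuous fun s : ℝ => L ^ 2 * G' (p + dirT i s) ^ 2 :=
        continuous_const.mul (c2.pow 2)
      have d2 : Continuous fun s : ℝ => 2 * L * A * |G' (p + dirT i s)| :=
        continuous_const.mul c2.abs
      rw [intervalIntegral.integral_add
        (f := fun s : ℝ => L ^ 2 * G' (p + dirT i s) ^ 2 - 2 * L * A * |G' (p + dirT i s)|)
        ((d1.sub d2).intervalIntegrable _ _) (continuous_const.intervalIntegrable _ _),
        intervalIntegral.integral_sub (d1.intervalIntegrable _ _) (d2.intervalIntegrable _ _),
        intervalIntegral.integral_const_mul, intervalIntegral.integral_const_mul] at h4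
      have e2 : ∫ s in (0 : ℝ)..L, |G' (p + dirT i s)| = A := rfl
      have e3 : ∫ s in (0 : ℝ)..L, G' (p + dirT i s) ^ 2
        = lineInt i (fun q => G' q ^ 2) p := rfl
      rw [e2, e3] at h4
      simp only [intervalIntegral.integral_const, sub_zero, smul_eq_mul] at h4
      have h5 : 0 ≤ L * (L * lineInt i (fun q => G' q ^ 2) p - A ^ 2) := by nlinarith
      have := nonneg_of_mul_nonneg_right h5 hL
      linarith
    calc G p ^ 2 = |G p| ^ 2 := (sq_abs _).symm
      _ ≤ A ^ 2 := by gcongr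
      _ ≤ _ := h3
  calc ∫ p, G p ^ 2 ≤ ∫ p, L * lineInt i (fun q => G' q ^ 2) p :=
        integral_mono (integrable_of_continuous (h.cont.pow 2))
          (integrable_of_continuous (continuous_const.mul (continuous_lineInt (h.cont'.pow 2) i)))
          key
    _ = _ := by rw [integral_const_mul, integral_lineInt (F := fun q => G' q ^ 2) (h.cont'.pow 2)]; ring

end LineBounds

/-- The Loomis–Whitney (Gagliardo–Nirenberg) inequality on the two-dimensional torus. -/
theorem integral_sq_le_of_hasPd {G : Torus L₁ L₂ → ℝ} {D : Fin 2 → Torus L₁ L₂ → ℝ}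
    (h : ∀ i, HasPd (dirT i) G (D i)) :
    ∫ p, G p ^ 2 ≤ (∫ p, (L₁⁻¹ * |G p| + |D 0 p|)) * ∫ p, (L₂⁻¹ * |G p| + |D 1 p|) := by
  set F₀ : Torus L₁ L₂ → ℝ := fun p => L₁⁻¹ * |G p| + |D 0 p|
  set F₁ : Torus L₁ L₂ → ℝ := fun p => L₂⁻¹ * |G p| + |D 1 p|
  have c0 : Continuous F₀ := (continuous_const.mul (h 0).cont.abs).add (h 0).cont'.abs
  have c1 : Continuous F₁ := (continuous_const.mul (h 1).cont.abs).add (h 1).cont'.abs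
  have i0 := integrable_of_continuous c0
  have i1 := integrable_of_continuous c1
  -- One bound depends on `p.2` only, the other on `p.1` only. Their product bounds the square and
  -- integrates to a product.
  have b0 : ∀ p : Torus L₁ L₂, |G p| ≤ ∫ x, F₀ (x, p.2) := fun p => by
    rw [← lineInt_zero_eq F₀ p]; exact (h 0).abs_le_lineInt p
  have b1 : ∀ p : Torus L₁ L₂, |G p| ≤ ∫ y, F₁ (p.1, y) := fun p => by
    rw [← lineInt_one_eq F₁ p]; exact (h 1).abs_le_lineInt p
  have e0 : ∫ p, F₀ p = ∫ y, ∫ x, F₀ (x, y) := integral_prod_symm _ i0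
  have e1 : ∫ p, F₁ p = ∫ x, ∫ y, F₁ (x, y) := integral_prod _ i1
  have e2 := integral_prod_mul (μ := (volume : Measure (AddCircle L₁)))
    (ν := (volume : Measure (AddCircle L₂))) (fun x => ∫ y, F₁ (x, y)) (fun y => ∫ x, F₀ (x, y))
  rw [e0, e1, mul_comm, ← e2]
  refine integral_mono (integrable_of_continuous ((h 0).cont.pow 2)) ?_ fun p => ?_
  · exact Integrable.mul_prod i1.integral_prod_left i0.integral_prod_right
  · calc G p ^ 2 = |G p| * |G p| := by rw [← sq_abs, sq]
      _ ≤ _ := mul_le_mul (b1 p) (b0 p) (abs_nonneg _) ((abs_nonneg _).trans (b1 p))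

theorem integral_lineInt_le_zero {F : Torus L₁ L₂ → ℝ} (hF : Continuous F) (p : Torus L₁ L₂) :
    lineInt 0 (lineInt 1 F) p = ∫ q, F q := by
  rw [lineInt_zero_eq]
  simp only [lineInt_one_eq]
  exact (integral_prod _ (integrable_of_continuous hF)).symm

theorem integral_lineInt_le_one {F : Torus L₁ L₂ → ℝ} (hF : Continuous F) (p : Torus L₁ L₂) :
    lineInt 1 (lineInt 0 F) p = ∫ q, F q := by
  rw [lineInt_one_eq]
  simp only [lineInt_zero_eq]
  exact (integral_prod_symm _ (integrable_of_continuous hF)).symm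

theorem lineInt_mono {F F' : Torus L₁ L₂ → ℝ} (hF : Continuous F) (hF' : Continuous F')
    (h : ∀ p, F p ≤ F' p) (i : Fin 2) (p : Torus L₁ L₂) : lineInt i F p ≤ lineInt i F' p :=
  intervalIntegral.integral_mono_on (period_pos i).le
    ((HasPd.continuous_line hF (dirT i) p).intervalIntegrable _ _)
    ((HasPd.continuous_line hF' (dirT i) p).intervalIntegrable _ _) fun _ _ => h _

/-- The oscillation of a twice differentiable function on the torus. -/
theorem abs_sub_le_of_hasPd {H : Torus L₁ L₂ → ℝ} {D : Fin 2 → Torus L₁ L₂ → ℝ}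
    {D2 : Fin 2 → Fin 2 → Torus L₁ L₂ → ℝ} (h : ∀ i, HasPd (dirT i) H (D i))
    (h2 : ∀ i j, HasPd (dirT j) (D i) (D2 i j)) (p q : Torus L₁ L₂) :
    |H q - H p| ≤ (∫ r, (L₂⁻¹ * |D 0 r| + |D2 0 1 r|)) + ∫ r, (L₁⁻¹ * |D 1 r| + |D2 1 0 r|) := by
  obtain ⟨s, hs, t, ht, rfl⟩ := exists_add_dirT p q
  have c0 : Continuous fun r => L₂⁻¹ * |D 0 r| + |D2 0 1 r| :=
    (continuous_const.mul (h 0).cont'.abs).add (h2 0 1).cont'.abs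
  have c1 : Continuous fun r => L₁⁻¹ * |D 1 r| + |D2 1 0 r| :=
    (continuous_const.mul (h 1).cont'.abs).add (h2 1 0).cont'.abs
  -- Moving along the first direction costs a line integral of |∂₀H|; each of its values costs a
  -- line integral in the second direction. The iterated line integral is the integral over the
  -- torus, so only a mixed second derivative appears.
  have a1 : |H (p + dirT 0 s) - H p| ≤ ∫ r, (L₂⁻¹ * |D 0 r| + |D2 0 1 r|) := by
    refine ((h 0).abs_sub_le_lineInt p hs).trans ?_
    rw [← integral_lineInt_le_zero c0 p]
    exact lineInt_mono (h 0).cont'.abs (continuous_lineInt c0 1)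
      (fun r => (h2 0 1).abs_le_lineInt r) 0 p
  have a2 : |H (p + dirT 0 s + dirT 1 t) - H (p + dirT 0 s)|
      ≤ ∫ r, (L₁⁻¹ * |D 1 r| + |D2 1 0 r|) := by
    refine ((h 1).abs_sub_le_lineInt (p + dirT 0 s) ht).trans ?_
    rw [← integral_lineInt_le_one c1 (p + dirT 0 s)]
    exact lineInt_mono (h 1).cont'.abs (continuous_lineInt c1 0)
      (fun r => (h2 1 0).abs_le_lineInt r) 1 _
  calc _ ≤ |H (p + dirT 0 s) - H p| + |H (p + dirT 0 s + dirT 1 t) - H (p + dirT 0 s)| := by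
        rw [add_comm (|H (p + dirT 0 s) - H p|)]
        exact abs_sub_le (H (p + dirT 0 s + dirT 1 t)) (H (p + dirT 0 s)) (H p)
    _ ≤ _ := add_le_add a1 a2

/-! ### Sobolev embedding of the square root -/

/-- If `N = n²` with `n ≤ E` and `|∇N| ≤ 2 n E κ`, then all norms of `N` are controlled by the
quadratic mean of `E` and the norms of `κ`. -/
theorem lintegral_pow_le_of_hasPd {k : ℕ} (hk : 0 < k) {N E κ : Torus L₁ L₂ → ℝ}
    {D : Fin 2 → Torus L₁ L₂ → ℝ} (h : ∀ i, HasPd (dirT i) N (D i)) (hN : ∀ p, 0 ≤ N p)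
    (hE : Continuous E) (hκ : Continuous κ) (hκ1 : ∀ p, 1 ≤ κ p) (hNE : ∀ p, √(N p) ≤ E p)
    (hD : ∀ i p, |D i p| ≤ 2 * √(N p) * E p * κ p) :
    ∫⁻ p, ENNReal.ofReal (N p) ^ (2 * k) ≤ ENNReal.ofReal (L₁⁻¹ + L₂⁻¹ + 2 * k) ^ (4 * k)
      * (∫⁻ p, ENNReal.ofReal (E p) ^ 2) ^ (2 * k) * ∫⁻ p, ENNReal.ofReal (κ p) ^ (4 * k) := by
  have hL1 : 0 < L₁⁻¹ := inv_pos.2 Fact.out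
  have hL2 : 0 < L₂⁻¹ := inv_pos.2 Fact.out
  have hE0 : ∀ p, 0 ≤ E p := fun p => (Real.sqrt_nonneg _).trans (hNE p)
  have hκ0 : ∀ p, 0 ≤ κ p := fun p => zero_le_one.trans (hκ1 p)
  set a := L₁⁻¹ + L₂⁻¹ + 2 * k with ha
  have ha0 : 0 < a := by positivity
  have cN : Continuous N := (h 0).cont
  -- A common majorant, up to constants, of `N ^ k` and its gradient, to which Loomis–Whitney is
  -- applied.
  set I : Torus L₁ L₂ → ℝ := fun p => N p ^ (k - 1) * √(N p) * E p * κ p with hI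
  have cI : Continuous I := (((cN.pow _).mul cN.sqrt).mul hE).mul hκ
  have hI0 : ∀ p, 0 ≤ I p := fun p =>
    mul_nonneg (mul_nonneg (mul_nonneg (pow_nonneg (hN p) _) (Real.sqrt_nonneg _)) (hE0 p)) (hκ0 p)
  have bG : ∀ p, |N p ^ k| ≤ I p := by
    intro p
    rw [abs_of_nonneg (pow_nonneg (hN p) k), hI]
    obtain ⟨m, rfl⟩ : ∃ m, k = m + 1 := ⟨k - 1, by omega⟩
    simp only [Nat.add_sub_cancel]
    calc N p ^ (m + 1) = N p ^ m * √(N p) * √(N p) * 1 := by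
          rw [mul_one, mul_assoc, Real.mul_self_sqrt (hN p), pow_succ]
      _ ≤ N p ^ m * √(N p) * E p * κ p := by
          have := hNE p
          have := hκ1 p
          have h0 := pow_nonneg (hN p) m
          have h1 := mul_nonneg h0 (Real.sqrt_nonneg (N p))
          have h2 := mul_nonneg h1 (hE0 p)
          gcongr
  have bD : ∀ i p, |(k : ℝ) * N p ^ (k - 1) * D i p| ≤ 2 * k * I p := by
    intro i p
    rw [abs_mul, abs_of_nonneg (mul_nonneg (Nat.cast_nonneg k) (pow_nonneg (hN p) _))]
    calc _ ≤ (k : ℝ) * N p ^ (k - 1) * (2 * √(N p) * E p * κ p) :=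
          mul_le_mul_of_nonneg_left (hD i p)
            (mul_nonneg (Nat.cast_nonneg k) (pow_nonneg (hN p) _))
      _ = _ := by simp only [hI]; ring
  have hG := fun i => (h i).pow k
  have key : ∫ p, (N p ^ k) ^ 2 ≤ (a * ∫ p, I p) ^ 2 := by
    refine (integral_sq_le_of_hasPd hG).trans ?_
    rw [sq, ← integral_const_mul a I]
    have iI := integrable_of_continuous (continuous_const.mul cI : Continuous fun p => a * I p)
    refine mul_le_mul (integral_mono (integrable_of_continuous ?_) iI fun p => ?_)
      (integral_mono (integrable_of_continuous ?_) iI fun p => ?_)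
      (integral_nonneg fun p => ?_) (integral_nonneg fun p => ?_)
    · exact (continuous_const.mul (hG 0).cont.abs).add (hG 0).cont'.abs
    · have := mul_le_mul_of_nonneg_left (bG p) hL1.le
      have := bD 0 p
      have := mul_nonneg hL2.le (hI0 p)
      simp only [ha]
      linarith
    · exact (continuous_const.mul (hG 1).cont.abs).add (hG 1).cont'.abs
    · have := mul_le_mul_of_nonneg_left (bG p) hL2.le
      have := bD 1 p
      have := mul_nonneg hL1.le (hI0 p)
      simp only [ha]
      linarith
    · positivity
    · exact mul_nonneg ha0.le (hI0 p)
  set Y := ∫⁻ p, ENNReal.ofReal (N p) ^ (2 * k) with hY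
  set Q := ∫⁻ p, ENNReal.ofReal (E p) ^ 2 with hQ
  set K := ∫⁻ p, ENNReal.ofReal (κ p) ^ (4 * k) with hK
  have hYe : Y = ENNReal.ofReal (∫ p, (N p ^ k) ^ 2) := by
    rw [ofReal_integral_eq_lintegral_ofReal (integrable_of_continuous (f := fun p => (N p ^ k) ^ 2) ((cN.pow k).pow 2))
      (Eventually.of_forall fun p => sq_nonneg _)]
    refine lintegral_congr fun p => ?_
    rw [← ENNReal.ofReal_pow (hN p), ← pow_mul, mul_comm 2 k]
  have hIe : ENNReal.ofReal (∫ p, I p) = ∫⁻ p, ENNReal.ofReal (I p) :=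
    ofReal_integral_eq_lintegral_ofReal (integrable_of_continuous cI) (Eventually.of_forall hI0)
  have k0 : (0 : ℝ) < k := by exact_mod_cast hk
  -- Hölder with three exponents of sum one, chosen so that the factors of `I` are powers of `N ^
  -- (2k)`, `E²` and `κ ^ (4k)`.
  have hold : ∫⁻ p, ENNReal.ofReal (I p)
      ≤ Y ^ ((2 * k - 1) / (4 * k) : ℝ) * Q ^ (1 / 2 : ℝ) * K ^ (1 / (4 * k) : ℝ) := by
    have hh := ENNReal.lintegral_prod_norm_pow_le (μ := (volume : Measure (Torus L₁ L₂)))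
      (Finset.univ : Finset (Fin 3))
      (f := ![fun p => ENNReal.ofReal (N p) ^ (2 * k), fun p => ENNReal.ofReal (E p) ^ 2,
        fun p => ENNReal.ofReal (κ p) ^ (4 * k)])
      (p := ![((2 * k - 1) / (4 * k) : ℝ), (1 / 2 : ℝ), (1 / (4 * k) : ℝ)])
      (by
        intro i _
        fin_cases i
        · exact (cN.measurable.ennreal_ofReal.pow_const _).aemeasurable
        · exact (hE.measurable.ennreal_ofReal.pow_const _).aemeasurable
        · exact (hκ.measurable.ennreal_ofReal.pow_const _).aemeasurable)
      (by simp [Fin.sum_univ_three]; field_simp; ring)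
      (by
        have : (1 : ℝ) ≤ k := by exact_mod_cast hk
        intro i _
        fin_cases i
        · exact div_nonneg (by linarith) (by positivity)
        · norm_num
        · exact div_nonneg zero_le_one (by positivity))
    simp only [Fin.prod_univ_three, Matrix.cons_val_zero, Matrix.cons_val_one,
      Matrix.cons_val_two] at hh
    refine le_trans (lintegral_mono fun p => le_of_eq ?_) hh
    change _ = (ENNReal.ofReal (N p) ^ (2 * k)) ^ ((2 * k - 1) / (4 * k) : ℝ)
      * (ENNReal.ofReal (E p) ^ 2) ^ (1 / 2 : ℝ)
      * (ENNReal.ofReal (κ p) ^ (4 * k)) ^ (1 / (4 * k) : ℝ)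
    have e1 : (ENNReal.ofReal (E p) ^ 2) ^ (1 / 2 : ℝ) = ENNReal.ofReal (E p) := by
      rw [← ENNReal.rpow_natCast, ← ENNReal.rpow_mul]; simp
    have e2 : (ENNReal.ofReal (κ p) ^ (4 * k)) ^ (1 / (4 * k) : ℝ) = ENNReal.ofReal (κ p) := by
      rw [← ENNReal.rpow_natCast, ← ENNReal.rpow_mul]
      push_cast
      rw [mul_one_div_cancel (by positivity), ENNReal.rpow_one]
    have e3 : (ENNReal.ofReal (N p) ^ (2 * k)) ^ ((2 * k - 1) / (4 * k) : ℝ)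
        = ENNReal.ofReal (N p ^ (k - 1) * √(N p)) := by
      rw [← ENNReal.ofReal_pow (hN p), ENNReal.ofReal_rpow_of_nonneg (pow_nonneg (hN p) _)]
      · congr 1
        rw [← Real.rpow_natCast, ← Real.rpow_mul (hN p), Real.sqrt_eq_rpow, ← Real.rpow_natCast]
        have e4 : ((2 * k : ℕ) : ℝ) * ((2 * k - 1) / (4 * k)) = ((k - 1 : ℕ) : ℝ) + 1 / 2 := by
          rw [Nat.cast_sub hk]; push_cast; field_simp; ring
        rw [e4, Real.rpow_add_of_nonneg (hN p) (Nat.cast_nonneg _) (by norm_num)]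
      · have : (1 : ℝ) ≤ k := by exact_mod_cast hk
        exact div_nonneg (by linarith) (by positivity)
    rw [e1, e2, e3, hI, ENNReal.ofReal_mul, ENNReal.ofReal_mul]
    · exact mul_nonneg (pow_nonneg (hN p) _) (Real.sqrt_nonneg _)
    · exact mul_nonneg (mul_nonneg (pow_nonneg (hN p) _) (Real.sqrt_nonneg _)) (hE0 p)
  have main : Y ≤ (ENNReal.ofReal a * (Y ^ ((2 * k - 1) / (4 * k) : ℝ) * Q ^ (1 / 2 : ℝ)
      * K ^ (1 / (4 * k) : ℝ))) ^ 2 := by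
    calc Y ≤ ENNReal.ofReal ((a * ∫ p, I p) ^ 2) := by
          rw [hYe]; exact ENNReal.ofReal_le_ofReal key
      _ = (ENNReal.ofReal a * ∫⁻ p, ENNReal.ofReal (I p)) ^ 2 := by
          rw [ENNReal.ofReal_pow (mul_nonneg ha0.le (integral_nonneg hI0)),
            ENNReal.ofReal_mul ha0.le, hIe]
      _ ≤ _ := by gcongr
  rcases eq_or_ne Y 0 with h0 | h0
  · rw [h0]; exact zero_le
  -- `Y` occurs on both sides, on the right with exponent (2k−1)/(2k) < 1. Being finite and nonzero,
  -- it may be divided out, which leaves a bound for its power 1/(2k).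
  have hYt : Y ≠ ⊤ := by rw [hYe]; exact ENNReal.ofReal_ne_top
  have e5 : (ENNReal.ofReal a * (Y ^ ((2 * k - 1) / (4 * k) : ℝ) * Q ^ (1 / 2 : ℝ)
      * K ^ (1 / (4 * k) : ℝ))) ^ 2
      = (ENNReal.ofReal a ^ 2 * Q * K ^ (1 / (2 * k) : ℝ)) * Y ^ ((2 * k - 1) / (2 * k) : ℝ) := by
    simp only [mul_pow]
    have : ∀ (x : ℝ≥0∞) (y : ℝ), (x ^ y) ^ 2 = x ^ (y * 2) := fun x y => by
      rw [← ENNReal.rpow_natCast, ← ENNReal.rpow_mul]; norm_num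
    rw [this, this, this]
    have f1 : ((2 * k - 1) / (4 * k) : ℝ) * 2 = (2 * k - 1) / (2 * k) := by field_simp; ring
    have f2 : (1 / (4 * k) : ℝ) * 2 = 1 / (2 * k) := by field_simp; ring
    rw [f1, f2]
    norm_num
    ring
  rw [e5] at main
  have e6 : Y = Y ^ (1 / (2 * k) : ℝ) * Y ^ ((2 * k - 1) / (2 * k) : ℝ) := by
    rw [← ENNReal.rpow_add _ _ h0 hYt]
    have : (1 / (2 * k) + (2 * k - 1) / (2 * k) : ℝ) = 1 := by field_simp; ring
    rw [this, ENNReal.rpow_one]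
  have m2 : Y ^ (1 / (2 * k) : ℝ) ≤ ENNReal.ofReal a ^ 2 * Q * K ^ (1 / (2 * k) : ℝ) := by
    have h7 : Y ^ ((2 * k - 1) / (2 * k) : ℝ) ≠ 0 := by
      intro h; rw [ENNReal.rpow_eq_zero_iff] at h
      rcases h with h | h
      · exact h0 h.1
      · exact hYt h.1
    have h8 : Y ^ ((2 * k - 1) / (2 * k) : ℝ) ≠ ⊤ := by
      refine ENNReal.rpow_ne_top_of_nonneg ?_ hYt
      have : (1 : ℝ) ≤ k := by exact_mod_cast hk
      exact div_nonneg (by linarith) (by positivity)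
    refine (ENNReal.mul_le_mul_iff_left h7 h8).1 ?_
    rw [← e6]; exact main
  have e9 : ∀ x : ℝ≥0∞, (x ^ (1 / (2 * k) : ℝ)) ^ (2 * k) = x := fun x => by
    rw [← ENNReal.rpow_natCast, ← ENNReal.rpow_mul]
    push_cast
    rw [one_div_mul_cancel (by positivity), ENNReal.rpow_one]
  calc Y = (Y ^ (1 / (2 * k) : ℝ)) ^ (2 * k) := (e9 Y).symm
    _ ≤ (ENNReal.ofReal a ^ 2 * Q * K ^ (1 / (2 * k) : ℝ)) ^ (2 * k) := by gcongr
    _ = _ := by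
      rw [mul_pow, mul_pow, e9, ← pow_mul]
      congr 3
      ring

end

end FluidPlate

/-! ### Functions in H² on the torus: approximation, oscillation, slope and logarithmic gradient -/

namespace FluidPlate

set_option linter.unusedSectionVars false

noncomputable section

/-- Fatou's lemma in the form that carries bounds for smooth approximants to a limit known only
almost everywhere. -/
theorem lintegral_le_of_tendsto {α : Type*} [MeasurableSpace α] {μ : Measure α}
    {F : ℕ → α → ℝ≥0∞} {f : α → ℝ≥0∞} {c : ℕ → ℝ≥0∞} {C : ℝ≥0∞}
    (hm : ∀ n, AEMeasurable (F n) μ) (h : ∀ᵐ x ∂μ, Tendsto (fun n => F n x) atTop (𝓝 (f x)))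
    (hc : ∀ n, ∫⁻ x, F n x ∂μ ≤ c n) (hC : Tendsto c atTop (𝓝 C)) : ∫⁻ x, f x ∂μ ≤ C :=
  calc ∫⁻ x, f x ∂μ = ∫⁻ x, liminf (fun n => F n x) atTop ∂μ :=
        lintegral_congr_ae (h.mono fun x hx => hx.liminf_eq.symm)
    _ ≤ liminf (fun n => ∫⁻ x, F n x ∂μ) atTop := lintegral_liminf_le' hm
    _ ≤ liminf c atTop := liminf_le_liminf (Eventually.of_forall hc)
    _ = C := hC.liminf_eq

theorem integral_abs_le_sqrt {α : Type*} [MeasurableSpace α] {μ : Measure α} [IsFiniteMeasure μ]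
    {f : α → ℝ} (hf : MemLp f 2 μ) :
    ∫ x, |f x| ∂μ ≤ √(μ.real univ) * √(∫ x, f x ^ 2 ∂μ) := by
  have hi : Integrable f μ := hf.integrable (by norm_num)
  set A := ∫ x, |f x| ∂μ with hA
  set V := μ.real univ with hV
  set B := ∫ x, f x ^ 2 ∂μ with hB
  have hA0 : 0 ≤ A := integral_nonneg fun _ => abs_nonneg _
  have hV0 : 0 ≤ V := measureReal_nonneg
  have h1 : 0 ≤ ∫ x, (V * |f x| - A) ^ 2 ∂μ := integral_nonneg fun _ => sq_nonneg _
  have e : ∀ x, (V * |f x| - A) ^ 2 = (V ^ 2 * f x ^ 2 - 2 * V * A * |f x|) + A ^ 2 := by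
    intro x; rw [← sq_abs (f x)]; ring
  simp_rw [e] at h1
  rw [integral_add (f := fun x => V ^ 2 * f x ^ 2 - 2 * V * A * |f x|)
    ((hf.integrable_sq.const_mul _).sub (hi.abs.const_mul _)) (integrable_const _),
    integral_sub (hf.integrable_sq.const_mul _) (hi.abs.const_mul _), integral_const_mul,
    integral_const_mul, integral_const, smul_eq_mul, ← hA, ← hB, ← hV] at h1
  rw [← Real.sqrt_mul hV0]
  refine Real.le_sqrt_of_sq_le ?_
  rcases hV0.eq_or_lt with h0 | h0
  · have hz : A = 0 := by
      have : μ univ = 0 := by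
        rcases (ENNReal.toReal_eq_zero_iff _).1 h0.symm with h | h
        · exact h
        · exact absurd h (measure_ne_top μ univ)
      have := Measure.measure_univ_eq_zero.1 this
      rw [hA, this, integral_zero_measure]
    rw [hz, ← h0]; simp
  · nlinarith

variable {L₁ L₂ : ℝ} [Fact (0 < L₁)] [Fact (0 < L₂)]

/-- The square of the `L²` norm of the Laplacian. -/
def lapSq (D2f : Torus L₁ L₂ → Fin 2 → Fin 2 → ℝ) : ℝ := ∫ p, (∑ i, D2f p i i) ^ 2

theorem lapSq_nonneg (D2f : Torus L₁ L₂ → Fin 2 → Fin 2 → ℝ) : 0 ≤ lapSq D2f :=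
  integral_nonneg fun _ => sq_nonneg _

/-- The Hessian is controlled by the Laplacian on the torus. -/
theorem integral_hess_sq_le {g κ : Torus L₁ L₂ → ℝ} (hg : Integrable g) (hκ : SmoothT κ)
    (i j : Fin 2) : ∫ p, conv g (pdT j (pdT i κ)) p ^ 2
      ≤ ∫ p, (∑ i, conv g (pdT i (pdT i κ)) p) ^ 2 := by
  have hc : ∀ i j, Continuous (conv g (pdT j (pdT i κ))) := fun i j =>
    continuous_conv hg (((hκ.pdT i).pdT j).hasPd 0).cont
  -- Two integrations by parts turn the product of pure second derivatives into the square of the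
  -- mixed one, so the squared Laplacian integrates to a sum of squares.
  have hm : ∫ p, conv g (pdT 0 (pdT 0 κ)) p * conv g (pdT 1 (pdT 1 κ)) p
      = ∫ p, conv g (pdT 1 (pdT 0 κ)) p * conv g (pdT 1 (pdT 0 κ)) p := by
    rw [(((hκ.pdT 0).hasPd 0).conv hg).integral_mul_deriv
        ((((hκ.pdT 1).pdT 1).hasPd 0).conv hg),
      (((hκ.pdT 0).hasPd 1).conv hg).integral_mul_deriv
        ((((hκ.pdT 0).pdT 1).hasPd 1).conv hg),
      (hκ.pdT 1).pdT_comm 0 1, hκ.pdT_comm 0 1]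
  have hs : conv g (pdT 0 (pdT 1 κ)) = conv g (pdT 1 (pdT 0 κ)) := by rw [hκ.pdT_comm]
  have i0 : Integrable fun p => conv g (pdT 0 (pdT 0 κ)) p ^ 2 :=
    integrable_of_continuous ((hc 0 0).pow 2)
  have i1 : Integrable fun p => conv g (pdT 1 (pdT 1 κ)) p ^ 2 :=
    integrable_of_continuous ((hc 1 1).pow 2)
  have i2 : Integrable fun p => conv g (pdT 0 (pdT 0 κ)) p * conv g (pdT 1 (pdT 1 κ)) p :=
    integrable_of_continuous ((hc 0 0).mul (hc 1 1))
  have e : ∫ p, (∑ i, conv g (pdT i (pdT i κ)) p) ^ 2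
      = (∫ p, conv g (pdT 0 (pdT 0 κ)) p ^ 2) + (∫ p, conv g (pdT 1 (pdT 1 κ)) p ^ 2)
        + 2 * ∫ p, conv g (pdT 1 (pdT 0 κ)) p ^ 2 := by
    have e1 : ∀ p, (∑ i, conv g (pdT i (pdT i κ)) p) ^ 2
        = (conv g (pdT 0 (pdT 0 κ)) p ^ 2 + conv g (pdT 1 (pdT 1 κ)) p ^ 2)
          + 2 * (conv g (pdT 0 (pdT 0 κ)) p * conv g (pdT 1 (pdT 1 κ)) p) := by
      intro p; rw [Fin.sum_univ_two]; ring
    simp_rw [e1]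
    rw [integral_add (f := fun p => conv g (pdT 0 (pdT 0 κ)) p ^ 2
      + conv g (pdT 1 (pdT 1 κ)) p ^ 2) (i0.add i1) (i2.const_mul 2), integral_add i0 i1,
      integral_const_mul, hm]
    simp only [sq]
  have p0 : 0 ≤ ∫ p, conv g (pdT 0 (pdT 0 κ)) p ^ 2 := integral_nonneg fun _ => sq_nonneg _
  have p1 : 0 ≤ ∫ p, conv g (pdT 1 (pdT 1 κ)) p ^ 2 := integral_nonneg fun _ => sq_nonneg _
  have p2 : 0 ≤ ∫ p, conv g (pdT 1 (pdT 0 κ)) p ^ 2 := integral_nonneg fun _ => sq_nonneg _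
  rw [e]
  fin_cases i <;> fin_cases j <;> simp only [Fin.zero_eta, Fin.mk_one, Fin.isValue] <;>
    (try rw [hs]) <;> linarith

/-- Approximation of a function with weak Hessian by twice differentiable ones. -/
structure IsApprox (h : Torus L₁ L₂ → ℝ) (Dh : Torus L₁ L₂ → Fin 2 → ℝ) (S : ℝ)
    (H : ℕ → Torus L₁ L₂ → ℝ) (H1 : ℕ → Fin 2 → Torus L₁ L₂ → ℝ)
    (H2 : ℕ → Fin 2 → Fin 2 → Torus L₁ L₂ → ℝ) (ε : ℕ → ℝ) : Prop where
  pd : ∀ n i, HasPd (dirT i) (H n) (H1 n i)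
  pd2 : ∀ n i j, HasPd (dirT j) (H1 n i) (H2 n i j)
  tendsto_zero : Tendsto ε atTop (𝓝 0)
  abs_le : ∀ n p, |H n p - h p| ≤ ε n
  grad_L2 : ∀ i, Tendsto (fun n => eLpNorm (fun p => H1 n i p - Dh p i) 2) atTop (𝓝 0)
  grad_ae : ∀ᵐ p, ∀ i, Tendsto (fun n => H1 n i p) atTop (𝓝 (Dh p i))
  hess_le : ∀ n i j, ∫ p, H2 n i j p ^ 2 ≤ S
  nonneg : (∀ p, 0 ≤ h p) → ∀ n p, 0 ≤ H n p

theorem IsApprox.tendsto {h : Torus L₁ L₂ → ℝ} {Dh : Torus L₁ L₂ → Fin 2 → ℝ} {S : ℝ}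
    {H : ℕ → Torus L₁ L₂ → ℝ} {H1 : ℕ → Fin 2 → Torus L₁ L₂ → ℝ}
    {H2 : ℕ → Fin 2 → Fin 2 → Torus L₁ L₂ → ℝ} {ε : ℕ → ℝ} (hA : IsApprox h Dh S H H1 H2 ε)
    (p : Torus L₁ L₂) : Tendsto (fun n => H n p) atTop (𝓝 (h p)) := by
  rw [tendsto_iff_norm_sub_tendsto_zero]
  exact squeeze_zero (fun n => norm_nonneg _) (fun n => hA.abs_le n p) hA.tendsto_zero

theorem exists_subseq_tendsto_ae {α : Type*} [MeasurableSpace α] {μ : Measure α}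
    {f : ℕ → α → ℝ} {g : α → ℝ} (hf : ∀ n, AEStronglyMeasurable (f n) μ)
    (hg : AEStronglyMeasurable g μ)
    (h : Tendsto (fun n => eLpNorm (fun p => f n p - g p) 2 μ) atTop (𝓝 0)) :
    ∃ φ : ℕ → ℕ, StrictMono φ ∧ ∀ᵐ p ∂μ, Tendsto (fun n => f (φ n) p) atTop (𝓝 (g p)) :=
  (tendstoInMeasure_of_tendsto_eLpNorm (p := 2) (by norm_num) hf hg h).exists_seq_tendsto_ae

/-- Mollification. The Hessian bound uses only the Laplacian, since mollifying does not increase its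
L² norm and the Laplacian controls the Hessian. Nonnegative kernels preserve the sign. -/
theorem IsH2.exists_approx {h : Torus L₁ L₂ → ℝ} {Dh : Torus L₁ L₂ → Fin 2 → ℝ}
    {D2h : Torus L₁ L₂ → Fin 2 → Fin 2 → ℝ} (hh : IsH2 h Dh D2h) (hc : Continuous h) :
    ∃ H H1 H2 ε, IsApprox h Dh (lapSq D2h) H H1 H2 ε := by
  have hi := integrable_of_continuous hc
  have e1 : ∀ n i, conv h (pdT i (kernel n)) = conv (fun p => Dh p i) (kernel n) := fun n i =>
    (hh.grad i).conv (smoothT_kernel n)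
  have e2 : ∀ n i j, conv h (pdT j (pdT i (kernel n)))
      = conv (fun p => D2h p i j) (kernel n) := fun n i j => by
    rw [(smoothT_kernel n).pdT_comm, (hh.grad i).conv ((smoothT_kernel n).pdT j),
      (hh.hess i j).conv (smoothT_kernel n)]
  obtain ⟨ε, hε, hb⟩ := conv_kernel_tendstoUniformly hc
  have hL2 : ∀ i, Tendsto (fun n => eLpNorm (fun p => conv h (pdT i (kernel n)) p - Dh p i) 2)
      atTop (𝓝 0) := fun i => by
    simp only [e1]
    exact conv_kernel_tendsto_L2 (hh.grad_memLp i)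
  have hcont : ∀ n i, Continuous (conv h (pdT i (kernel n))) := fun n i =>
    continuous_conv hi ((smoothT_kernel n).hasPd i).cont'
  -- Two successive extractions, one for each gradient component, give almost everywhere convergence
  -- of both.
  obtain ⟨φ, hφ, ha⟩ := exists_subseq_tendsto_ae (fun n => (hcont n 0).aestronglyMeasurable)
    (hh.grad_memLp 0).aestronglyMeasurable (hL2 0)
  obtain ⟨χ, hχ, hb'⟩ := exists_subseq_tendsto_ae
    (fun n => (hcont (φ n) 1).aestronglyMeasurable)
    (hh.grad_memLp 1).aestronglyMeasurable ((hL2 1).comp hφ.tendsto_atTop)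
  have hφχ : Tendsto (φ ∘ χ) atTop atTop := hφ.tendsto_atTop.comp hχ.tendsto_atTop
  refine ⟨fun n => conv h (kernel (φ (χ n))), fun n i => conv h (pdT i (kernel (φ (χ n)))),
    fun n i j => conv h (pdT j (pdT i (kernel (φ (χ n))))), ε ∘ φ ∘ χ,
    fun n i => ((smoothT_kernel _).hasPd i).conv hi,
    fun n i j => (((smoothT_kernel _).pdT i).hasPd j).conv hi,
    hε.comp hφχ, fun n p => hb _ p, fun i => (hL2 i).comp hφχ, ?_, fun n i j => ?_,
    fun h0 n p => ?_⟩
  · filter_upwards [ha, hb'] with p hp hp' i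
    fin_cases i
    · exact hp.comp hχ.tendsto_atTop
    · exact hp'
  · refine (integral_hess_sq_le hi (smoothT_kernel _) i j).trans ?_
    have e3 : ∀ p, ∑ i, conv h (pdT i (pdT i (kernel (φ (χ n))))) p
        = conv (fun p => ∑ i, D2h p i i) (kernel (φ (χ n))) p := by
      intro p
      simp only [e2]
      unfold conv
      rw [← integral_finsetSum]
      · simp only [Finset.sum_mul]
      · exact fun i _ => integrable_conv_aux ((hh.hess_memLp i i).integrable (by norm_num))
          (continuous_kernel _) p
    simp only [e3]
    exact integral_conv_sq_le (memLp_finsetSum _ fun i _ => hh.hess_memLp i i)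
      (continuous_kernel _) (kernel_nonneg _) (integral_kernel _)
  · exact integral_nonneg fun q => mul_nonneg (h0 q) (kernel_nonneg _ _)

/-- The total area of the torus. -/
def area (L₁ L₂ : ℝ) [Fact (0 < L₁)] [Fact (0 < L₂)] : ℝ :=
  (volume : Measure (Torus L₁ L₂)).real univ

theorem area_pos : 0 < area L₁ L₂ := by
  have h : (volume : Measure (Torus L₁ L₂)) univ ≠ 0 :=
    (isOpen_univ.measure_pos volume ⟨0, mem_univ _⟩).ne'
  exact ENNReal.toReal_pos h (measure_ne_top _ _)

section C2

variable {H : Torus L₁ L₂ → ℝ} {H1 : Fin 2 → Torus L₁ L₂ → ℝ}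
  {H2 : Fin 2 → Fin 2 → Torus L₁ L₂ → ℝ}

theorem integral_grad_sq_le (h : ∀ i, HasPd (dirT i) H (H1 i))
    (h2 : ∀ i j, HasPd (dirT j) (H1 i) (H2 i j)) {S : ℝ} (hS : ∀ i j, ∫ p, H2 i j p ^ 2 ≤ S)
    (i : Fin 2) : ∫ p, H1 i p ^ 2 ≤ (L₁ + L₂) ^ 2 * S := by
  have p1 : 0 < L₁ := Fact.out
  have p2 : 0 < L₂ := Fact.out
  refine ((h i).integral_sq_le (h2 i i)).trans ?_
  refine mul_le_mul ?_ (hS i i) (integral_nonneg fun _ => sq_nonneg _) (sq_nonneg _)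
  have hp := period_pos (L₁ := L₁) (L₂ := L₂) i
  have : period L₁ L₂ i ≤ L₁ + L₂ := by
    fin_cases i <;> simp [period] <;> linarith
  gcongr

/-- The constant of the embedding `H² ⊂ L^∞` on the torus. -/
def oscConst (L₁ L₂ : ℝ) [Fact (0 < L₁)] [Fact (0 < L₂)] : ℝ :=
  √(area L₁ L₂) * ((L₁⁻¹ + L₂⁻¹) * (L₁ + L₂) + 2)

theorem oscConst_nonneg : 0 ≤ oscConst L₁ L₂ := by
  have p1 : 0 < L₁ := Fact.out
  have p2 : 0 < L₂ := Fact.out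
  unfold oscConst; positivity

/-- Cauchy–Schwarz and Poincaré reduce the oscillation bound to the Hessian alone. No norm of the
function itself may enter, since the elastic energy does not see constants. -/
theorem osc_le_of_hasPd (h : ∀ i, HasPd (dirT i) H (H1 i))
    (h2 : ∀ i j, HasPd (dirT j) (H1 i) (H2 i j)) {S : ℝ} (hS : ∀ i j, ∫ p, H2 i j p ^ 2 ≤ S)
    (p q : Torus L₁ L₂) : |H q - H p| ≤ oscConst L₁ L₂ * √S := by
  have p1 : 0 < L₁ := Fact.out
  have p2 : 0 < L₂ := Fact.out
  have a1 : ∀ i, ∫ r, |H1 i r| ≤ √(area L₁ L₂) * ((L₁ + L₂) * √S) := fun i => by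
    refine (integral_abs_le_sqrt (memLp_of_continuous (h i).cont' 2)).trans ?_
    refine mul_le_mul_of_nonneg_left ?_ (Real.sqrt_nonneg _)
    refine (Real.sqrt_le_sqrt (integral_grad_sq_le h h2 hS i)).trans (le_of_eq ?_)
    rw [Real.sqrt_mul (sq_nonneg _), Real.sqrt_sq (by positivity)]
  have a2 : ∀ i j, ∫ r, |H2 i j r| ≤ √(area L₁ L₂) * √S := fun i j => by
    refine (integral_abs_le_sqrt (memLp_of_continuous (h2 i j).cont' 2)).trans ?_
    exact mul_le_mul_of_nonneg_left (Real.sqrt_le_sqrt (hS i j)) (Real.sqrt_nonneg _)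
  have i1 : ∀ i, Integrable fun r => |H1 i r| := fun i => integrable_of_continuous (h i).cont'.abs
  have i2 : ∀ i j, Integrable fun r => |H2 i j r| := fun i j =>
    integrable_of_continuous (h2 i j).cont'.abs
  have key := abs_sub_le_of_hasPd h h2 p q
  rw [integral_add ((i1 0).const_mul _) (i2 0 1), integral_add ((i1 1).const_mul _) (i2 1 0),
    integral_const_mul, integral_const_mul] at key
  have b1 := mul_le_mul_of_nonneg_left (a1 0) (inv_nonneg.2 p2.le)
  have b2 := mul_le_mul_of_nonneg_left (a1 1) (inv_nonneg.2 p1.le)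
  have b3 := a2 0 1
  have b4 := a2 1 0
  have e : oscConst L₁ L₂ * √S = L₂⁻¹ * (√(area L₁ L₂) * ((L₁ + L₂) * √S))
      + L₁⁻¹ * (√(area L₁ L₂) * ((L₁ + L₂) * √S)) + 2 * (√(area L₁ L₂) * √S) := by
    unfold oscConst; ring
  rw [e]
  linarith

/-- The abstract power estimate with N = (∂ᵢH)², κ = 1 and `E` the sum of |∂ᵢH| and the two
derivatives of ∂ᵢH: in two dimensions an H¹ function lies in every L^p with p finite. -/
theorem lintegral_grad_pow_le {k : ℕ} (hk : 0 < k) (h : ∀ i, HasPd (dirT i) H (H1 i))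
    (h2 : ∀ i j, HasPd (dirT j) (H1 i) (H2 i j)) {S : ℝ} (hS : ∀ i j, ∫ p, H2 i j p ^ 2 ≤ S)
    (i : Fin 2) : ∫⁻ p, ENNReal.ofReal |H1 i p| ^ (4 * k)
      ≤ ENNReal.ofReal (L₁⁻¹ + L₂⁻¹ + 2 * k) ^ (4 * k)
      * ENNReal.ofReal (3 * ((L₁ + L₂) ^ 2 * S + S + S)) ^ (2 * k)
      * volume (univ : Set (Torus L₁ L₂)) := by
  set E : Torus L₁ L₂ → ℝ := fun p => |H1 i p| + |H2 i 0 p| + |H2 i 1 p| with hE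
  have c0 := (h i).cont'
  have c1 := (h2 i 0).cont'
  have c2 := (h2 i 1).cont'
  have cE : Continuous E := by fun_prop
  have key := lintegral_pow_le_of_hasPd hk (N := fun p => H1 i p ^ 2) (E := E) (κ := fun _ => 1)
    (fun j => (h2 i j).pow 2) (fun p => sq_nonneg _) cE continuous_const (fun _ => le_rfl)
    (fun p => by rw [Real.sqrt_sq_eq_abs]; simp only [hE]; linarith [abs_nonneg (H2 i 0 p), abs_nonneg (H2 i 1 p)])
    (fun j p => by
      rw [Real.sqrt_sq_eq_abs]
      simp only [Nat.cast_ofNat, Nat.add_one_sub_one, pow_one, mul_one, abs_mul, abs_two]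
      refine mul_le_mul_of_nonneg_left ?_ (by positivity)
      simp only [hE]
      have a0 := abs_nonneg (H1 i p)
      have a1 := abs_nonneg (H2 i 0 p)
      have a2 := abs_nonneg (H2 i 1 p)
      fin_cases j <;> simp only [Fin.zero_eta, Fin.mk_one, Fin.isValue] <;> linarith)
  have e1 : ∀ p, ENNReal.ofReal (H1 i p ^ 2) ^ (2 * k) = ENNReal.ofReal |H1 i p| ^ (4 * k) := by
    intro p
    rw [← sq_abs, ENNReal.ofReal_pow (abs_nonneg _), ← pow_mul]
    congr 1
    ring
  simp only [e1, ENNReal.ofReal_one, one_pow, lintegral_const, one_mul] at key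
  refine key.trans ?_
  gcongr
  have m0 := memLp_of_continuous c0 2
  have m1 := memLp_of_continuous c1 2
  have m2 := memLp_of_continuous c2 2
  have e2 : ∀ p, ENNReal.ofReal (E p) ^ 2 = ENNReal.ofReal (E p ^ 2) := fun p =>
    (ENNReal.ofReal_pow (by positivity) 2).symm
  simp only [e2]
  rw [← ofReal_integral_eq_lintegral_ofReal (integrable_of_continuous (f := fun p => E p ^ 2) (cE.pow 2))
    (Eventually.of_forall fun p => sq_nonneg _)]
  refine ENNReal.ofReal_le_ofReal ?_
  calc ∫ p, E p ^ 2 ≤ ∫ p, 3 * (H1 i p ^ 2 + H2 i 0 p ^ 2 + H2 i 1 p ^ 2) := by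
        refine integral_mono (integrable_of_continuous (cE.pow 2))
          (integrable_of_continuous (by fun_prop)) fun p => ?_
        simp only [hE]
        rw [← sq_abs (H1 i p), ← sq_abs (H2 i 0 p), ← sq_abs (H2 i 1 p)]
        nlinarith [sq_nonneg (|H1 i p| - |H2 i 0 p|), sq_nonneg (|H1 i p| - |H2 i 1 p|),
          sq_nonneg (|H2 i 0 p| - |H2 i 1 p|)]
    _ = 3 * ((∫ p, H1 i p ^ 2) + (∫ p, H2 i 0 p ^ 2) + ∫ p, H2 i 1 p ^ 2) := by
        rw [integral_const_mul, integral_add (f := fun p => H1 i p ^ 2 + H2 i 0 p ^ 2)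
          (m0.integrable_sq.add m1.integrable_sq) m2.integrable_sq,
          integral_add m0.integrable_sq m1.integrable_sq]
    _ ≤ _ := by
        have := integral_grad_sq_le h h2 hS i
        have := hS i 0
        have := hS i 1
        linarith

/-- The weight `1 + |∂₁h| + |∂₂h|`. -/
def slope (D : Torus L₁ L₂ → Fin 2 → ℝ) (p : Torus L₁ L₂) : ℝ := 1 + |D p 0| + |D p 1|

theorem one_le_slope (D : Torus L₁ L₂ → Fin 2 → ℝ) (p : Torus L₁ L₂) : 1 ≤ slope D p := by
  unfold slope; linarith [abs_nonneg (D p 0), abs_nonneg (D p 1)]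

theorem abs_le_slope (D : Torus L₁ L₂ → Fin 2 → ℝ) (p : Torus L₁ L₂) (i : Fin 2) :
    1 + |D p i| ≤ slope D p := by
  unfold slope
  fin_cases i <;> simp

/-- A bound for the norms of the slope. -/
def slopeConst (L₁ L₂ : ℝ) [Fact (0 < L₁)] [Fact (0 < L₂)] (k : ℕ) (S : ℝ) : ℝ≥0∞ :=
  3 ^ (4 * k) * (1 + 2 * (ENNReal.ofReal (L₁⁻¹ + L₂⁻¹ + 2 * k) ^ (4 * k)
      * ENNReal.ofReal (3 * ((L₁ + L₂) ^ 2 * S + S + S)) ^ (2 * k)))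
      * volume (univ : Set (Torus L₁ L₂))

theorem slopeConst_ne_top (k : ℕ) (S : ℝ) : slopeConst L₁ L₂ k S ≠ ⊤ := by
  unfold slopeConst; finiteness

theorem slopeConst_mono (k : ℕ) {S S' : ℝ} (h : S ≤ S') :
    slopeConst L₁ L₂ k S ≤ slopeConst L₁ L₂ k S' := by
  unfold slopeConst; gcongr

theorem lintegral_slope_le {k : ℕ} (hk : 0 < k) (h : ∀ i, HasPd (dirT i) H (H1 i))
    (h2 : ∀ i j, HasPd (dirT j) (H1 i) (H2 i j)) {S : ℝ} (hS : ∀ i j, ∫ p, H2 i j p ^ 2 ≤ S) :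
    ∫⁻ p, ENNReal.ofReal (slope (fun p i => H1 i p) p) ^ (4 * k) ≤ slopeConst L₁ L₂ k S := by
  have hb : ∀ x y z : ℝ≥0∞, (x + y + z) ^ (4 * k)
      ≤ 3 ^ (4 * k) * (x ^ (4 * k) + y ^ (4 * k) + z ^ (4 * k)) := by
    intro x y z
    have h1 : x + y + z ≤ 3 * max x (max y z) := by
      have e : (3 : ℝ≥0∞) * max x (max y z) = max x (max y z) + max x (max y z) + max x (max y z) := by
        ring
      rw [e]; gcongr <;> simp
    refine (pow_le_pow_left' h1 _).trans ?_
    rw [mul_pow]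
    gcongr
    rcases max_cases x (max y z) with ⟨hh, -⟩ | ⟨hh, -⟩
    · rw [hh, add_assoc]; exact le_self_add
    · rw [hh]
      rcases max_cases y z with ⟨hh, -⟩ | ⟨hh, -⟩
      · rw [hh, add_right_comm]; exact le_add_self
      · rw [hh]; exact le_add_self
  have m : ∀ i, Measurable fun p => ENNReal.ofReal |H1 i p| ^ (4 * k) := fun i =>
    ((h i).cont'.abs.measurable.ennreal_ofReal).pow_const _
  calc _ ≤ ∫⁻ p, 3 ^ (4 * k) * (1 + ENNReal.ofReal |H1 0 p| ^ (4 * k)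
        + ENNReal.ofReal |H1 1 p| ^ (4 * k)) := by
        refine lintegral_mono fun p => ?_
        unfold slope
        rw [ENNReal.ofReal_add (by positivity) (by positivity),
          ENNReal.ofReal_add (by positivity) (by positivity)]
        refine (hb _ _ _).trans_eq ?_
        simp
    _ = 3 ^ (4 * k) * (volume (univ : Set (Torus L₁ L₂))
        + (∫⁻ p, ENNReal.ofReal |H1 0 p| ^ (4 * k))
        + ∫⁻ p, ENNReal.ofReal |H1 1 p| ^ (4 * k)) := by
        rw [lintegral_const_mul' _ _ (by finiteness), lintegral_add_right _ (m 1), lintegral_add_right _ (m 0)]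
        simp
    _ ≤ _ := by
        refine (mul_le_mul_right (add_le_add (add_le_add le_rfl
          (lintegral_grad_pow_le hk h h2 hS 0)) (lintegral_grad_pow_le hk h h2 hS 1)) _).trans
          (le_of_eq ?_)
        unfold slopeConst
        ring

/-- Interpolation for positive functions: `∫ |∂ᵢh|²/h ≤ C ‖∂ᵢᵢh‖`. -/
theorem integral_grad_sq_div_le (hpos : ∀ p, 0 < H p) (h : ∀ i, HasPd (dirT i) H (H1 i))
    (h2 : ∀ i j, HasPd (dirT j) (H1 i) (H2 i j)) {S : ℝ} (hS : ∀ i j, ∫ p, H2 i j p ^ 2 ≤ S)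
    (i : Fin 2) : ∫ p, H1 i p ^ 2 / H p ≤ √(area L₁ L₂) * (3 * √S) := by
  have hne : ∀ p, H p ≠ 0 := fun p => (hpos p).ne'
  have c := (h i).cont
  have c1 := (h i).cont'
  have c2 := (h2 i i).cont'
  set w : Torus L₁ L₂ → ℝ := fun p => H1 i p ^ 2 / H p with hw
  have cw : Continuous w := (c1.pow 2).div c hne
  -- The derivative of (∂ᵢH)³/H integrates to zero, which gives ∫w² = 3∫w ∂ᵢᵢH.
  have h0 := (((h2 i i).pow 3).mul ((h i).inv hne)).integral_eq_zero
  have e : ∀ p, ((3 : ℕ) : ℝ) * H1 i p ^ (3 - 1) * H2 i i p * (H p)⁻¹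
      + H1 i p ^ 3 * (-H1 i p / H p ^ 2) = 3 * (w p * H2 i i p) - w p ^ 2 := by
    intro p
    simp only [hw]
    have := hne p
    field_simp
    push_cast
    ring
  simp only [e] at h0
  rw [integral_sub (integrable_of_continuous (by fun_prop)) (integrable_of_continuous (by fun_prop)),
    integral_const_mul] at h0
  -- The weights 1/2 and 9/2 leave half of ∫w² to absorb and produce the factor 9 whose root is the
  -- 3 in the statement.
  have h3 : ∫ p, 3 * (w p * H2 i i p) ≤ ∫ p, (1 / 2 * w p ^ 2 + 9 / 2 * H2 i i p ^ 2) := by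
    refine integral_mono (integrable_of_continuous (by fun_prop))
      (integrable_of_continuous (by fun_prop)) fun p => ?_
    simp only
    nlinarith [sq_nonneg (w p - 3 * H2 i i p)]
  rw [integral_add (integrable_of_continuous (by fun_prop)) (integrable_of_continuous (by fun_prop)),
    integral_const_mul, integral_const_mul, integral_const_mul] at h3
  have h4 : ∫ p, w p ^ 2 ≤ 3 ^ 2 * S := by linarith [hS i i]
  calc ∫ p, w p ≤ ∫ p, |w p| := integral_mono (integrable_of_continuous cw)
        (integrable_of_continuous cw.abs) fun p => le_abs_self _
    _ ≤ √(area L₁ L₂) * √(∫ p, w p ^ 2) := integral_abs_le_sqrt (memLp_of_continuous cw 2)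
    _ ≤ √(area L₁ L₂) * (3 * √S) := by
        refine mul_le_mul_of_nonneg_left ((Real.sqrt_le_sqrt h4).trans_eq ?_) (Real.sqrt_nonneg _)
        rw [Real.sqrt_mul (by norm_num), Real.sqrt_sq (by norm_num)]

end C2

section H2

variable {h : Torus L₁ L₂ → ℝ} {Dh : Torus L₁ L₂ → Fin 2 → ℝ}
  {D2h : Torus L₁ L₂ → Fin 2 → Fin 2 → ℝ}

theorem IsH2.abs_sub_le (hh : IsH2 h Dh D2h) (hc : Continuous h) (p q : Torus L₁ L₂) :
    |h q - h p| ≤ oscConst L₁ L₂ * √(lapSq D2h) := by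
  obtain ⟨H, H1, H2, ε, hA⟩ := hh.exists_approx hc
  refine le_of_tendsto' (((hA.tendsto q).sub (hA.tendsto p)).abs) fun n => ?_
  exact osc_le_of_hasPd (hA.pd n) (hA.pd2 n) (hA.hess_le n) p q

theorem IsH2.lintegral_slope_le (hh : IsH2 h Dh D2h) (hc : Continuous h) {k : ℕ} (hk : 0 < k) :
    ∫⁻ p, ENNReal.ofReal (slope Dh p) ^ (4 * k) ≤ slopeConst L₁ L₂ k (lapSq D2h) := by
  obtain ⟨H, H1, H2, ε, hA⟩ := hh.exists_approx hc
  refine lintegral_le_of_tendsto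
    (F := fun n p => ENNReal.ofReal (slope (fun p i => H1 n i p) p) ^ (4 * k))
    (fun n => ?_) ?_ (fun n => FluidPlate.lintegral_slope_le hk (hA.pd n) (hA.pd2 n) (hA.hess_le n))
    tendsto_const_nhds
  · have c0 := (hA.pd n 0).cont'.measurable
    have c1 := (hA.pd n 1).cont'.measurable
    unfold slope
    fun_prop
  · filter_upwards [hA.grad_ae] with p hp
    exact ENNReal.Tendsto.pow (ENNReal.tendsto_ofReal
      ((tendsto_const_nhds.add (hp 0).abs).add (hp 1).abs))

/-- The approximants are only nonnegative. Adding a small positive constant changes no derivative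
and does not affect the bound, so Fatou applies as it tends to zero. -/
theorem IsH2.lintegral_grad_sq_div_le (hh : IsH2 h Dh D2h) (hc : Continuous h)
    (h0 : ∀ p, 0 ≤ h p) (hpos : ∀ᵐ p, 0 < h p) (i : Fin 2) :
    ∫⁻ p, ENNReal.ofReal (Dh p i ^ 2 / h p)
      ≤ ENNReal.ofReal (√(area L₁ L₂) * (3 * √(lapSq D2h))) := by
  obtain ⟨H, H1, H2, ε, hA⟩ := hh.exists_approx hc
  have d0 : ∀ n : ℕ, (0 : ℝ) < 1 / ((n : ℝ) + 1) := fun n => Nat.one_div_pos_of_nat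
  have hp0 : ∀ n p, 0 < H n p + 1 / ((n : ℝ) + 1) := fun n p =>
    add_pos_of_nonneg_of_pos (hA.nonneg h0 n p) (d0 n)
  have hcont : ∀ n, Continuous fun p => H1 n i p ^ 2 / (H n p + 1 / ((n : ℝ) + 1)) := fun n =>
    ((hA.pd n i).cont'.pow 2).div ((hA.pd n i).cont.add continuous_const) fun p => (hp0 n p).ne'
  refine lintegral_le_of_tendsto
    (F := fun n p => ENNReal.ofReal (H1 n i p ^ 2 / (H n p + 1 / ((n : ℝ) + 1))))
    (fun n => (hcont n).measurable.ennreal_ofReal.aemeasurable) ?_ (fun n => ?_)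
    tendsto_const_nhds
  · filter_upwards [hA.grad_ae, hpos] with p hp hp1
    refine ENNReal.tendsto_ofReal (((hp i).pow 2).div ?_ hp1.ne')
    simpa using (hA.tendsto p).add tendsto_one_div_add_atTop_nhds_zero_nat
  · rw [← ofReal_integral_eq_lintegral_ofReal (integrable_of_continuous (hcont n))
      (Eventually.of_forall fun p => div_nonneg (sq_nonneg _) (hp0 n p).le)]
    exact ENNReal.ofReal_le_ofReal (integral_grad_sq_div_le (hp0 n)
      (fun j => (hA.pd n j).add_const _) (hA.pd2 n) (hA.hess_le n) i)

/-- Each weak solution brings its own Hessian of the initial displacement. The threshold for static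
forces must be fixed beforehand, so the elastic energy has to be independent of that choice. -/
theorem IsH2.lapSq_unique {Dh' : Torus L₁ L₂ → Fin 2 → ℝ}
    {D2h' : Torus L₁ L₂ → Fin 2 → Fin 2 → ℝ} (hh : IsH2 h Dh D2h) (hh' : IsH2 h Dh' D2h') :
    lapSq D2h = lapSq D2h' := by
  have h1 : ∀ i, (fun p => Dh p i) =ᵐ[volume] fun p => Dh' p i := fun i =>
    (hh.grad i).unique (hh'.grad i) ae_eq_rfl (hh.grad_memLp i) (hh'.grad_memLp i)
  have h2 : ∀ i, (fun p => D2h p i i) =ᵐ[volume] fun p => D2h' p i i := fun i =>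
    (hh.hess i i).unique (hh'.hess i i) (h1 i) (hh.hess_memLp i i) (hh'.hess_memLp i i)
  refine integral_congr_ae ?_
  filter_upwards [h2 0, h2 1] with p a b
  simp only [Fin.sum_univ_two]
  rw [a, b]

end H2

end

end FluidPlate

/-! ### Vertical fibres: one-dimensional traces and the Leibniz rule below a graph -/

namespace FluidPlate

set_option linter.unusedSectionVars false

noncomputable section

/-- The Cauchy–Schwarz inequality. -/
theorem integral_abs_mul_le_sqrt {α : Type*} [MeasurableSpace α] {μ : Measure α}
    {f g : α → ℝ} (hf : MemLp f 2 μ) (hg : MemLp g 2 μ) :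
    ∫ x, |f x * g x| ∂μ ≤ √(∫ x, f x ^ 2 ∂μ) * √(∫ x, g x ^ 2 ∂μ) := by
  have h := integral_mul_le_Lp_mul_Lq_of_nonneg (μ := μ) Real.HolderConjugate.two_two
    (f := fun x => |f x|) (g := fun x => |g x|) (Eventually.of_forall fun _ => abs_nonneg _)
    (Eventually.of_forall fun _ => abs_nonneg _) (by rw [ENNReal.ofReal_ofNat]; exact hf.abs)
    (by rw [ENNReal.ofReal_ofNat]; exact hg.abs)
  simp only [← Real.sqrt_eq_rpow, Real.rpow_two, sq_abs, ← abs_mul] at h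
  exact h

theorem intervalIntegral_abs_mul_le_sqrt {f g : ℝ → ℝ} (hf : Continuous f) (hg : Continuous g)
    {a b : ℝ} (hab : a ≤ b) :
    ∫ x in a..b, |f x * g x| ≤ √(∫ x in a..b, f x ^ 2) * √(∫ x in a..b, g x ^ 2) := by
  simp only [intervalIntegral.integral_of_le hab]
  have hm : ∀ {k : ℝ → ℝ}, Continuous k → MemLp k 2 (volume.restrict (Ioc a b)) := fun hk =>
    (memLp_two_iff_integrable_sq hk.aestronglyMeasurable).2 (hk.pow 2).integrableOn_Ioc
  exact integral_abs_mul_le_sqrt (hm hf) (hm hg)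

/-- A one-dimensional trace inequality. -/
theorem sq_le_of_hasDerivAt {u u' : ℝ → ℝ} (h : ∀ z, HasDerivAt u (u' z) z) (hc : Continuous u')
    {b z : ℝ} (hb : 0 ≤ b) (hz : z ∈ Icc (-1) b) :
    u z ^ 2 ≤ (∫ s in (-1 : ℝ)..0, u s ^ 2) + 2 * ∫ s in (-1 : ℝ)..b, |u s * u' s| := by
  have cu : Continuous u := continuous_iff_continuousAt.2 fun z => (h z).continuousAt
  set A := ∫ s in (-1 : ℝ)..b, |u s * u' s| with hA
  -- Averaging over the starting point in an interval of length one gives the claim without further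
  -- constants. For a function vanishing below zero the averaged term drops out.
  have key : ∀ s ∈ Icc (-1 : ℝ) 0, u z ^ 2 ≤ u s ^ 2 + 2 * A := by
    intro s hs
    have h1 : ∫ r in s..z, 2 * (u r * u' r) = u z ^ 2 - u s ^ 2 := by
      refine intervalIntegral.integral_eq_sub_of_hasDerivAt (f := fun r => u r ^ 2)
        (f' := fun r => 2 * (u r * u' r)) (fun r _ => ?_)
        ((continuous_const.mul (cu.mul hc)).intervalIntegrable _ _)
      refine ((h r).pow 2).congr_deriv ?_
      simp; ring
    have h2 : |∫ r in s..z, u r * u' r| ≤ A := by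
      have hs' : ∀ x ∈ uIoc s z, x ∈ Ioc (-1) b := by
        intro x hx
        rcases le_total s z with hsz | hsz
        · rw [uIoc_of_le hsz] at hx
          exact ⟨hs.1.trans_lt hx.1, hx.2.trans hz.2⟩
        · rw [uIoc_of_ge hsz] at hx
          exact ⟨hz.1.trans_lt hx.1, hx.2.trans (hs.2.trans hb)⟩
      have hAe : A = ∫ r in Ioc (-1 : ℝ) b, |u r * u' r| := by
        rw [hA, intervalIntegral.integral_of_le (by linarith)]
      rw [hAe, ← Real.norm_eq_abs]
      refine intervalIntegral.norm_integral_le_integral_norm_uIoc.trans ?_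
      exact setIntegral_mono_set ((cu.mul hc).abs.integrableOn_Ioc)
        (Eventually.of_forall fun _ => abs_nonneg _) (Eventually.of_forall hs')
    rw [intervalIntegral.integral_const_mul] at h1
    have := (abs_le.1 h2).2
    linarith
  have h3 : ∫ _s in (-1 : ℝ)..0, u z ^ 2 ≤ ∫ s in (-1 : ℝ)..0, (u s ^ 2 + 2 * A) :=
    intervalIntegral.integral_mono_on (by norm_num) (by simp)
      (((cu.pow 2).add continuous_const).intervalIntegrable _ _) key
  rw [intervalIntegral.integral_add (f := fun s => u s ^ 2) ((cu.pow 2).intervalIntegrable _ _) (by simp)] at h3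
  simpa using h3

variable {L₁ L₂ : ℝ} [Fact (0 < L₁)] [Fact (0 < L₂)]

theorem continuous_vertical {F : Space L₁ L₂ → ℝ} (hF : Continuous F) (q : Torus L₁ L₂) :
    Continuous fun z : ℝ => F (q, z) := hF.comp (Continuous.prodMk_right q)

theorem HasPd.hasDerivAt_vertical {w w' : Space L₁ L₂ → ℝ} (h : HasPd (dirS 2) w w')
    (q : Torus L₁ L₂) (z : ℝ) : HasDerivAt (fun s : ℝ => w (q, s)) (w' (q, z)) z := by
  have h1 := h.hasDerivAt (q, 0) z
  simpa [dirS_two] using h1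

theorem HasPd.hasDerivAt_horizontal {i : Fin 2} {w w' : Space L₁ L₂ → ℝ}
    (h : HasPd (dirS i.castSucc) w w') (q : Torus L₁ L₂) (z s : ℝ) :
    HasDerivAt (fun s : ℝ => w (q + dirT i s, z)) (w' (q + dirT i s, z)) s := by
  have h1 := h.hasDerivAt (q, z) s
  simpa [dirS_castSucc] using h1

/-- Integration over the vertical fibres below a graph. -/
def fiberInt (F : Space L₁ L₂ → ℝ) (H : Torus L₁ L₂ → ℝ) (q : Torus L₁ L₂) : ℝ :=
  ∫ z in (-1 : ℝ)..H q, F (q, z)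

theorem continuous_fiberInt {F : Space L₁ L₂ → ℝ} {H : Torus L₁ L₂ → ℝ} (hF : Continuous F)
    (hH : Continuous H) : Continuous (fiberInt F H) :=
  intervalIntegral.continuous_parametric_intervalIntegral_of_continuous
    (f := fun q z => F (q, z)) hF hH

/-- The Leibniz rule for integrals below a moving graph. -/
theorem HasPd.fiberInt {i : Fin 2} {F F' : Space L₁ L₂ → ℝ} {H H' : Torus L₁ L₂ → ℝ}
    (hF : HasPd (dirS i.castSucc) F F') (hH : HasPd (dirT i) H H') :
    HasPd (dirT i) (fiberInt F H)
      (fun q => FluidPlate.fiberInt F' H q + F (q, H q) * H' q) where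
  cont := continuous_fiberInt hF.cont hH.cont
  cont' := (continuous_fiberInt hF.cont' hH.cont).add
    ((hF.cont.comp (continuous_id.prodMk hH.cont)).mul hH.cont')
  deriv p := by
    have cd : Continuous (dirT i : ℝ → Torus L₁ L₂) := (dirT i).continuous_toFun
    have cF : Continuous fun a : ℝ × ℝ => F (p + dirT i a.1, a.2) :=
      hF.cont.comp ((continuous_const.add (cd.comp continuous_fst)).prodMk continuous_snd)
    have cF' : Continuous fun a : ℝ × ℝ => F' (p + dirT i a.1, a.2) :=
      hF.cont'.comp ((continuous_const.add (cd.comp continuous_fst)).prodMk continuous_snd)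
    have cF1 : ∀ s : ℝ, Continuous fun z : ℝ => F (p + dirT i s, z) := fun s =>
      cF.comp (Continuous.prodMk_right s)
    have cF1' : ∀ s : ℝ, Continuous fun z : ℝ => F' (p + dirT i s, z) := fun s =>
      cF'.comp (Continuous.prodMk_right s)
    -- The horizontal shift and the upper limit are separated into two variables. Continuous partial
    -- derivatives make this function strictly differentiable, and the chain rule applies along (s,
    -- H(p + s)).
    let Φ : ℝ → ℝ → ℝ := fun s t => ∫ z in (-1 : ℝ)..t, F (p + dirT i s, z)
    let Φ₁ : ℝ → ℝ → ℝ →L[ℝ] ℝ := fun s t =>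
      ContinuousLinearMap.toSpanSingleton ℝ (∫ z in (-1 : ℝ)..t, F' (p + dirT i s, z))
    let Φ₂ : ℝ → ℝ → ℝ →L[ℝ] ℝ := fun s t =>
      ContinuousLinearMap.toSpanSingleton ℝ (F (p + dirT i s, t))
    have d1 : ∀ s t, HasDerivAt (fun s => Φ s t) (∫ z in (-1 : ℝ)..t, F' (p + dirT i s, z)) s := by
      intro s t
      obtain ⟨C, hC⟩ := (isCompact_Icc (a := s - 1) (b := s + 1)).prod
        (isCompact_uIcc (a := (-1 : ℝ)) (b := t)) |>.exists_bound_of_continuousOn cF'.continuousOn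
      refine (intervalIntegral.hasDerivAt_integral_of_dominated_loc_of_deriv_le
        (F := fun s z => F (p + dirT i s, z)) (F' := fun s z => F' (p + dirT i s, z))
        (s := Icc (s - 1) (s + 1)) (bound := fun _ => C)
        (Icc_mem_nhds (by linarith) (by linarith)) (Eventually.of_forall fun r =>
          (cF1 r).aestronglyMeasurable) ((cF1 s).intervalIntegrable _ _)
        (cF1' s).aestronglyMeasurable (Eventually.of_forall fun z hz r hr =>
          hC (r, z) ⟨hr, uIoc_subset_uIcc hz⟩) (by simp)
        (Eventually.of_forall fun z _ r _ => hF.hasDerivAt_horizontal p z r)).2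
    have d2 : ∀ s t, HasDerivAt (fun t => Φ s t) (F (p + dirT i s, t)) t := fun s t =>
      intervalIntegral.integral_hasDerivAt_right ((cF1 s).intervalIntegrable _ _)
        ((cF1 s).stronglyMeasurableAtFilter _ _) (cF1 s).continuousAt
    have c1 : Continuous fun a : ℝ × ℝ => Φ₁ a.1 a.2 := by
      refine (ContinuousLinearMap.toSpanSingletonCLE (𝕜 := ℝ) (E := ℝ)).continuous.comp ?_
      exact intervalIntegral.continuous_parametric_intervalIntegral_of_continuous
        (f := fun (a : ℝ × ℝ) z => F' (p + dirT i a.1, z))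
        (cF'.comp ((continuous_fst.comp continuous_fst).prodMk continuous_snd)) continuous_snd
    have c2 : Continuous fun a : ℝ × ℝ => Φ₂ a.1 a.2 :=
      (ContinuousLinearMap.toSpanSingletonCLE (𝕜 := ℝ) (E := ℝ)).continuous.comp cF
    have hs := (hasStrictFDerivAt_uncurry_coprod (𝕜 := ℝ) (u := ((0 : ℝ), H p)) (f := Φ) (f₁ := Φ₁)
      (f₂ := Φ₂) (Eventually.of_forall fun v => (d1 v.1 v.2).hasFDerivAt)
      (Eventually.of_forall fun v => (d2 v.1 v.2).hasFDerivAt) c1.continuousAt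
      c2.continuousAt).hasFDerivAt
    have hcurve : HasDerivAt (fun s : ℝ => (s, H (p + dirT i s))) (1, H' p) 0 :=
      (hasDerivAt_id 0).prodMk (hH.deriv p)
    have e0 : ((0 : ℝ), H p) = (fun s : ℝ => (s, H (p + dirT i s))) 0 := by simp
    rw [e0] at hs
    have key := hs.comp_hasDerivAt (0 : ℝ) hcurve
    refine key.congr_deriv ?_
    simp [Φ₁, Φ₂, FluidPlate.fiberInt, Function.HasUncurry.uncurry, mul_comm]

/-- The square of `w`. -/
def sqS (w : Space L₁ L₂ → ℝ) (x : Space L₁ L₂) : ℝ := w x ^ 2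

/-- The squared gradient of `w`. -/
def gradSqS (w : Space L₁ L₂ → ℝ) (x : Space L₁ L₂) : ℝ := ∑ i, pdS i w x ^ 2

section Trace

variable {w : Space L₁ L₂ → ℝ}

theorem continuous_gradSqS (hw : ContDiffS 1 w) : Continuous (gradSqS w) :=
  continuous_finsetSum _ fun i _ => (hw.hasPd i).cont'.pow 2

theorem sq_le_fiber (hw : ContDiffS 1 w) (q : Torus L₁ L₂) {b z : ℝ} (hb : 0 ≤ b)
    (hz : z ∈ Icc (-1) b) : w (q, z) ^ 2 ≤ (∫ s in (-1 : ℝ)..0, w (q, s) ^ 2)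
      + 2 * ∫ s in (-1 : ℝ)..b, |w (q, s) * pdS 2 w (q, s)| :=
  sq_le_of_hasDerivAt (fun z => (hw.hasPd 2).hasDerivAt_vertical q z)
    (continuous_vertical (hw.hasPd 2).cont' q) hb hz

theorem fiberInt_nonneg {F : Space L₁ L₂ → ℝ} (hF : ∀ x, 0 ≤ F x) {H : Torus L₁ L₂ → ℝ}
    (hH : ∀ q, 0 ≤ H q) (q : Torus L₁ L₂) : 0 ≤ fiberInt F H q :=
  intervalIntegral.integral_nonneg (by linarith [hH q]) fun _ _ => hF _

theorem gradSqS_nonneg (w : Space L₁ L₂ → ℝ) (x : Space L₁ L₂) : 0 ≤ gradSqS w x :=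
  Finset.sum_nonneg fun _ _ => sq_nonneg _

theorem sqS_nonneg (w : Space L₁ L₂ → ℝ) (x : Space L₁ L₂) : 0 ≤ sqS w x := sq_nonneg _

theorem fiberInt_abs_mul_pd_le (hw : ContDiffS 1 w) {H : Torus L₁ L₂ → ℝ} (hH : ∀ q, 0 ≤ H q)
    (i : Fin 3) (q : Torus L₁ L₂) : ∫ s in (-1 : ℝ)..H q, |w (q, s) * pdS i w (q, s)|
      ≤ √(fiberInt (sqS w) H q) * √(fiberInt (gradSqS w) H q) := by
  have hq : (-1 : ℝ) ≤ H q := by linarith [hH q]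
  refine (intervalIntegral_abs_mul_le_sqrt (continuous_vertical (hw.hasPd 0).cont q)
    (continuous_vertical (hw.hasPd i).cont' q) hq).trans ?_
  refine mul_le_mul_of_nonneg_left (Real.sqrt_le_sqrt ?_) (Real.sqrt_nonneg _)
  refine intervalIntegral.integral_mono_on hq
    (((continuous_vertical (hw.hasPd i).cont' q).pow 2).intervalIntegrable _ _)
    ((continuous_vertical (continuous_gradSqS hw) q).intervalIntegrable _ _) fun z _ => ?_
  exact Finset.single_le_sum (f := fun i => pdS i w (q, z) ^ 2) (fun _ _ => sq_nonneg _)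
    (Finset.mem_univ i)

/-- The embedding estimate for fibre integrals over smooth domains. -/
theorem lintegral_fiberInt_pow_le_of_hasPd {k : ℕ} (hk : 0 < k) (hw : ContDiffS 1 w)
    {H : Torus L₁ L₂ → ℝ} {H1 : Fin 2 → Torus L₁ L₂ → ℝ} (h : ∀ i, HasPd (dirT i) H (H1 i))
    (hH : ∀ q, 0 ≤ H q) :
    ∫⁻ q, ENNReal.ofReal (fiberInt (sqS w) H q) ^ (2 * k)
      ≤ ENNReal.ofReal (L₁⁻¹ + L₂⁻¹ + 2 * k) ^ (4 * k)
      * ENNReal.ofReal (2 * ∫ q, (fiberInt (sqS w) H q + fiberInt (gradSqS w) H q)) ^ (2 * k)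
      * ∫⁻ q, ENNReal.ofReal (slope (fun p i => H1 i p) q) ^ (4 * k) := by
  have cw := (hw.hasPd 0).cont
  set N := fiberInt (sqS w) H with hN
  set W := fiberInt (gradSqS w) H with hW
  have cN : Continuous N := continuous_fiberInt (cw.pow 2) (h 0).cont
  have cW : Continuous W := continuous_fiberInt (continuous_gradSqS hw) (h 0).cont
  have N0 : ∀ q, 0 ≤ N q := fiberInt_nonneg (sqS_nonneg w) hH
  have W0 : ∀ q, 0 ≤ W q := fiberInt_nonneg (gradSqS_nonneg w) hH
  have cs : Continuous (slope fun p i => H1 i p) := by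
    have c0 := (h 0).cont'
    have c1 := (h 1).cont'
    unfold slope; fun_prop
  -- The interior part of ∂ᵢN is at most 2√N√W by Cauchy–Schwarz; the boundary part is a squared
  -- trace times ∂ᵢH. This `E`, with the slope as weight, fits the abstract power estimate.
  set E : Torus L₁ L₂ → ℝ := fun q => √(N q) + √(W q) with hE
  have cE : Continuous E := cN.sqrt.add cW.sqrt
  have hpd : ∀ i : Fin 2, HasPd (dirT i) N _ := fun i =>
    HasPd.fiberInt ((hw.hasPd i.castSucc).pow 2) (h i)
  have key := lintegral_pow_le_of_hasPd hk (N := N) (E := E) (κ := slope fun p i => H1 i p)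
    hpd N0 cE cs (one_le_slope _) (fun q => le_add_of_nonneg_right (Real.sqrt_nonneg _))
    (fun i q => by
      have hq : (-1 : ℝ) ≤ H q := by linarith [hH q]
      have s1 := Real.sqrt_nonneg (N q)
      have s2 := Real.sqrt_nonneg (W q)
      have b1 : |fiberInt (fun x => ((2 : ℕ) : ℝ) * w x ^ (2 - 1) * pdS i.castSucc w x) H q|
          ≤ 2 * (√(N q) * √(W q)) := by
        refine (intervalIntegral.abs_integral_le_integral_abs hq).trans ?_
        refine le_trans (le_of_eq ?_) (mul_le_mul_of_nonneg_left
          (fiberInt_abs_mul_pd_le hw hH i.castSucc q) zero_le_two)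
        rw [← intervalIntegral.integral_const_mul]
        congr 1
        funext z
        simp only [Nat.cast_ofNat, Nat.add_one_sub_one, pow_one, mul_assoc]
        rw [abs_mul, abs_two]
      -- The trace inequality at the top of the fibre controls the boundary term of the Leibniz rule
      -- by fibre integrals, again with the factor √N.
      have b2 : w (q, H q) ^ 2 ≤ N q + 2 * (√(N q) * √(W q)) := by
        refine (sq_le_fiber hw q (hH q) (right_mem_Icc.2 hq)).trans (add_le_add ?_
          (mul_le_mul_of_nonneg_left (fiberInt_abs_mul_pd_le hw hH 2 q) zero_le_two))
        exact intervalIntegral.integral_mono_interval le_rfl (by norm_num) (hH q)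
          (Eventually.of_forall fun z => sq_nonneg _)
          (((continuous_vertical cw q).pow 2).intervalIntegrable _ _)
      have b3 := abs_le_slope (fun p i => H1 i p) q i
      have b4 : w (q, H q) ^ 2 * |H1 i q| ≤ (N q + 2 * (√(N q) * √(W q))) * |H1 i q| :=
        mul_le_mul_of_nonneg_right b2 (abs_nonneg _)
      have e4 : |w (q, H q) ^ 2 * H1 i q| = w (q, H q) ^ 2 * |H1 i q| := by
        rw [abs_mul, abs_of_nonneg (sq_nonneg (w (q, H q)))]
      refine (abs_add_le _ _).trans ?_
      have e5 : N q = √(N q) * √(N q) := (Real.mul_self_sqrt (N0 q)).symm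
      calc _ ≤ 2 * (√(N q) * √(W q)) + (N q + 2 * (√(N q) * √(W q))) * |H1 i q| :=
            add_le_add b1 (e4.le.trans b4)
        _ ≤ 2 * √(N q) * (√(N q) + √(W q)) * (1 + |H1 i q|) := by
            have a1 := abs_nonneg (H1 i q)
            have a2 := mul_nonneg s1 s1
            have a3 := mul_nonneg a2 a1
            calc _ = 2 * (√(N q) * √(W q)) + (√(N q) * √(N q) + 2 * (√(N q) * √(W q))) * |H1 i q| := by
                  rw [← e5]
              _ ≤ _ := by nlinarith
        _ ≤ _ := by
            refine mul_le_mul_of_nonneg_left b3 ?_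
            exact mul_nonneg (mul_nonneg zero_le_two s1) (add_nonneg s1 s2))
  refine key.trans ?_
  gcongr
  have e2 : ∀ q, ENNReal.ofReal (E q) ^ 2 = ENNReal.ofReal (E q ^ 2) := fun q =>
    (ENNReal.ofReal_pow (add_nonneg (Real.sqrt_nonneg _) (Real.sqrt_nonneg _)) 2).symm
  simp only [e2]
  rw [← ofReal_integral_eq_lintegral_ofReal (integrable_of_continuous (f := fun q => E q ^ 2)
    (cE.pow 2)) (Eventually.of_forall fun p => sq_nonneg _)]
  refine ENNReal.ofReal_le_ofReal ?_
  rw [← integral_const_mul]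
  refine integral_mono (integrable_of_continuous (cE.pow 2))
    (integrable_of_continuous (by fun_prop)) fun q => ?_
  simp only [hE]
  nlinarith [sq_nonneg (√(N q) - √(W q)), Real.sq_sqrt (N0 q), Real.sq_sqrt (W0 q)]

/-- Uniform convergence keeps all heights in one compact interval, on which the fibre integral is
continuous and bounded; dominated convergence does the rest. -/
theorem tendsto_integral_fiberInt {F : Space L₁ L₂ → ℝ} (hF : Continuous F)
    {H : ℕ → Torus L₁ L₂ → ℝ} {h : Torus L₁ L₂ → ℝ} {ε : ℕ → ℝ} (hH : ∀ n, Continuous (H n))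
    (hh : Continuous h) (hε : Tendsto ε atTop (𝓝 0)) (hb : ∀ n q, |H n q - h q| ≤ ε n) :
    (∀ q, Tendsto (fun n => fiberInt F (H n) q) atTop (𝓝 (fiberInt F h q))) ∧
    Tendsto (fun n => ∫ q, fiberInt F (H n) q) atTop (𝓝 (∫ q, fiberInt F h q)) := by
  obtain ⟨C, hC0, hC⟩ := exists_bound_of_continuous hh
  obtain ⟨B, hB⟩ := hε.bddAbove_range
  have hHB : ∀ n q, H n q ∈ Icc (-(C + B)) (C + B) := fun n q => by
    have h1 := abs_le.1 (hb n q)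
    have h2 := abs_le.1 (hC q)
    have h3 := hB (mem_range_self n)
    constructor <;> linarith
  have cT : Continuous fun a : Torus L₁ L₂ × ℝ => ∫ z in (-1 : ℝ)..a.2, F (a.1, z) :=
    intervalIntegral.continuous_parametric_intervalIntegral_of_continuous
      (f := fun (a : Torus L₁ L₂ × ℝ) z => F (a.1, z))
      (hF.comp ((continuous_fst.comp continuous_fst).prodMk continuous_snd)) continuous_snd
  obtain ⟨M, hM⟩ := (isCompact_univ (X := Torus L₁ L₂)).prod
    (isCompact_Icc (a := -(C + B)) (b := C + B)) |>.exists_bound_of_continuousOn cT.continuousOn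
  have hpt : ∀ q, Tendsto (fun n => fiberInt F (H n) q) atTop (𝓝 (fiberInt F h q)) := fun q => by
    have h1 : Tendsto (fun n => H n q) atTop (𝓝 (h q)) := by
      rw [tendsto_iff_norm_sub_tendsto_zero]
      exact squeeze_zero (fun n => norm_nonneg _) (fun n => hb n q) hε
    exact ((cT.comp (Continuous.prodMk_right q)).tendsto (h q)).comp h1
  refine ⟨hpt, tendsto_integral_of_dominated_convergence (fun _ => M)
    (fun n => (continuous_fiberInt hF (hH n)).aestronglyMeasurable) (integrable_const _)
    (fun n => Eventually.of_forall fun q => hM (q, H n q) ⟨mem_univ _, hHB n q⟩)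
    (Eventually.of_forall hpt)⟩

/-- The embedding estimate for fibre integrals below the graph of a nonnegative function in
`H²`. -/
theorem IsH2.lintegral_fiberInt_pow_le {h : Torus L₁ L₂ → ℝ} {Dh : Torus L₁ L₂ → Fin 2 → ℝ}
    {D2h : Torus L₁ L₂ → Fin 2 → Fin 2 → ℝ} (hh : IsH2 h Dh D2h) (hc : Continuous h)
    (h0 : ∀ q, 0 ≤ h q) {k : ℕ} (hk : 0 < k) (hw : ContDiffS 1 w) :
    ∫⁻ q, ENNReal.ofReal (fiberInt (sqS w) h q) ^ (2 * k)
      ≤ ENNReal.ofReal (L₁⁻¹ + L₂⁻¹ + 2 * k) ^ (4 * k)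
      * ENNReal.ofReal (2 * ∫ q, (fiberInt (sqS w) h q + fiberInt (gradSqS w) h q)) ^ (2 * k)
      * slopeConst L₁ L₂ k (lapSq D2h) := by
  obtain ⟨H, H1, H2, ε, hA⟩ := hh.exists_approx hc
  have cw := (hw.hasPd 0).cont
  have c1 : Continuous (sqS w) := cw.pow 2
  have c2 := continuous_gradSqS hw
  have hHc : ∀ n, Continuous (H n) := fun n => (hA.pd n 0).cont
  have t1 := tendsto_integral_fiberInt c1 hHc hc hA.tendsto_zero hA.abs_le
  have t2 := tendsto_integral_fiberInt c2 hHc hc hA.tendsto_zero hA.abs_le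
  have e : ∀ {H : Torus L₁ L₂ → ℝ}, Continuous H →
      ∫ q, (fiberInt (sqS w) H q + fiberInt (gradSqS w) H q)
      = (∫ q, fiberInt (sqS w) H q) + ∫ q, fiberInt (gradSqS w) H q := fun hH =>
    integral_add (integrable_of_continuous (continuous_fiberInt c1 hH))
      (integrable_of_continuous (continuous_fiberInt c2 hH))
  refine lintegral_le_of_tendsto
    (F := fun n q => ENNReal.ofReal (fiberInt (sqS w) (H n) q) ^ (2 * k)) (fun n => ?_) ?_
    (fun n => (lintegral_fiberInt_pow_le_of_hasPd hk hw (hA.pd n) (hA.nonneg h0 n)).trans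
      (mul_le_mul_right (FluidPlate.lintegral_slope_le hk (hA.pd n) (hA.pd2 n) (hA.hess_le n)) _)) ?_
  · exact ((continuous_fiberInt c1 (hHc n)).measurable.ennreal_ofReal.pow_const _).aemeasurable
  · exact Eventually.of_forall fun q => ENNReal.Tendsto.pow (ENNReal.tendsto_ofReal (t1.1 q))
  · refine ENNReal.Tendsto.mul_const (ENNReal.Tendsto.const_mul (ENNReal.Tendsto.pow
      (ENNReal.tendsto_ofReal (Tendsto.const_mul _ ?_))) (Or.inr (by finiteness)))
      (Or.inr (slopeConst_ne_top _ _))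
    rw [e hc]
    simp only [e (hHc _)]
    exact t1.2.add t2.2

end Trace

end

end FluidPlate

/-! ### Extraction of subsequences and limits of products in L² -/

namespace FluidPlate

set_option linter.unusedSectionVars false

noncomputable section

section Tools

variable {α : Type*} [MeasurableSpace α] {μ : Measure α}

/-- Along a subsequence the integrals are at most 2^(-n); the sum is then integrable, hence finite
almost everywhere, and its terms tend to zero. -/
theorem exists_subseq_ae_tendsto_zero {e : ℕ → α → ℝ≥0∞} (hm : ∀ n, AEMeasurable (e n) μ)
    (h : Tendsto (fun n => ∫⁻ x, e n x ∂μ) atTop (𝓝 0)) :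
    ∃ φ : ℕ → ℕ, StrictMono φ ∧ ∀ᵐ x ∂μ, Tendsto (fun n => e (φ n) x) atTop (𝓝 0) := by
  have h1 : ∀ n : ℕ, ∀ᶠ k in atTop, ∫⁻ x, e k x ∂μ ≤ (2⁻¹ : ℝ≥0∞) ^ n := fun n =>
    (ENNReal.tendsto_nhds_zero.1 h) _ (ENNReal.pow_pos (by simp) n)
  obtain ⟨φ, hφ, hb⟩ := extraction_forall_of_eventually h1
  refine ⟨φ, hφ, ?_⟩
  have h2 : ∫⁻ x, ∑' n, e (φ n) x ∂μ ≠ ⊤ := by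
    rw [lintegral_tsum fun n => hm (φ n)]
    refine ne_top_of_le_ne_top ?_ (ENNReal.tsum_le_tsum hb)
    rw [ENNReal.tsum_geometric]
    simp
  filter_upwards [ae_lt_top' (AEMeasurable.tsum fun n => hm (φ n)) h2] with x hx
  exact ENNReal.tendsto_atTop_zero_of_tsum_ne_top hx.ne

/-- Continuity of the inner product of L². -/
theorem tendsto_integral_mul_of_L2 {a b : ℕ → α → ℝ} {a' b' : α → ℝ}
    (ha : ∀ n, MemLp (a n) 2 μ) (hb : ∀ n, MemLp (b n) 2 μ) (ha' : MemLp a' 2 μ)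
    (hb' : MemLp b' 2 μ)
    (h1 : Tendsto (fun n => eLpNorm (fun x => a n x - a' x) 2 μ) atTop (𝓝 0))
    (h2 : Tendsto (fun n => eLpNorm (fun x => b n x - b' x) 2 μ) atTop (𝓝 0)) :
    Tendsto (fun n => ∫ x, a n x * b n x ∂μ) atTop (𝓝 (∫ x, a' x * b' x ∂μ)) := by
  have t1 := (Lp.tendsto_Lp_iff_tendsto_eLpNorm'' a ha a' ha').2 h1
  have t2 := (Lp.tendsto_Lp_iff_tendsto_eLpNorm'' b hb b' hb').2 h2
  have t3 := t1.inner (𝕜 := ℝ) t2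
  have e : ∀ {u v : α → ℝ} (hu : MemLp u 2 μ) (hv : MemLp v 2 μ),
      inner ℝ (hu.toLp u) (hv.toLp v) = ∫ x, u x * v x ∂μ := by
    intro u v hu hv
    rw [L2.inner_def]
    refine integral_congr_ae ?_
    filter_upwards [hu.coeFn_toLp, hv.coeFn_toLp] with x h1 h2
    rw [h1, h2]
    simp [mul_comm]
  simpa only [e] using t3

theorem tendsto_eLpNorm_abs {a : ℕ → α → ℝ} {a' : α → ℝ}
    (h1 : Tendsto (fun n => eLpNorm (fun x => a n x - a' x) 2 μ) atTop (𝓝 0)) :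
    Tendsto (fun n => eLpNorm (fun x => |a n x| - |a' x|) 2 μ) atTop (𝓝 0) := by
  refine tendsto_of_tendsto_of_tendsto_of_le_of_le tendsto_const_nhds h1 (fun _ => zero_le)
    fun n => eLpNorm_mono fun x => ?_
  simpa only [Real.norm_eq_abs] using abs_abs_sub_abs_le (a n x) (a' x)

end Tools

variable {L₁ L₂ : ℝ} [Fact (0 < L₁)] [Fact (0 < L₂)]

/-! ### Fubini on domains below a graph -/

/-- The region `a < z < h`. -/
def slab (a : ℝ) (h : Torus L₁ L₂ → ℝ) : Set (Space L₁ L₂) := {p | a < p.2 ∧ p.2 < h p.1}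

theorem isOpen_slab (a : ℝ) {h : Torus L₁ L₂ → ℝ} (hh : Continuous h) : IsOpen (slab a h) :=
  (isOpen_lt continuous_const continuous_snd).inter
    (isOpen_lt continuous_snd (hh.comp continuous_fst))

theorem measurableSet_slab (a : ℝ) {h : Torus L₁ L₂ → ℝ} (hh : Continuous h) :
    MeasurableSet (slab a h) := (isOpen_slab a hh).measurableSet

theorem lintegral_slab {a : ℝ} {h : Torus L₁ L₂ → ℝ} (hh : Continuous h)
    {F : Space L₁ L₂ → ℝ≥0∞} (hF : AEMeasurable F (volume.restrict (slab a h))) :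
    ∫⁻ p in slab a h, F p = ∫⁻ q, ∫⁻ z in Ioo a (h q), F (q, z) := by
  have hS := measurableSet_slab a hh
  rw [← lintegral_indicator hS]
  have e := lintegral_prod (μ := (volume : Measure (Torus L₁ L₂))) (ν := (volume : Measure ℝ))
    ((slab a h).indicator F) ((aemeasurable_indicator_iff hS).2 hF)
  refine e.trans (lintegral_congr fun q => ?_)
  rw [← lintegral_indicator measurableSet_Ioo]
  rfl

theorem aestronglyMeasurable_slab {a : ℝ} {h : Torus L₁ L₂ → ℝ} (hh : Continuous h)
    {F : Space L₁ L₂ → ℝ} (hF : AEStronglyMeasurable F (volume.restrict (slab a h))) :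
    ∀ᵐ q, AEStronglyMeasurable (fun z => F (q, z)) (volume.restrict (Ioo a (h q))) := by
  have hS := measurableSet_slab a hh
  have h1 : AEStronglyMeasurable ((slab a h).indicator F)
      ((volume : Measure (Torus L₁ L₂)).prod (volume : Measure ℝ)) :=
    (aestronglyMeasurable_indicator_iff hS).2 hF
  filter_upwards [h1.prodMk_left] with q hq
  rw [← aestronglyMeasurable_indicator_iff measurableSet_Ioo]
  exact hq

theorem memLp_slab {a : ℝ} {h : Torus L₁ L₂ → ℝ} (hh : Continuous h)
    {F : Space L₁ L₂ → ℝ} (hF : MemLp F 2 (volume.restrict (slab a h))) :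
    ∀ᵐ q, MemLp (fun z => F (q, z)) 2 (volume.restrict (Ioo a (h q))) := by
  have hm : AEMeasurable (fun p => ‖F p‖ₑ ^ 2) (volume.restrict (slab a h)) :=
    hF.aestronglyMeasurable.enorm.pow_const _
  have h1 : ∫⁻ q, ∫⁻ z in Ioo a (h q), ‖F (q, z)‖ₑ ^ 2 < ⊤ := by
    rw [← lintegral_slab hh hm, ← eLpNorm_two_sq]
    exact ENNReal.pow_lt_top hF.eLpNorm_lt_top
  have h2 : AEMeasurable (fun q => ∫⁻ z in Ioo a (h q), ‖F (q, z)‖ₑ ^ 2) := by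
    have hS := measurableSet_slab a hh
    have := ((aemeasurable_indicator_iff (μ := (volume : Measure (Torus L₁ L₂)).prod
      (volume : Measure ℝ)) hS).2 hm).lintegral_prod_right'
    refine this.congr (Eventually.of_forall fun q => ?_)
    simp only
    rw [← lintegral_indicator measurableSet_Ioo]
    rfl
  filter_upwards [ae_lt_top' h2 h1.ne, aestronglyMeasurable_slab hh hF.aestronglyMeasurable]
    with q hq hq2
  refine ⟨hq2, ?_⟩
  by_contra hc
  have h3 := eLpNorm_two_sq (fun z => F (q, z)) (volume.restrict (Ioo a (h q)))
  rw [not_lt, top_le_iff] at hc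
  rw [hc, ENNReal.top_pow two_ne_zero] at h3
  exact hq.ne h3.symm

theorem aemeasurable_lintegral_slab {a : ℝ} {h : Torus L₁ L₂ → ℝ} (hh : Continuous h)
    {F : Space L₁ L₂ → ℝ≥0∞} (hF : AEMeasurable F (volume.restrict (slab a h))) :
    AEMeasurable (fun q => ∫⁻ z in Ioo a (h q), F (q, z)) := by
  have hS := measurableSet_slab a hh
  have := ((aemeasurable_indicator_iff (μ := (volume : Measure (Torus L₁ L₂)).prod
    (volume : Measure ℝ)) hS).2 hF).lintegral_prod_right'
  refine this.congr (Eventually.of_forall fun q => ?_)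
  simp only
  rw [← lintegral_indicator measurableSet_Ioo]
  rfl

end

end FluidPlate

/-! ### Estimates for functions with a trace on the graph -/

namespace FluidPlate

set_option linter.unusedSectionVars false

noncomputable section

section OneDim

variable {b : ℝ} {u u' : ℕ → ℝ → ℝ} {f g : ℝ → ℝ}

theorem memLp_Ioo_of_continuous {k : ℝ → ℝ} (hk : Continuous k) (a b : ℝ) :
    MemLp k 2 (volume.restrict (Ioo a b)) :=
  (memLp_two_iff_integrable_sq hk.aestronglyMeasurable).2
    ((hk.pow 2).integrableOn_Ioc.mono_set Ioo_subset_Ioc_self)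

/-- The limit of the one-dimensional trace inequality. -/
theorem section_limit (hb : 0 ≤ b) (hu : ∀ n z, HasDerivAt (u n) (u' n z) z)
    (hu' : ∀ n, Continuous (u' n)) (hf : MemLp f 2 (volume.restrict (Ioo (-1) b)))
    (hg : MemLp g 2 (volume.restrict (Ioo (-1) b))) (hf0 : ∀ z ≤ 0, f z = 0)
    (h1 : Tendsto (fun n => eLpNorm (fun z => u n z - f z) 2 (volume.restrict (Ioo (-1) b)))
      atTop (𝓝 0))
    (h2 : Tendsto (fun n => eLpNorm (fun z => u' n z - g z) 2 (volume.restrict (Ioo (-1) b)))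
      atTop (𝓝 0)) :
    Tendsto (fun n => ∫ z in (-1 : ℝ)..b, u n z ^ 2) atTop (𝓝 (∫ z in Ioo (-1) b, f z ^ 2)) ∧
    (∀ᵐ z ∂(volume.restrict (Ioo (-1) b)), f z ^ 2 ≤ 2 * ∫ z in Ioo (-1) b, |f z * g z|) ∧
    ∀ t : ℝ, Tendsto (fun n => u n b) atTop (𝓝 t) → t ^ 2 ≤ 2 * ∫ z in Ioo (-1) b, |f z * g z| := by
  have hb1 : (-1 : ℝ) ≤ b := by linarith
  have cu : ∀ n, Continuous (u n) := fun n =>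
    continuous_iff_continuousAt.2 fun z => (hu n z).continuousAt
  have mu := fun n => memLp_Ioo_of_continuous (cu n) (-1) b
  have mu' := fun n => memLp_Ioo_of_continuous (hu' n) (-1) b
  have t1 := tendsto_integral_mul_of_L2 mu mu hf hf h1 h1
  have t2 := tendsto_integral_mul_of_L2 (fun n => (mu n).abs) (fun n => (mu' n).abs) hf.abs hg.abs
    (tendsto_eLpNorm_abs h1) (tendsto_eLpNorm_abs h2)
  have hle : volume.restrict (Ioo (-1 : ℝ) 0) ≤ volume.restrict (Ioo (-1) b) :=
    Measure.restrict_mono (Ioo_subset_Ioo_right hb) le_rfl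
  have h3 : Tendsto (fun n => eLpNorm (fun z => u n z - f z) 2 (volume.restrict (Ioo (-1) 0)))
      atTop (𝓝 0) :=
    tendsto_of_tendsto_of_tendsto_of_le_of_le tendsto_const_nhds h1 (fun _ => zero_le)
      fun n => eLpNorm_mono_measure _ hle
  have t3 := tendsto_integral_mul_of_L2 (fun n => (mu n).mono_measure hle)
    (fun n => (mu n).mono_measure hle) (hf.mono_measure hle) (hf.mono_measure hle) h3 h3
  -- The limit vanishes below zero, so the mean value term of the trace inequality disappears and
  -- only the product of function and derivative remains.
  have e3 : ∫ z in Ioo (-1 : ℝ) 0, f z * f z = 0 := by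
    have : ∫ z in Ioo (-1 : ℝ) 0, f z * f z = ∫ z in Ioo (-1 : ℝ) 0, (0 : ℝ) :=
      setIntegral_congr_fun measurableSet_Ioo fun z hz => by simp [hf0 z hz.2.le]
    simpa using this
  simp only [← sq] at t1 t3
  simp only [Pi.abs_apply, ← abs_mul] at t2
  have toIoo : ∀ (a c : ℝ) (_ : a ≤ c) (k : ℝ → ℝ),
      ∫ z in a..c, k z = ∫ z in Ioo a c, k z := fun a c hac k => by
    rw [intervalIntegral.integral_of_le hac, integral_Ioc_eq_integral_Ioo]
  rw [show (∫ z in Ioo (-1 : ℝ) 0, f z ^ 2) = 0 by simpa only [sq] using e3] at t3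
  have tB : Tendsto (fun n => (∫ s in (-1 : ℝ)..0, u n s ^ 2)
      + 2 * ∫ s in (-1 : ℝ)..b, |u n s * u' n s|) atTop
      (𝓝 (2 * ∫ z in Ioo (-1) b, |f z * g z|)) := by
    simp only [toIoo _ _ hb1, toIoo (-1) 0 (by norm_num)]
    simpa using t3.add (t2.const_mul 2)
  refine ⟨by simpa only [toIoo _ _ hb1] using t1, ?_, fun t ht => ?_⟩
  · obtain ⟨φ, hφ, ha⟩ := exists_subseq_tendsto_ae
      (fun n => (mu n).aestronglyMeasurable) hf.aestronglyMeasurable h1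
    filter_upwards [ha, ae_restrict_mem measurableSet_Ioo] with z hz hzm
    exact le_of_tendsto_of_tendsto' (hz.pow 2) (tB.comp hφ.tendsto_atTop) fun n =>
      sq_le_of_hasDerivAt (hu _) (hu' _) hb ⟨hzm.1.le, hzm.2.le⟩
  · exact le_of_tendsto_of_tendsto' (ht.pow 2) tB fun n =>
      sq_le_of_hasDerivAt (hu _) (hu' _) hb (right_mem_Icc.2 hb1)

end OneDim

variable {L₁ L₂ : ℝ} [Fact (0 < L₁)] [Fact (0 < L₂)]

/-- The fibre integral of `‖f‖²`. -/
def fiberSq (h : Torus L₁ L₂ → ℝ) (f : Space L₁ L₂ → ℝ) (q : Torus L₁ L₂) : ℝ≥0∞ :=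
  ∫⁻ z in Ioo 0 (h q), ‖f (q, z)‖ₑ ^ 2

/-- The fibre integral of `‖f‖ ‖g‖`. -/
def fiberMul (h : Torus L₁ L₂ → ℝ) (f g : Space L₁ L₂ → ℝ) (q : Torus L₁ L₂) : ℝ≥0∞ :=
  ∫⁻ z in Ioo 0 (h q), ‖f (q, z)‖ₑ * ‖g (q, z)‖ₑ

/-- The square of the `H¹` norm on the fluid domain. -/
def h1Sq (h : Torus L₁ L₂ → ℝ) (f : Space L₁ L₂ → ℝ) (G : Space L₁ L₂ → Fin 3 → ℝ) : ℝ≥0∞ :=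
  (∫⁻ p in fluidDomain h, ‖f p‖ₑ ^ 2) + ∑ i, ∫⁻ p in fluidDomain h, ‖G p i‖ₑ ^ 2

theorem lintegral_Ioo_indicator {h : Torus L₁ L₂ → ℝ} (q : Torus L₁ L₂)
    (Φ : ℝ → ℝ≥0∞) : ∫⁻ z in Ioo (-1) (h q), (Ioi (0 : ℝ)).indicator Φ z
      = ∫⁻ z in Ioo 0 (h q), Φ z := by
  rw [setLIntegral_indicator measurableSet_Ioi]
  congr 2
  ext z
  simp only [mem_inter_iff, mem_Ioi, mem_Ioo]
  constructor
  · rintro ⟨h1, h2, h3⟩; exact ⟨h1, h3⟩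
  · rintro ⟨h1, h2⟩; exact ⟨h1, by linarith, h2⟩

theorem indicator_section {h : Torus L₁ L₂ → ℝ} {q : Torus L₁ L₂} {z : ℝ}
    (hz : z ∈ Ioo (-1) (h q)) (f : Space L₁ L₂ → ℝ) :
    (fluidDomain h).indicator f (q, z) = (Ioi (0 : ℝ)).indicator (fun z => f (q, z)) z := by
  by_cases h0 : 0 < z
  · rw [indicator_of_mem (show (q, z) ∈ fluidDomain h from ⟨h0, hz.2⟩),
      indicator_of_mem (show z ∈ Ioi (0 : ℝ) from h0)]
  · rw [indicator_of_notMem (fun hc : (q, z) ∈ fluidDomain h => h0 hc.1),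
      indicator_of_notMem (show z ∉ Ioi (0 : ℝ) from h0)]

theorem fluidDomain_subset_extDomain (h : Torus L₁ L₂ → ℝ) : fluidDomain h ⊆ extDomain h :=
  fun p hp => ⟨by linarith [hp.1], hp.2⟩

theorem memLp_indicator_fluidDomain {h : Torus L₁ L₂ → ℝ} (hh : Continuous h)
    {f : Space L₁ L₂ → ℝ} (hf : MemLp f 2 (volume.restrict (fluidDomain h))) :
    MemLp ((fluidDomain h).indicator f) 2 (volume.restrict (extDomain h)) :=
  ((memLp_indicator_iff_restrict (measurableSet_slab 0 hh)).2 hf).restrict _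

theorem eLpNorm_indicator_fluidDomain {h : Torus L₁ L₂ → ℝ} (hh : Continuous h)
    (f : Space L₁ L₂ → ℝ) :
    eLpNorm ((fluidDomain h).indicator f) 2 (volume.restrict (extDomain h))
      = eLpNorm f 2 (volume.restrict (fluidDomain h)) := by
  have hS : MeasurableSet (fluidDomain h) := measurableSet_slab 0 hh
  rw [eLpNorm_indicator_eq_eLpNorm_restrict hS, Measure.restrict_restrict hS,
    inter_eq_left.2 (fluidDomain_subset_extDomain h)]

theorem exists_slab_subset {h : Torus L₁ L₂ → ℝ} (hh : Continuous h) (a : ℝ) :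
    ∃ R : ℝ, slab a h ⊆ univ ×ˢ Icc a R := by
  obtain ⟨C, -, hC⟩ := exists_bound_of_continuous hh
  exact ⟨C, fun p hp => ⟨mem_univ _, hp.1.le, hp.2.le.trans ((le_abs_self _).trans (hC _))⟩⟩

theorem memLp_slab_of_continuous {h : Torus L₁ L₂ → ℝ} (hh : Continuous h) {a : ℝ}
    {F : Space L₁ L₂ → ℝ} (hF : Continuous F) : MemLp F 2 (volume.restrict (slab a h)) := by
  obtain ⟨R, hR⟩ := exists_slab_subset hh a
  have hK : IsCompact ((univ : Set (Torus L₁ L₂)) ×ˢ Icc a R) := isCompact_univ.prod isCompact_Icc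
  have hi : IntegrableOn (fun x => F x ^ 2) (univ ×ˢ Icc a R) :=
    (hF.pow 2).continuousOn.integrableOn_compact hK
  exact (memLp_two_iff_integrable_sq hF.aestronglyMeasurable).2 (hi.mono_set hR)

theorem lintegral_fiberInt_eq {h : Torus L₁ L₂ → ℝ} (hh : Continuous h) (h0 : ∀ q, 0 ≤ h q)
    {F : Space L₁ L₂ → ℝ} (hF : Continuous F) (hF0 : ∀ x, 0 ≤ F x) :
    ENNReal.ofReal (∫ q, fiberInt F h q) = ∫⁻ p in extDomain h, ENNReal.ofReal (F p) := by
  rw [ofReal_integral_eq_lintegral_ofReal (integrable_of_continuous (continuous_fiberInt hF hh))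
    (Eventually.of_forall (fiberInt_nonneg hF0 h0))]
  have := lintegral_slab (a := -1) hh hF.measurable.ennreal_ofReal.aemeasurable
  refine Eq.trans (lintegral_congr fun q => ?_) this.symm
  unfold fiberInt
  rw [intervalIntegral.integral_of_le (by linarith [h0 q]), integral_Ioc_eq_integral_Ioo,
    ofReal_integral_eq_lintegral_ofReal _ (Eventually.of_forall fun _ => hF0 _)]
  exact (continuous_vertical hF q).integrableOn_Ioc.mono_set Ioo_subset_Ioc_self

theorem ofReal_h1_eq {h : Torus L₁ L₂ → ℝ} (hh : Continuous h) (h0 : ∀ q, 0 ≤ h q)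
    {w : Space L₁ L₂ → ℝ} (hw : ContDiffS 1 w) :
    ENNReal.ofReal (2 * ∫ q, (fiberInt (sqS w) h q + fiberInt (gradSqS w) h q))
      = 2 * (eLpNorm w 2 (volume.restrict (extDomain h)) ^ 2
        + ∑ i, eLpNorm (pdS i w) 2 (volume.restrict (extDomain h)) ^ 2) := by
  have c1 : Continuous (sqS w) := (hw.hasPd 0).cont.pow 2
  have c2 := continuous_gradSqS hw
  rw [integral_add (integrable_of_continuous (continuous_fiberInt c1 hh))
    (integrable_of_continuous (continuous_fiberInt c2 hh)), ENNReal.ofReal_mul zero_le_two,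
    ENNReal.ofReal_add (integral_nonneg (fiberInt_nonneg (sqS_nonneg w) h0))
    (integral_nonneg (fiberInt_nonneg (gradSqS_nonneg w) h0)),
    lintegral_fiberInt_eq hh h0 c1 (sqS_nonneg w), lintegral_fiberInt_eq hh h0 c2 (gradSqS_nonneg w)]
  have e : ∀ x : ℝ, ENNReal.ofReal (x ^ 2) = ‖x‖ₑ ^ 2 := fun x => by
    rw [Real.enorm_eq_ofReal_abs, ← ENNReal.ofReal_pow (abs_nonneg _), sq_abs]
  simp only [eLpNorm_two_sq, sqS, gradSqS]
  rw [ENNReal.ofReal_ofNat]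
  congr 2
  · simp only [e]
  · rw [← lintegral_finsetSum]
    · refine lintegral_congr fun p => ?_
      rw [ENNReal.ofReal_sum_of_nonneg fun _ _ => sq_nonneg _]
      simp only [e]
    · exact fun i _ => (hw.hasPd i).cont'.measurable.enorm.pow_const _

section Main

variable {h g : Torus L₁ L₂ → ℝ} {Dh : Torus L₁ L₂ → Fin 2 → ℝ}
    {D2h : Torus L₁ L₂ → Fin 2 → Fin 2 → ℝ} {f : Space L₁ L₂ → ℝ} {G : Space L₁ L₂ → Fin 3 → ℝ}

/-- Subsequences of the approximants of a graph trace converge on almost all fibres. -/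
theorem HasGraphTrace.exists_seq (ht : HasGraphTrace h f G g) (hc : Continuous h)
    (hf : MemLp f 2 (volume.restrict (fluidDomain h)))
    (hG : ∀ i, MemLp (fun p => G p i) 2 (volume.restrict (fluidDomain h)))
    (hg : AEStronglyMeasurable g volume) :
    ∃ w : ℕ → Space L₁ L₂ → ℝ, (∀ n, ContDiffS 1 (w n)) ∧
      Tendsto (fun n => eLpNorm (fun p => w n p - (fluidDomain h).indicator f p) 2
        (volume.restrict (extDomain h))) atTop (𝓝 0) ∧
      (∀ i, Tendsto (fun n => eLpNorm
        (fun p => pdS i (w n) p - (fluidDomain h).indicator (fun p' => G p' i) p) 2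
        (volume.restrict (extDomain h))) atTop (𝓝 0)) ∧
      ∀ᵐ q, Tendsto (fun n => eLpNorm (fun z => w n (q, z) - (fluidDomain h).indicator f (q, z)) 2
          (volume.restrict (Ioo (-1) (h q)))) atTop (𝓝 0) ∧
        Tendsto (fun n => eLpNorm (fun z => pdS 2 (w n) (q, z)
          - (fluidDomain h).indicator (fun p' => G p' 2) (q, z)) 2
          (volume.restrict (Ioo (-1) (h q)))) atTop (𝓝 0) ∧
        Tendsto (fun n => w n (q, h q)) atTop (𝓝 (g q)) := by
  obtain ⟨w, hw, h1, h2, h3⟩ := ht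
  have mf := (memLp_indicator_fluidDomain hc hf).aestronglyMeasurable
  have mG := (memLp_indicator_fluidDomain hc (hG 2)).aestronglyMeasurable
  have cw : ∀ n, Continuous (w n) := fun n => ((hw n).hasPd 0).cont
  have m1 : ∀ n, AEMeasurable (fun p => ‖w n p - (fluidDomain h).indicator f p‖ₑ ^ 2)
      (volume.restrict (slab (-1) h)) := fun n =>
    ((cw n).aestronglyMeasurable.sub mf).enorm.pow_const _
  have m2 : ∀ n, AEMeasurable (fun p => ‖pdS 2 (w n) p
      - (fluidDomain h).indicator (fun p' => G p' 2) p‖ₑ ^ 2) (volume.restrict (slab (-1) h)) :=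
    fun n => (((hw n).hasPd 2).cont'.aestronglyMeasurable.sub mG).enorm.pow_const _
  have m3 : ∀ n, AEMeasurable (fun q => ‖w n (q, h q) - g q‖ₑ ^ 2) volume := fun n =>
    (((cw n).comp (continuous_id.prodMk hc)).aestronglyMeasurable.sub hg).enorm.pow_const _
  -- The three fibre errors are added up, so that a single subsequence makes all of them small on
  -- almost every fibre.
  set e : ℕ → Torus L₁ L₂ → ℝ≥0∞ := fun n q =>
    (∫⁻ z in Ioo (-1) (h q), ‖w n (q, z) - (fluidDomain h).indicator f (q, z)‖ₑ ^ 2)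
    + ((∫⁻ z in Ioo (-1) (h q), ‖pdS 2 (w n) (q, z)
        - (fluidDomain h).indicator (fun p' => G p' 2) (q, z)‖ₑ ^ 2)
    + ‖w n (q, h q) - g q‖ₑ ^ 2) with he
  have a1 := fun n => aemeasurable_lintegral_slab hc (m1 n)
  have a2 := fun n => aemeasurable_lintegral_slab hc (m2 n)
  have hlim : Tendsto (fun n => ∫⁻ q, e n q) atTop (𝓝 0) := by
    have t1 := tendsto_eLpNorm_two_iff.1 h1
    have t2 := tendsto_eLpNorm_two_iff.1 (h2 2)
    have t3 := tendsto_eLpNorm_two_iff.1 h3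
    have t := t1.add (t2.add t3)
    simp only [add_zero] at t
    refine t.congr fun n => ?_
    simp only [he]
    rw [lintegral_add_left' (a1 n), lintegral_add_left' (a2 n), ← lintegral_slab hc (m1 n),
      ← lintegral_slab hc (m2 n)]
    rfl
  obtain ⟨φ, hφ, ha⟩ := exists_subseq_ae_tendsto_zero
    (fun n => (a1 n).add ((a2 n).add (m3 n))) hlim
  refine ⟨fun n => w (φ n), fun n => hw _, h1.comp hφ.tendsto_atTop,
    fun i => (h2 i).comp hφ.tendsto_atTop, ?_⟩
  filter_upwards [ha] with q hq
  have sq : ∀ {k : ℕ → ℝ≥0∞}, (∀ n, k n ≤ e (φ n) q) → Tendsto k atTop (𝓝 0) := fun hk =>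
    tendsto_of_tendsto_of_tendsto_of_le_of_le tendsto_const_nhds hq (fun _ => zero_le) hk
  refine ⟨tendsto_eLpNorm_two_iff.2 (sq fun n => le_self_add), tendsto_eLpNorm_two_iff.2
    (sq fun n => le_add_left le_self_add), ?_⟩
  have t3 : Tendsto (fun n => ‖w (φ n) (q, h q) - g q‖ₑ ^ 2) atTop (𝓝 0) :=
    sq fun n => le_add_left le_add_self
  have t4 : Tendsto (fun n => (w (φ n) (q, h q) - g q) ^ 2) atTop (𝓝 0) := by
    have := (ENNReal.tendsto_toReal (by simp : (0 : ℝ≥0∞) ≠ ⊤)).comp t3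
    simpa [Function.comp_def] using this
  have t5 := t4.sqrt
  simp only [Real.sqrt_sq_eq_abs, Real.sqrt_zero] at t5
  rw [tendsto_iff_norm_sub_tendsto_zero]
  exact t5

/-- Pointwise and integral consequences of a graph trace. -/
theorem HasGraphTrace.estimates (ht : HasGraphTrace h f G g) (hc : Continuous h)
    (h0 : ∀ q, 0 ≤ h q) (hf : MemLp f 2 (volume.restrict (fluidDomain h)))
    (hG : ∀ i, MemLp (fun p => G p i) 2 (volume.restrict (fluidDomain h)))
    (hg : AEStronglyMeasurable g volume) :
    (∀ᵐ q, ‖g q‖ₑ ^ 2 ≤ 2 * fiberMul h f (fun p => G p 2) q ∧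
      ∀ᵐ z ∂(volume.restrict (Ioo 0 (h q))),
        ‖f (q, z)‖ₑ ^ 2 ≤ 2 * fiberMul h f (fun p => G p 2) q) ∧
    ∀ {Dh : Torus L₁ L₂ → Fin 2 → ℝ} {D2h : Torus L₁ L₂ → Fin 2 → Fin 2 → ℝ} {k : ℕ},
      IsH2 h Dh D2h → 0 < k →
      ∫⁻ q, fiberSq h f q ^ (2 * k) ≤ ENNReal.ofReal (L₁⁻¹ + L₂⁻¹ + 2 * k) ^ (4 * k)
        * (2 * h1Sq h f G) ^ (2 * k) * slopeConst L₁ L₂ k (lapSq D2h) := by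
  obtain ⟨w, hw, h1, h2, ha⟩ := ht.exists_seq hc hf hG hg
  have mf := memLp_indicator_fluidDomain hc hf
  have mG := fun i => memLp_indicator_fluidDomain hc (hG i)
  have esq : ∀ x : ℝ, ENNReal.ofReal (x ^ 2) = ‖x‖ₑ ^ 2 := fun x => by
    rw [Real.enorm_eq_ofReal_abs, ← ENNReal.ofReal_pow (abs_nonneg _), sq_abs]
  have key : ∀ᵐ q, Tendsto (fun n => ENNReal.ofReal (fiberInt (sqS (w n)) h q)) atTop
        (𝓝 (fiberSq h f q)) ∧
      ‖g q‖ₑ ^ 2 ≤ 2 * fiberMul h f (fun p => G p 2) q ∧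
      ∀ᵐ z ∂(volume.restrict (Ioo 0 (h q))),
        ‖f (q, z)‖ₑ ^ 2 ≤ 2 * fiberMul h f (fun p => G p 2) q := by
    filter_upwards [ha, memLp_slab hc mf, memLp_slab hc (mG 2)] with q hq hfq hGq
    obtain ⟨r1, r2, r3⟩ := section_limit (h0 q) (u := fun n z => w n (q, z))
      (u' := fun n z => pdS 2 (w n) (q, z))
      (fun n z => ((hw n).hasPd 2).hasDerivAt_vertical q z)
      (fun n => continuous_vertical ((hw n).hasPd 2).cont' q) hfq hGq
      (fun z hz => indicator_of_notMem (fun hc : (q, z) ∈ fluidDomain h => hz.not_gt hc.1) _)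
      hq.1 hq.2.1
    have e1 : ENNReal.ofReal (∫ z in Ioo (-1) (h q), (fluidDomain h).indicator f (q, z) ^ 2)
        = fiberSq h f q := by
      rw [ofReal_integral_eq_lintegral_ofReal hfq.integrable_sq
        (Eventually.of_forall fun _ => sq_nonneg _)]
      unfold fiberSq
      rw [← lintegral_Ioo_indicator q]
      refine setLIntegral_congr_fun measurableSet_Ioo fun z hz => ?_
      simp only [esq, indicator_section hz]
      by_cases hz0 : z ∈ Ioi (0 : ℝ) <;> simp [hz0]
    have e2 : ENNReal.ofReal (2 * ∫ z in Ioo (-1) (h q), |(fluidDomain h).indicator f (q, z)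
        * (fluidDomain h).indicator (fun p => G p 2) (q, z)|)
        = 2 * fiberMul h f (fun p => G p 2) q := by
      rw [ENNReal.ofReal_mul zero_le_two, ENNReal.ofReal_ofNat]
      have := ofReal_integral_norm_eq_lintegral_enorm (hfq.integrable_mul hGq)
      simp only [Real.norm_eq_abs, Pi.mul_apply] at this
      rw [this]
      unfold fiberMul
      rw [← lintegral_Ioo_indicator q]
      congr 1
      refine setLIntegral_congr_fun measurableSet_Ioo fun z hz => ?_
      simp only [enorm_mul, indicator_section hz]
      by_cases hz0 : z ∈ Ioi (0 : ℝ) <;> simp [hz0]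
    refine ⟨?_, ?_, ?_⟩
    · have hle : (-1 : ℝ) ≤ h q := by linarith [h0 q]
      rw [← e1]
      exact ENNReal.tendsto_ofReal r1
    · rw [← e2, ← esq]
      exact ENNReal.ofReal_le_ofReal (r3 _ hq.2.2)
    · have hle : volume.restrict (Ioo (0 : ℝ) (h q)) ≤ volume.restrict (Ioo (-1) (h q)) :=
        Measure.restrict_mono (Ioo_subset_Ioo_left (by norm_num)) le_rfl
      filter_upwards [ae_mono hle r2, ae_restrict_mem measurableSet_Ioo] with z hz hzm
      rw [← e2, ← esq]
      have e3 : f (q, z) = (fluidDomain h).indicator f (q, z) :=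
        (indicator_of_mem (show (q, z) ∈ fluidDomain h from hzm) f).symm
      rw [e3]
      exact ENNReal.ofReal_le_ofReal hz
  refine ⟨key.mono fun q hq => hq.2, fun {Dh D2h k} hh hk => ?_⟩
  -- An upper bound, by the triangle inequality, for twice the squared H¹ norm of the approximant;
  -- the errors vanish, so it tends to twice that of `f`.
  set c : ℕ → ℝ≥0∞ := fun n => 2 * ((eLpNorm (fun p => w n p - (fluidDomain h).indicator f p) 2
      (volume.restrict (extDomain h)) + eLpNorm f 2 (volume.restrict (fluidDomain h))) ^ 2
    + ∑ i, (eLpNorm (fun p => pdS i (w n) p - (fluidDomain h).indicator (fun p' => G p' i) p) 2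
      (volume.restrict (extDomain h))
      + eLpNorm (fun p => G p i) 2 (volume.restrict (fluidDomain h))) ^ 2) with hcdef
  have hcl : Tendsto c atTop (𝓝 (2 * h1Sq h f G)) := by
    have e : h1Sq h f G = (0 + eLpNorm f 2 (volume.restrict (fluidDomain h))) ^ 2
        + ∑ i, (0 + eLpNorm (fun p => G p i) 2 (volume.restrict (fluidDomain h))) ^ 2 := by
      simp only [zero_add, eLpNorm_two_sq]; rfl
    rw [e]
    refine ENNReal.Tendsto.const_mul (Tendsto.add ?_ (tendsto_finsetSum _ fun i _ => ?_))
      (Or.inr (by finiteness))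
    · exact ENNReal.Tendsto.pow (h1.add tendsto_const_nhds)
    · exact ENNReal.Tendsto.pow ((h2 i).add tendsto_const_nhds)
  have htri : ∀ {a b : Space L₁ L₂ → ℝ}, Continuous a →
      MemLp b 2 (volume.restrict (fluidDomain h)) →
      eLpNorm a 2 (volume.restrict (extDomain h))
        ≤ eLpNorm (fun p => a p - (fluidDomain h).indicator b p) 2 (volume.restrict (extDomain h))
          + eLpNorm b 2 (volume.restrict (fluidDomain h)) := by
    intro a b ha hb
    have mb := (memLp_indicator_fluidDomain hc hb).aestronglyMeasurable
    rw [← eLpNorm_indicator_fluidDomain hc b]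
    refine le_trans (le_of_eq ?_) (eLpNorm_add_le (ha.aestronglyMeasurable.sub mb) mb (by norm_num))
    congr 1
    funext p
    simp
  refine lintegral_le_of_tendsto
    (F := fun n q => ENNReal.ofReal (fiberInt (sqS (w n)) h q) ^ (2 * k)) (fun n => ?_) ?_
    (c := fun n => ENNReal.ofReal (L₁⁻¹ + L₂⁻¹ + 2 * k) ^ (4 * k) * c n ^ (2 * k)
      * slopeConst L₁ L₂ k (lapSq D2h)) (fun n => ?_) ?_
  · exact ((continuous_fiberInt (((hw n).hasPd 0).cont.pow 2) hc).measurable.ennreal_ofReal.pow_const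
      _).aemeasurable
  · filter_upwards [key] with q hq
    exact ENNReal.Tendsto.pow hq.1
  · refine (hh.lintegral_fiberInt_pow_le hc h0 hk (hw n)).trans ?_
    rw [ofReal_h1_eq hc h0 (hw n)]
    simp only [hcdef]
    gcongr with i
    · exact htri ((hw n).hasPd 0).cont hf
    · exact htri ((hw n).hasPd i).cont' (hG i)
  · refine ENNReal.Tendsto.mul_const (ENNReal.Tendsto.const_mul (ENNReal.Tendsto.pow hcl)
      (Or.inr (by finiteness))) (Or.inr (slopeConst_ne_top _ _))

end Main

end

end FluidPlate

/-! ### Steklov averages, Gauss' theorem, exchange of derivatives and Korn's inequality -/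

namespace FluidPlate

set_option linter.unusedSectionVars false

noncomputable section

section Steklov

variable {X : Type*} [TopologicalSpace X] [AddCommGroup X] [ContinuousAdd X]

/-- Steklov averages in direction `d`. -/
def steklov (d : ℝ →ₜ+ X) (r : ℝ) (k : X → ℝ) (p : X) : ℝ := r⁻¹ * ∫ s in (0 : ℝ)..r, k (p + d s)

theorem HasPd.steklov {d : ℝ →ₜ+ X} {k : X → ℝ} (hk : Continuous k) (r : ℝ) :
    HasPd d (steklov d r k) (fun p => r⁻¹ * (k (p + d r) - k p)) where
  cont := by
    refine continuous_const.mul ?_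
    refine intervalIntegral.continuous_parametric_intervalIntegral_of_continuous'
      (f := fun p s => k (p + d s)) ?_ _ _
    exact hk.comp (continuous_fst.add (d.continuous_toFun.comp continuous_snd))
  cont' := continuous_const.mul ((hk.comp (continuous_add_const _)).sub hk)
  deriv p := by
    have hc := continuous_line hk d p
    have e : ∀ τ : ℝ, FluidPlate.steklov d r k (p + d τ)
        = r⁻¹ * ((∫ s in (0 : ℝ)..(τ + r), k (p + d s)) - ∫ s in (0 : ℝ)..τ, k (p + d s)) := by
      intro τ
      unfold FluidPlate.steklov
      congr 1
      rw [intervalIntegral.integral_interval_sub_left (hc.intervalIntegrable _ _)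
        (hc.intervalIntegrable _ _)]
      have := intervalIntegral.integral_comp_add_left (a := 0) (b := r) (fun s => k (p + d s)) τ
      simp only [add_zero] at this
      rw [← this]
      refine intervalIntegral.integral_congr fun s _ => ?_
      simp only [map_add, add_assoc]
    simp only [e]
    have h0 : ∀ x : ℝ, HasDerivAt (fun τ : ℝ => ∫ s in (0 : ℝ)..τ, k (p + d s)) (k (p + d x)) x :=
      fun x => intervalIntegral.integral_hasDerivAt_right (hc.intervalIntegrable _ _)
        hc.aestronglyMeasurable.stronglyMeasurableAtFilter hc.continuousAt
    have h1 : HasDerivAt (fun τ : ℝ => ∫ s in (0 : ℝ)..(τ + r), k (p + d s)) (k (p + d r)) 0 := by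
      have := h0 (0 + r)
      simpa using this.comp_add_const 0 r
    refine HasDerivAt.congr_deriv ((h1.sub (h0 0)).const_mul r⁻¹) (by simp)

/-- The average of a derivative is a difference quotient, which is as smooth as the function itself.
This replaces second derivatives where only C¹ regularity is at hand. -/
theorem HasPd.steklov_eq {d : ℝ →ₜ+ X} {g g' : X → ℝ} (h : HasPd d g g') (r : ℝ) (p : X) :
    FluidPlate.steklov d r g' p = r⁻¹ * (g (p + d r) - g p) := by
  unfold FluidPlate.steklov
  rw [h.integral_line]
  simp

theorem tendsto_steklov {d : ℝ →ₜ+ X} {k : X → ℝ} (hk : Continuous k) (p : X) :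
    Tendsto (fun n : ℕ => steklov d (1 / ((n : ℝ) + 1)) k p) atTop (𝓝 (k p)) := by
  have hc := HasPd.continuous_line hk d p
  have h0 : HasDerivAt (fun τ : ℝ => ∫ s in (0 : ℝ)..τ, k (p + d s)) (k (p + d 0)) 0 :=
    intervalIntegral.integral_hasDerivAt_right (hc.intervalIntegrable _ _)
        hc.aestronglyMeasurable.stronglyMeasurableAtFilter hc.continuousAt
  have h1 := h0.tendsto_slope_zero
  simp only [zero_add, intervalIntegral.integral_same, sub_zero, map_zero, add_zero,
    smul_eq_mul] at h1
  exact h1.comp (tendsto_nhdsWithin_iff.2 ⟨tendsto_one_div_add_atTop_nhds_zero_nat,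
    Eventually.of_forall fun n => (Nat.one_div_pos_of_nat (α := ℝ)).ne'⟩)

theorem steklov_bound {d : ℝ →ₜ+ X} {k : X → ℝ} (hk : Continuous k) {K : Set X}
    (hK : IsCompact K) : ∃ C, ∀ p ∈ K, ∀ n : ℕ, |steklov d (1 / ((n : ℝ) + 1)) k p| ≤ C := by
  have hc : Continuous fun a : X × ℝ => k (a.1 + d a.2) :=
    hk.comp (continuous_fst.add (d.continuous_toFun.comp continuous_snd))
  obtain ⟨C, hC⟩ := (hK.prod (isCompact_Icc (a := (0 : ℝ)) (b := 1))).exists_bound_of_continuousOn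
    hc.continuousOn
  refine ⟨C, fun p hp n => ?_⟩
  have hn : (0 : ℝ) < 1 / ((n : ℝ) + 1) := Nat.one_div_pos_of_nat
  have hn1 : 1 / ((n : ℝ) + 1) ≤ 1 := by
    rw [div_le_one (by positivity)]; linarith [(Nat.cast_nonneg n : (0 : ℝ) ≤ n)]
  unfold steklov
  have h1 := intervalIntegral.norm_integral_le_of_norm_le_const (a := 0) (b := 1 / ((n : ℝ) + 1))
    (f := fun s => k (p + d s)) (C := C) fun s hs => by
      rw [uIoc_of_le hn.le] at hs
      exact hC (p, s) ⟨hp, hs.1.le, hs.2.trans hn1⟩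
  rw [Real.norm_eq_abs, sub_zero, abs_of_pos hn] at h1
  rw [abs_mul, abs_of_pos (inv_pos.2 hn), inv_mul_le_iff₀ hn, mul_comm]
  exact h1

end Steklov

variable {L₁ L₂ : ℝ} [Fact (0 < L₁)] [Fact (0 < L₂)]

section Gauss

variable {h : Torus L₁ L₂ → ℝ} {Dh : Torus L₁ L₂ → Fin 2 → ℝ}
  {D2h : Torus L₁ L₂ → Fin 2 → Fin 2 → ℝ}

theorem measure_slab_lt_top (hh : Continuous h) (a : ℝ) : volume (slab a h) < ⊤ := by
  obtain ⟨R, hR⟩ := exists_slab_subset hh a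
  exact (measure_mono hR).trans_lt ((isCompact_univ.prod isCompact_Icc).measure_lt_top)

theorem integral_extDomain_eq (hh : Continuous h) (h0 : ∀ q, 0 ≤ h q)
    {F : Space L₁ L₂ → ℝ} (hF : Continuous F) :
    ∫ p in extDomain h, F p = ∫ q, fiberInt F h q := by
  have hS : MeasurableSet (extDomain h) := measurableSet_slab (-1) hh
  obtain ⟨R, hR⟩ := exists_slab_subset hh (-1)
  have hi : IntegrableOn F (extDomain h) :=
    (hF.continuousOn.integrableOn_compact (isCompact_univ.prod isCompact_Icc)).mono_set hR
  rw [← integral_indicator hS]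
  refine (integral_prod (μ := (volume : Measure (Torus L₁ L₂))) (ν := (volume : Measure ℝ)) _
    ((integrable_indicator_iff hS).2 hi)).trans (integral_congr_ae (Eventually.of_forall fun q => ?_))
  simp only
  unfold fiberInt
  rw [intervalIntegral.integral_of_le (by linarith [h0 q]), integral_Ioc_eq_integral_Ioo,
    ← integral_indicator measurableSet_Ioo]
  rfl

/-- Gauss' theorem for horizontal derivatives below the graph of a function in `H²`. -/
theorem IsH2.integral_fiberInt_pd (hh : IsH2 h Dh D2h) (hc : Continuous h) {i : Fin 2}
    {F F' : Space L₁ L₂ → ℝ} (hF : HasPd (dirS i.castSucc) F F') :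
    ∫ q, fiberInt F' h q = -∫ q, F (q, h q) * Dh q i := by
  obtain ⟨H, H1, H2, ε, hA⟩ := hh.exists_approx hc
  have hHc : ∀ n, Continuous (H n) := fun n => (hA.pd n 0).cont
  have t1 := (tendsto_integral_fiberInt hF.cont' hHc hc hA.tendsto_zero hA.abs_le).2
  have cF : ∀ {k : Torus L₁ L₂ → ℝ}, Continuous k → Continuous fun q => F (q, k q) :=
    fun hk => hF.cont.comp (continuous_id.prodMk hk)
  have hL : Tendsto (fun n => eLpNorm (fun q => F (q, H n q) - F (q, h q)) 2 volume)
      atTop (𝓝 0) := by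
    obtain ⟨C, hC0, hC⟩ := exists_bound_of_continuous hc
    obtain ⟨B, hB⟩ := hA.tendsto_zero.bddAbove_range
    have hHB : ∀ n q, H n q ∈ Icc (-(C + B)) (C + B) := fun n q => by
      have h1 := abs_le.1 (hA.abs_le n q)
      have h2 := abs_le.1 (hC q)
      have h3 := hB (mem_range_self n)
      constructor <;> linarith
    obtain ⟨M, hM⟩ := (isCompact_univ (X := Torus L₁ L₂)).prod
      (isCompact_Icc (a := -(C + B)) (b := C + B)) |>.exists_bound_of_continuousOn
        hF.cont.continuousOn
    have hhB : ∀ q, h q ∈ Icc (-(C + B)) (C + B) := fun q =>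
      isClosed_Icc.mem_of_tendsto (hA.tendsto q) (Eventually.of_forall fun n => hHB n q)
    rw [tendsto_eLpNorm_two_iff]
    have := tendsto_lintegral_of_dominated_convergence (μ := (volume : Measure (Torus L₁ L₂)))
      (F := fun n q => ‖F (q, H n q) - F (q, h q)‖ₑ ^ 2) (f := fun _ => 0)
      (fun _ => ENNReal.ofReal (M + M) ^ 2) (fun n => by
        exact ((cF (hHc n)).sub (cF hc)).measurable.enorm.pow_const _)
      (fun n => Eventually.of_forall fun q => by
        refine pow_le_pow_left' ?_ 2
        rw [← ofReal_norm]
        exact ENNReal.ofReal_le_ofReal ((norm_sub_le _ _).trans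
          (add_le_add (hM (q, H n q) ⟨mem_univ _, hHB n q⟩) (hM (q, h q) ⟨mem_univ _, hhB q⟩))))
      (by
        rw [lintegral_const]
        exact (ENNReal.mul_lt_top (by finiteness) (measure_lt_top _ _)).ne)
      (Eventually.of_forall fun q => by
        have ht : Tendsto (fun n => F (q, H n q) - F (q, h q)) atTop (𝓝 0) := by
          have := ((hF.cont.comp (Continuous.prodMk_right q)).tendsto (h q)).comp (hA.tendsto q)
          simpa using this.sub_const (F (q, h q))
        have := ENNReal.Tendsto.pow (n := 2) ht.enorm
        simpa using this)
    simpa using this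
  have t2 := tendsto_integral_mul_of_L2 (μ := (volume : Measure (Torus L₁ L₂)))
    (fun n => memLp_of_continuous (cF (hHc n)) 2) (fun n => memLp_of_continuous (hA.pd n i).cont' 2)
    (memLp_of_continuous (cF hc) 2) (hh.grad_memLp i) hL (hA.grad_L2 i)
  -- For smooth graphs this is the Leibniz rule integrated over the torus. In the limit the surface
  -- values converge uniformly and the slopes in L².
  have hz : ∀ n, (∫ q, FluidPlate.fiberInt F' (H n) q) + ∫ q, F (q, H n q) * H1 n i q = 0 := by
    intro n
    have := (hF.fiberInt (hA.pd n i)).integral_eq_zero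
    rwa [integral_add (f := fun q => FluidPlate.fiberInt F' (H n) q)
      (g := fun q => F (q, H n q) * H1 n i q)
      (integrable_of_continuous (continuous_fiberInt hF.cont' (hHc n)))
      (integrable_of_continuous ((cF (hHc n)).mul (hA.pd n i).cont'))] at this
  have t3 := t1.add t2
  simp only [hz] at t3
  linarith [tendsto_nhds_unique t3 tendsto_const_nhds]

variable {f : Space L₁ L₂ → ℝ} {G : Space L₁ L₂ → Fin 3 → ℝ}

theorem integral_indicator_mul (hh : Continuous h) (f φ : Space L₁ L₂ → ℝ) :
    ∫ p in extDomain h, (fluidDomain h).indicator f p * φ p = ∫ p in fluidDomain h, f p * φ p := by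
  have hS : MeasurableSet (fluidDomain h) := measurableSet_slab 0 hh
  have e : (fun p => (fluidDomain h).indicator f p * φ p)
      = (fluidDomain h).indicator fun p => f p * φ p := by
    funext p
    by_cases hp : p ∈ fluidDomain h <;> simp [hp]
  rw [e, setIntegral_indicator hS, inter_eq_right.2 (fluidDomain_subset_extDomain h)]

theorem integrable_mul_of_memLp_slab (hh : Continuous h) {a : ℝ} {f φ : Space L₁ L₂ → ℝ}
    (hf : MemLp f 2 (volume.restrict (slab a h))) (hφ : Continuous φ) :
    Integrable (fun p => f p * φ p) (volume.restrict (slab a h)) :=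
  hf.integrable_mul (memLp_slab_of_continuous hh hφ)

/-- Integration by parts against a function with vanishing trace, for test functions vanishing at
the artificial bottom. -/
theorem HasGraphTrace.integral_by_parts_aux (ht : HasGraphTrace h f G (fun _ => 0))
    (hh : IsH2 h Dh D2h) (hc : Continuous h) (h0 : ∀ q, 0 ≤ h q)
    (hf : MemLp f 2 (volume.restrict (fluidDomain h)))
    (hG : ∀ i, MemLp (fun p => G p i) 2 (volume.restrict (fluidDomain h)))
    {i : Fin 3} {φ φ' : Space L₁ L₂ → ℝ} (hφ : HasPd (dirS i) φ φ') (hb : ∀ q, φ (q, -1) = 0) :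
    ∫ p in fluidDomain h, f p * φ' p = -∫ p in fluidDomain h, G p i * φ p := by
  obtain ⟨w, hw, h1, h2, h3⟩ := ht
  have cw : ∀ n, Continuous (w n) := fun n => ((hw n).hasPd 0).cont
  have cw' : ∀ n, Continuous (pdS i (w n)) := fun n => ((hw n).hasPd i).cont'
  have z : ∀ k : Space L₁ L₂ → ℝ, Tendsto (fun _ : ℕ => eLpNorm (fun p => k p - k p) 2
      (volume.restrict (extDomain h))) atTop (𝓝 0) := fun k => by simp
  have mc : ∀ {k : Space L₁ L₂ → ℝ}, Continuous k → MemLp k 2 (volume.restrict (extDomain h)) :=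
    fun hk => memLp_slab_of_continuous hc hk
  have t1 := tendsto_integral_mul_of_L2 (fun n => mc (cw n)) (fun _ => mc hφ.cont')
    (memLp_indicator_fluidDomain hc hf) (mc hφ.cont') h1 (z φ')
  have t2 := tendsto_integral_mul_of_L2 (fun n => mc (cw' n)) (fun _ => mc hφ.cont)
    (memLp_indicator_fluidDomain hc (hG i)) (mc hφ.cont) (h2 i) (z φ)
  rw [integral_indicator_mul hc] at t1 t2
  have cg : ∀ {k : Space L₁ L₂ → ℝ}, Continuous k → Continuous fun q => k (q, h q) :=
    fun hk => hk.comp (continuous_id.prodMk hc)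
  have hsum : ∀ n, (∫ p in extDomain h, pdS i (w n) p * φ p) + ∫ p in extDomain h, w n p * φ' p
      = ∫ q, fiberInt (fun p => pdS i (w n) p * φ p + w n p * φ' p) h q := fun n => by
    rw [← integral_extDomain_eq (F := fun p => pdS i (w n) p * φ p + w n p * φ' p) hc h0
        (((cw' n).mul hφ.cont).add ((cw n).mul hφ.cont')),
      integral_add (f := fun p => pdS i (w n) p * φ p) (g := fun p => w n p * φ' p)]
    · exact integrable_mul_of_memLp_slab hc (mc (cw' n)) hφ.cont
    · exact integrable_mul_of_memLp_slab hc (mc (cw n)) hφ.cont'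
  -- The boundary contribution. Vertically it is the value at the graph, since `φ` vanishes at
  -- height −1; horizontally Gauss' theorem adds the slope as a factor. Both vanish in the limit as
  -- the trace of `w n` tends to zero in L².
  have hz : Tendsto (fun n => ∫ q, fiberInt (fun p => pdS i (w n) p * φ p + w n p * φ' p) h q)
      atTop (𝓝 0) := by
    have bt : ∀ {k : Torus L₁ L₂ → ℝ}, MemLp k 2 →
        Tendsto (fun n => ∫ q, w n (q, h q) * k q) atTop (𝓝 0) := fun {k} hk => by
      have := tendsto_integral_mul_of_L2 (μ := (volume : Measure (Torus L₁ L₂)))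
        (a' := fun _ => 0) (b := fun _ => k) (b' := k)
        (fun n => memLp_of_continuous (cg (cw n)) 2) (fun _ => hk) (by simp) hk h3 (by simp)
      simpa using this
    refine Fin.lastCases ?_ (fun i => ?_) i (motive := fun i => HasPd (dirS i) φ φ' →
      Tendsto (fun n => ∫ q, fiberInt (fun p => pdS i (w n) p * φ p + w n p * φ' p) h q)
        atTop (𝓝 0)) hφ
    · intro hφ
      refine (bt (memLp_of_continuous (cg hφ.cont) 2)).congr fun n => ?_
      refine integral_congr_ae (Eventually.of_forall fun q => ?_)
      have hp := ((hw n).hasPd (Fin.last 2)).mul hφ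
      have := intervalIntegral.integral_eq_sub_of_hasDerivAt (a := -1) (b := h q)
        (fun s _ => hp.hasDerivAt_vertical q s)
        ((continuous_vertical hp.cont' q).intervalIntegrable _ _)
      simp only [hb, mul_zero, sub_zero] at this
      exact this.symm
    · intro hφ
      obtain ⟨C, hC0, hC⟩ := exists_bound_of_continuous (cg hφ.cont)
      have hm : MemLp (fun q => φ (q, h q) * Dh q i) 2 := by
        refine MemLp.of_le_mul (c := C) (hh.grad_memLp i)
          ((cg hφ.cont).aestronglyMeasurable.mul (hh.grad_memLp i).aestronglyMeasurable)
          (Eventually.of_forall fun q => ?_)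
        rw [norm_mul]
        exact mul_le_mul_of_nonneg_right (hC q) (norm_nonneg _)
      have := (bt hm).neg
      rw [neg_zero] at this
      refine this.congr fun n => ?_
      rw [hh.integral_fiberInt_pd hc (((hw n).hasPd i.castSucc).mul hφ)]
      simp only [mul_assoc]
  have t3 := t2.add t1
  simp only [hsum] at t3
  linarith [tendsto_nhds_unique t3 hz]

/-- The condition at height −1 is removed by a cutoff equal to one above height zero, invisible in
the fluid domain. The bottom z = 0 gives no boundary term because the zero extension of `f` is
approximated in H¹ across it. -/
theorem HasGraphTrace.integral_by_parts (ht : HasGraphTrace h f G (fun _ => 0))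
    (hh : IsH2 h Dh D2h) (hc : Continuous h) (h0 : ∀ q, 0 ≤ h q)
    (hf : MemLp f 2 (volume.restrict (fluidDomain h)))
    (hG : ∀ i, MemLp (fun p => G p i) 2 (volume.restrict (fluidDomain h)))
    {i : Fin 3} {φ φ' : Space L₁ L₂ → ℝ} (hφ : HasPd (dirS i) φ φ') :
    ∫ p in fluidDomain h, f p * φ' p = -∫ p in fluidDomain h, G p i * φ p := by
  have hS : MeasurableSet (fluidDomain h) := measurableSet_slab 0 hc
  obtain ⟨χ, hχ, hχ1, hχ0⟩ : ∃ χ : ℝ → ℝ, ContDiff ℝ ∞ χ ∧ (∀ z, 0 < z → χ z = 1) ∧ χ (-1) = 0 :=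
    ⟨fun z => Real.smoothTransition (z + 1),
      Real.smoothTransition.contDiff.comp (contDiff_id.add contDiff_const),
      fun z hz => Real.smoothTransition.one_of_one_le (by linarith),
      Real.smoothTransition.zero_of_nonpos (by norm_num)⟩
  have hχc : ContDiffS 1 (fun p : Space L₁ L₂ => χ p.2) :=
    (hχ.of_le (by simp)).comp (contDiff_snd.comp contDiff_snd :
      ContDiff ℝ 1 fun q : ℝ × ℝ × ℝ => q.2.2)
  have hd := (hχc.hasPd i)
  have hd0 : ∀ p ∈ fluidDomain h, pdS i (fun p : Space L₁ L₂ => χ p.2) p = 0 := by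
    intro p hp
    rw [pdS_eq]
    have : (fun s : ℝ => χ (p + dirS i s).2) =ᶠ[𝓝 0] fun _ => 1 := by
      have hct : Continuous fun s : ℝ => (p + dirS i s).2 :=
        continuous_snd.comp (continuous_const.add (dirS i).continuous_toFun)
      have h1 : ∀ᶠ s in 𝓝 (0 : ℝ), 0 < (p + dirS i s).2 :=
        hct.continuousAt.eventually_const_lt (by simpa using hp.1)
      filter_upwards [h1] with s hs
      exact hχ1 _ hs
    rw [this.deriv_eq]
    simp
  have key := ht.integral_by_parts_aux hh hc h0 hf hG (hd.mul hφ) (fun q => by simp [hχ0])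
  have e1 : ∀ p ∈ fluidDomain h, χ p.2 = 1 := fun p hp => hχ1 _ hp.1
  have k1 : ∫ p in fluidDomain h, f p * (pdS i (fun p : Space L₁ L₂ => χ p.2) p * φ p + χ p.2 * φ' p)
      = ∫ p in fluidDomain h, f p * φ' p :=
    setIntegral_congr_fun hS fun p hp => by simp only [hd0 p hp, e1 p hp]; ring
  have k2 : ∫ p in fluidDomain h, G p i * (χ p.2 * φ p) = ∫ p in fluidDomain h, G p i * φ p :=
    setIntegral_congr_fun hS fun p hp => by simp only [e1 p hp]; ring
  rw [k1, k2] at key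
  exact key

theorem tendsto_integral_mul_steklov (hc : Continuous h) {A k : Space L₁ L₂ → ℝ}
    (hA : MemLp A 2 (volume.restrict (fluidDomain h))) (hk : Continuous k) (i : Fin 3) :
    Tendsto (fun n : ℕ => ∫ p in fluidDomain h, A p * steklov (dirS i) (1 / ((n : ℝ) + 1)) k p)
      atTop (𝓝 (∫ p in fluidDomain h, A p * k p)) := by
  have hS : MeasurableSet (fluidDomain h) := measurableSet_slab 0 hc
  obtain ⟨R, hR⟩ := exists_slab_subset hc 0
  obtain ⟨C, hC⟩ := steklov_bound (d := dirS i) hk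
    ((isCompact_univ (X := Torus L₁ L₂)).prod (isCompact_Icc (a := (0 : ℝ)) (b := R)))
  have : IsFiniteMeasure (volume.restrict (fluidDomain h)) :=
    ⟨by rw [Measure.restrict_apply_univ]; exact measure_slab_lt_top hc 0⟩
  refine tendsto_integral_of_dominated_convergence (fun p => ‖A p‖ * C) (fun n =>
    hA.aestronglyMeasurable.mul (HasPd.steklov hk _).cont.aestronglyMeasurable)
    ((hA.integrable (by norm_num)).norm.mul_const C) (fun n => ?_)
    (Eventually.of_forall fun p => (tendsto_steklov hk p).const_mul _)
  filter_upwards [ae_restrict_mem hS] with p hp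
  rw [norm_mul]
  exact mul_le_mul_of_nonneg_left (hC p (hR hp) n) (norm_nonneg _)

/-- The mixed derivatives of two functions may be exchanged under the integral if one of them
vanishes on the graph. -/
theorem HasGraphTrace.integral_exchange (ht : HasGraphTrace h f G (fun _ => 0))
    (hh : IsH2 h Dh D2h) (hc : Continuous h) (h0 : ∀ q, 0 ≤ h q)
    (hf : MemLp f 2 (volume.restrict (fluidDomain h)))
    (hG : ∀ i, MemLp (fun p => G p i) 2 (volume.restrict (fluidDomain h)))
    {f₂ : Space L₁ L₂ → ℝ} {G₂ : Space L₁ L₂ → Fin 3 → ℝ} {g₂ : Torus L₁ L₂ → ℝ}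
    (ht₂ : HasGraphTrace h f₂ G₂ g₂)
    (hG₂ : ∀ i, MemLp (fun p => G₂ p i) 2 (volume.restrict (fluidDomain h))) (a b : Fin 3) :
    ∫ p in fluidDomain h, G p a * G₂ p b = ∫ p in fluidDomain h, G p b * G₂ p a := by
  obtain ⟨w, hw, -, h2, -⟩ := ht₂
  -- The approximants are only C¹, so mixed second derivatives are replaced. The difference quotient
  -- of ∂ₐw in direction `b` is both the `b`-derivative of a Steklov average of ∂ₐw and the
  -- `a`-derivative of a difference quotient of `w`. Two integrations by parts are compared, then
  -- the step size tends to zero.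
  have key : ∀ n, ∫ p in fluidDomain h, G p a * pdS b (w n) p
      = ∫ p in fluidDomain h, G p b * pdS a (w n) p := fun n => by
    have hpa := (hw n).hasPd a
    have hpb := (hw n).hasPd b
    refine tendsto_nhds_unique (tendsto_integral_mul_steklov hc (hG a) hpb.cont' b)
      ((tendsto_integral_mul_steklov hc (hG b) hpa.cont' b).congr fun m => ?_)
    set r : ℝ := 1 / ((m : ℝ) + 1)
    have e1 := ht.integral_by_parts hh hc h0 hf hG (HasPd.steklov (d := dirS b) hpa.cont' r)
    have hq : HasPd (dirS a) (fun p => r⁻¹ * (w n (p + dirS b r) - w n p))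
        (fun p => r⁻¹ * (pdS a (w n) (p + dirS b r) - pdS a (w n) p)) := by
      have := ((hpa.translate (dirS b r)).add (hpa.const_mul (-1))).const_mul r⁻¹
      convert this using 2 <;> ring
    have e2 := ht.integral_by_parts hh hc h0 hf hG hq
    simp only [hpb.steklov_eq]
    linarith
  have hle : volume.restrict (fluidDomain h) ≤ volume.restrict (extDomain h) :=
    Measure.restrict_mono (fluidDomain_subset_extDomain h) le_rfl
  have hS : MeasurableSet (fluidDomain h) := measurableSet_slab 0 hc
  have conv : ∀ i, Tendsto (fun n => eLpNorm (fun p => pdS i (w n) p - G₂ p i) 2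
      (volume.restrict (fluidDomain h))) atTop (𝓝 0) := fun i => by
    refine tendsto_of_tendsto_of_tendsto_of_le_of_le tendsto_const_nhds (h2 i) (fun _ => zero_le)
      fun n => ?_
    refine le_trans (le_of_eq (eLpNorm_congr_ae ?_)) (eLpNorm_mono_measure _ hle)
    filter_upwards [ae_restrict_mem hS] with p hp
    simp [hp]
  have T : ∀ a b, Tendsto (fun n => ∫ p in fluidDomain h, G p a * pdS b (w n) p) atTop
      (𝓝 (∫ p in fluidDomain h, G p a * G₂ p b)) := fun a b =>
    tendsto_integral_mul_of_L2 (a := fun _ p => G p a) (fun _ => hG a)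
      (fun n => memLp_slab_of_continuous hc ((hw n).hasPd b).cont') (hG a) (hG₂ b) (by simp) (conv b)
  exact tendsto_nhds_unique (T a b) ((T b a).congr fun n => (key n).symm)

end Gauss

/-- Korn's inequality with constant one for fields with vertical trace on the graph. -/
theorem integral_stress_ge {h : Torus L₁ L₂ → ℝ} {Dh : Torus L₁ L₂ → Fin 2 → ℝ}
    {D2h : Torus L₁ L₂ → Fin 2 → Fin 2 → ℝ} {u : Space L₁ L₂ → Fin 3 → ℝ}
    {A : Space L₁ L₂ → Fin 3 → Fin 3 → ℝ} {v : Torus L₁ L₂ → ℝ} {μ lam : ℝ}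
    (hμ : 0 < μ) (hlam : 0 ≤ lam)
    (ht : ∀ i, HasGraphTrace h (fun p => u p i) (fun p => A p i)
      (fun p => (![0, 0, v p] : Fin 3 → ℝ) i))
    (hh : IsH2 h Dh D2h) (hc : Continuous h) (h0 : ∀ q, 0 ≤ h q)
    (hu : ∀ i, MemLp (fun p => u p i) 2 (volume.restrict (fluidDomain h)))
    (hA : ∀ i j, MemLp (fun p => A p i j) 2 (volume.restrict (fluidDomain h))) :
    Integrable (fun p => ∑ i, ∑ j, stress μ lam (A p) i j * A p i j)
      (volume.restrict (fluidDomain h)) ∧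
    μ * ∫ p in fluidDomain h, ∑ i, ∑ j, A p i j ^ 2
      ≤ ∫ p in fluidDomain h, ∑ i, ∑ j, stress μ lam (A p) i j * A p i j := by
  have I : ∀ i j k l, Integrable (fun p => A p i j * A p k l) (volume.restrict (fluidDomain h)) :=
    fun i j k l => (hA i j).integrable_mul (hA k l)
  -- One factor must have zero trace on the graph, which holds for the horizontal components. Each
  -- of the three mixed products below contains one.
  have ex : ∀ i k a b, (i = 0 ∨ i = 1) → ∫ p in fluidDomain h, A p i a * A p k b
      = ∫ p in fluidDomain h, A p i b * A p k a := by
    intro i k a b hi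
    have h0' : HasGraphTrace h (fun p => u p i) (fun p => A p i) (fun _ => 0) := by
      rcases hi with rfl | rfl
      · simpa using ht 0
      · simpa using ht 1
    exact h0'.integral_exchange hh hc h0 (hu i) (hA i) (ht k) (hA k) a b
  have x1 := ex 0 1 1 0 (Or.inl rfl)
  have x2 := ex 0 2 2 0 (Or.inl rfl)
  have x3 := ex 1 2 2 1 (Or.inr rfl)
  set N : Space L₁ L₂ → ℝ := fun p => ∑ i, ∑ j, A p i j ^ 2 with hN
  set τ : Space L₁ L₂ → ℝ := fun p => (A p 0 0 + A p 1 1 + A p 2 2) ^ 2 with hτ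
  set c : Space L₁ L₂ → ℝ := fun p => (A p 0 1 * A p 1 0 - A p 0 0 * A p 1 1)
    + (A p 0 2 * A p 2 0 - A p 0 0 * A p 2 2) + (A p 1 2 * A p 2 1 - A p 1 1 * A p 2 2) with hcdef
  have iN : Integrable N (volume.restrict (fluidDomain h)) :=
    integrable_finsetSum _ fun i _ => integrable_finsetSum _ fun j _ => (hA i j).integrable_sq
  have iτ : Integrable τ (volume.restrict (fluidDomain h)) :=
    (((hA 0 0).add (hA 1 1)).add (hA 2 2)).integrable_sq
  have i1 : Integrable (fun p => A p 0 1 * A p 1 0 - A p 0 0 * A p 1 1)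
      (volume.restrict (fluidDomain h)) := (I 0 1 1 0).sub (I 0 0 1 1)
  have i2 : Integrable (fun p => A p 0 2 * A p 2 0 - A p 0 0 * A p 2 2)
      (volume.restrict (fluidDomain h)) := (I 0 2 2 0).sub (I 0 0 2 2)
  have i3 : Integrable (fun p => A p 1 2 * A p 2 1 - A p 1 1 * A p 2 2)
      (volume.restrict (fluidDomain h)) := (I 1 2 2 1).sub (I 1 1 2 2)
  have ic : Integrable c (volume.restrict (fluidDomain h)) := (i1.add i2).add i3
  have hcz : ∫ p in fluidDomain h, c p = 0 := by
    have : ∫ p in fluidDomain h, c p = ((∫ p in fluidDomain h, A p 0 1 * A p 1 0)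
        - ∫ p in fluidDomain h, A p 0 0 * A p 1 1)
        + ((∫ p in fluidDomain h, A p 0 2 * A p 2 0) - ∫ p in fluidDomain h, A p 0 0 * A p 2 2)
        + ((∫ p in fluidDomain h, A p 1 2 * A p 2 1)
          - ∫ p in fluidDomain h, A p 1 1 * A p 2 2) := by
      rw [← integral_sub (I 0 1 1 0) (I 0 0 1 1), ← integral_sub (I 0 2 2 0) (I 0 0 2 2),
        ← integral_sub (I 1 2 2 1) (I 1 1 2 2), ← integral_add i1 i2]
      exact integral_add (i1.add i2) i3
    linarith
  -- Pointwise A : Aᵀ is the squared trace plus twice `c`, and `c` has zero integral. What remains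
  -- besides the full gradient is a nonnegative multiple of the squared divergence.
  have e : ∀ p, ∑ i, ∑ j, stress μ lam (A p) i j * A p i j
      = μ * N p + (μ / 3 + lam) * τ p + 2 * μ * c p := by
    intro p
    simp only [hN, hτ, hcdef, stress, Fin.sum_univ_three]
    simp
    ring
  simp only [e]
  have J1 := iN.const_mul μ
  have J2 := iτ.const_mul (μ / 3 + lam)
  have J3 := ic.const_mul (2 * μ)
  refine ⟨(J1.add J2).add J3, ?_⟩
  rw [integral_add (f := fun p => μ * N p + (μ / 3 + lam) * τ p) (J1.add J2) J3,
    integral_add J1 J2, integral_const_mul, integral_const_mul, integral_const_mul, hcz]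
  have : 0 ≤ ∫ p in fluidDomain h, τ p := integral_nonneg fun _ => sq_nonneg _
  have : 0 ≤ (μ / 3 + lam) * ∫ p in fluidDomain h, τ p := by positivity
  linarith

end

end FluidPlate

/-! ### Fibre estimates at a fixed time and the convective bound -/

namespace FluidPlate

set_option linter.unusedSectionVars false

noncomputable section

theorem lintegral_mul_sq_le {α : Type*} [MeasurableSpace α] {μ : Measure α} {f g : α → ℝ≥0∞}
    (hf : AEMeasurable f μ) (hg : AEMeasurable g μ) :
    (∫⁻ x, f x * g x ∂μ) ^ 2 ≤ (∫⁻ x, f x ^ 2 ∂μ) * ∫⁻ x, g x ^ 2 ∂μ := by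
  have h := ENNReal.lintegral_mul_le_Lp_mul_Lq μ Real.HolderConjugate.two_two hf hg
  have h2 := pow_le_pow_left' h 2
  rw [mul_pow] at h2
  have e : ∀ x : ℝ≥0∞, (x ^ (1 / 2 : ℝ)) ^ 2 = x := fun x => by
    rw [← ENNReal.rpow_natCast, ← ENNReal.rpow_mul]; norm_num
  simp only [e, ENNReal.rpow_two] at h2
  exact h2

/-- Interpolation of the pressure and velocity factors on a fibre. -/
theorem fibre_interpolation {R Q M U N b : ℝ≥0∞} {a : ℝ} (ha : 0 < a) (ha1 : a < 1)
    (hb : b ≠ 0) (hb' : b ≠ ⊤) (hR : R ≤ Q ^ a * b ^ (1 - a)) (h1 : M ≤ 4 * (b * U))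
    (h2 : M ^ 2 ≤ 36 * (N * U)) :
    R * b⁻¹ * M ≤ 36 * (Q ^ a * U ^ (1 / 2 + a / 2) * N ^ ((1 - a) / 2)) := by
  have a1 : 0 ≤ 1 - a := by linarith
  have h3 : M ≤ 6 * (N ^ (1 / 2 : ℝ) * U ^ (1 / 2 : ℝ)) := by
    have := ENNReal.rpow_le_rpow h2 (by norm_num : (0 : ℝ) ≤ 1 / 2)
    rw [← ENNReal.rpow_natCast, ← ENNReal.rpow_mul, ENNReal.mul_rpow_of_nonneg _ _ (by norm_num),
      ENNReal.mul_rpow_of_nonneg _ _ (by norm_num)] at this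
    norm_num at this
    have e : (36 : ℝ≥0∞) ^ (1 / 2 : ℝ) = 6 := by
      rw [show (36 : ℝ≥0∞) = 6 ^ (2 : ℝ) by norm_num, ← ENNReal.rpow_mul]; norm_num
    rw [e] at this
    norm_num
    exact this
  -- The power `a` is estimated by height times dissipation, the power 1 − a by the geometric mean.
  -- The powers of the height `b` then cancel exactly, so the estimate survives at contact.
  have eM : M = M ^ a * M ^ (1 - a) := by
    rw [← ENNReal.rpow_add_of_nonneg _ _ ha.le a1]; simp
  have h36 : ∀ x : ℝ, 0 ≤ x → ∀ c : ℝ≥0∞, 1 ≤ c → x ≤ 1 → c ^ x ≤ c := fun x _ c hc hx => by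
    simpa using ENNReal.rpow_le_rpow_of_exponent_le hc hx
  calc R * b⁻¹ * M = R * b⁻¹ * (M ^ a * M ^ (1 - a)) := by rw [← eM]
    _ ≤ (Q ^ a * b ^ (1 - a)) * b⁻¹ * ((4 * (b * U)) ^ a
        * (6 * (N ^ (1 / 2 : ℝ) * U ^ (1 / 2 : ℝ))) ^ (1 - a)) := by gcongr
    _ = (b ^ (1 - a) * b⁻¹ * b ^ a) * (4 ^ a * 6 ^ (1 - a))
        * (Q ^ a * (U ^ a * U ^ (1 / 2 * (1 - a))) * N ^ (1 / 2 * (1 - a))) := by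
      rw [ENNReal.mul_rpow_of_nonneg _ _ ha.le, ENNReal.mul_rpow_of_nonneg _ _ ha.le,
        ENNReal.mul_rpow_of_nonneg _ _ a1, ENNReal.mul_rpow_of_nonneg _ _ a1, ← ENNReal.rpow_mul,
        ← ENNReal.rpow_mul]
      ring
    _ = (4 ^ a * 6 ^ (1 - a)) * (Q ^ a * U ^ (1 / 2 + a / 2) * N ^ ((1 - a) / 2)) := by
      have e1 : b ^ (1 - a) * b⁻¹ * b ^ a = 1 := by
        rw [mul_right_comm, ← ENNReal.rpow_add_of_nonneg _ _ a1 ha.le]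
        simp [ENNReal.mul_inv_cancel hb hb']
      rw [e1, one_mul, ← ENNReal.rpow_add_of_nonneg _ _ ha.le (by linarith),
        show a + 1 / 2 * (1 - a) = 1 / 2 + a / 2 by ring,
        show 1 / 2 * (1 - a) = (1 - a) / 2 by ring]
    _ ≤ (6 * 6) * (Q ^ a * U ^ (1 / 2 + a / 2) * N ^ ((1 - a) / 2)) := by
      gcongr
      · exact (ENNReal.rpow_le_rpow (by norm_num) ha.le).trans
          (h36 a ha.le 6 (by norm_num) ha1.le)
      · exact h36 _ a1 6 (by norm_num) (by linarith)
    _ = _ := by norm_num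

variable {L₁ L₂ : ℝ} [Fact (0 < L₁)] [Fact (0 < L₂)]

/-- One inequality in Tonelli's theorem needs no measurability. For upper bounds of the terms in the
contact inequality it suffices. -/
theorem lintegral_slab_le {a : ℝ} {h : Torus L₁ L₂ → ℝ} (hh : Continuous h)
    (F : Space L₁ L₂ → ℝ≥0∞) :
    ∫⁻ p in slab a h, F p ≤ ∫⁻ q, ∫⁻ z in Ioo a (h q), F (q, z) := by
  rw [← lintegral_indicator (measurableSet_slab a hh)]
  refine (lintegral_prod_le (μ := (volume : Measure (Torus L₁ L₂))) (ν := (volume : Measure ℝ))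
    ((slab a h).indicator F)).trans (le_of_eq (lintegral_congr fun q => ?_))
  rw [← lintegral_indicator measurableSet_Ioo]
  rfl

/-- The state of a weak solution at a fixed time, with quantitative bounds. -/
structure IsSlice (γ H S : ℝ) (P : ℝ≥0∞) (h : Torus L₁ L₂ → ℝ) (Dh : Torus L₁ L₂ → Fin 2 → ℝ)
    (D2h : Torus L₁ L₂ → Fin 2 → Fin 2 → ℝ) (ρ : Space L₁ L₂ → ℝ) (u : Space L₁ L₂ → Fin 3 → ℝ)
    (A : Space L₁ L₂ → Fin 3 → Fin 3 → ℝ) (v : Torus L₁ L₂ → ℝ) : Prop where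
  cont : Continuous h
  nonneg : ∀ q, 0 ≤ h q
  pos : ∀ᵐ q, 0 < h q
  le : ∀ q, h q ≤ H
  isH2 : IsH2 h Dh D2h
  lap : lapSq D2h ≤ S
  trace : ∀ i, HasGraphTrace h (fun p => u p i) (fun p => A p i)
    (fun p => (![0, 0, v p] : Fin 3 → ℝ) i)
  u_memLp : ∀ i, MemLp (fun p => u p i) 2 (volume.restrict (fluidDomain h))
  A_memLp : ∀ i j, MemLp (fun p => A p i j) 2 (volume.restrict (fluidDomain h))
  v_meas : AEStronglyMeasurable v volume
  ρ_meas : AEStronglyMeasurable ρ (volume.restrict (fluidDomain h))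
  pressure : ∫⁻ p in fluidDomain h, ‖ρ p‖ₑ ^ γ ≤ P

/-- The pointwise majorant of the squared velocity on a fibre. -/
def velSq (h : Torus L₁ L₂ → ℝ) (u : Space L₁ L₂ → Fin 3 → ℝ)
    (A : Space L₁ L₂ → Fin 3 → Fin 3 → ℝ) (q : Torus L₁ L₂) : ℝ≥0∞ :=
  ∑ i, 2 * fiberMul h (fun p => u p i) (fun p => A p i 2) q

/-- The fibre integral of the squared velocity. -/
def fiberVel (h : Torus L₁ L₂ → ℝ) (u : Space L₁ L₂ → Fin 3 → ℝ) (q : Torus L₁ L₂) : ℝ≥0∞ :=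
  ∑ i, fiberSq h (fun p => u p i) q

/-- The dissipation integral. -/
def dissip (h : Torus L₁ L₂ → ℝ) (A : Space L₁ L₂ → Fin 3 → Fin 3 → ℝ) : ℝ≥0∞ :=
  ∑ i, ∑ j, ∫⁻ p in fluidDomain h, ‖A p i j‖ₑ ^ 2

namespace IsSlice

variable {γ H S : ℝ} {P : ℝ≥0∞} {h : Torus L₁ L₂ → ℝ} {Dh : Torus L₁ L₂ → Fin 2 → ℝ}
    {D2h : Torus L₁ L₂ → Fin 2 → Fin 2 → ℝ} {ρ : Space L₁ L₂ → ℝ} {u : Space L₁ L₂ → Fin 3 → ℝ}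
    {A : Space L₁ L₂ → Fin 3 → Fin 3 → ℝ} {v : Torus L₁ L₂ → ℝ}

theorem lintegral_fiberSq (hs : Continuous h) {f : Space L₁ L₂ → ℝ}
    (hf : MemLp f 2 (volume.restrict (fluidDomain h))) :
    ∫⁻ q, fiberSq h f q = ∫⁻ p in fluidDomain h, ‖f p‖ₑ ^ 2 :=
  (lintegral_slab hs (hf.aestronglyMeasurable.enorm.pow_const _)).symm

theorem aemeasurable_fiberSq (hs : Continuous h) {f : Space L₁ L₂ → ℝ}
    (hf : MemLp f 2 (volume.restrict (fluidDomain h))) : AEMeasurable (fiberSq h f) :=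
  aemeasurable_lintegral_slab hs (hf.aestronglyMeasurable.enorm.pow_const _)

/-- The fibrewise estimates. -/
theorem fibre (hs : IsSlice γ H S P h Dh D2h ρ u A v) : ∀ᵐ q,
    velSq h u A q ≤ 4 * (ENNReal.ofReal (h q) * fiberVel h (fun p i => A p i 2) q) ∧
    velSq h u A q ^ 2 ≤ 36 * (fiberVel h u q * fiberVel h (fun p i => A p i 2) q) ∧
    fiberVel h u q ≤ ENNReal.ofReal (h q) * velSq h u A q ∧
    ‖v q‖ₑ ^ 2 ≤ velSq h u A q ∧
    ∀ i, ∀ᵐ z ∂(volume.restrict (Ioo 0 (h q))), ‖u (q, z) i‖ₑ ^ 2 ≤ velSq h u A q := by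
  have tr : ∀ i, ∀ᵐ q, ‖(![0, 0, v q] : Fin 3 → ℝ) i‖ₑ ^ 2
        ≤ 2 * fiberMul h (fun p => u p i) (fun p => A p i 2) q ∧
      ∀ᵐ z ∂(volume.restrict (Ioo 0 (h q))),
        ‖u (q, z) i‖ₑ ^ 2 ≤ 2 * fiberMul h (fun p => u p i) (fun p => A p i 2) q := fun i => by
    refine ((hs.trace i).estimates hs.cont hs.nonneg (hs.u_memLp i) (hs.A_memLp i) ?_).1
    fin_cases i
    · exact aestronglyMeasurable_const
    · exact aestronglyMeasurable_const
    · exact hs.v_meas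
  filter_upwards [ae_all_iff.2 tr, ae_all_iff.2 fun i => memLp_slab hs.cont (hs.u_memLp i),
    ae_all_iff.2 fun i => memLp_slab hs.cont (hs.A_memLp i 2)] with q htr hu hA
  set m : Fin 3 → ℝ≥0∞ := fun i => fiberMul h (fun p => u p i) (fun p => A p i 2) q with hm
  set n : Fin 3 → ℝ≥0∞ := fun i => fiberSq h (fun p => u p i) q with hn
  set b : Fin 3 → ℝ≥0∞ := fun i => fiberSq h (fun p => A p i 2) q with hb
  have cs : ∀ i, m i ^ 2 ≤ n i * b i := fun i =>
    lintegral_mul_sq_le (hu i).aestronglyMeasurable.enorm (hA i).aestronglyMeasurable.enorm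
  have fin : ∀ i, n i ≠ ⊤ ∧ b i ≠ ⊤ := fun i => by
    constructor
    · have := (hu i).eLpNorm_lt_top
      rw [hn]; simp only [fiberSq]; rw [← eLpNorm_two_sq]; finiteness
    · have := (hA i).eLpNorm_lt_top
      rw [hb]; simp only [fiberSq]; rw [← eLpNorm_two_sq]; finiteness
  have nle : ∀ i, n i ≤ ENNReal.ofReal (h q) * (2 * m i) := fun i => by
    refine (lintegral_mono_ae (htr i).2).trans ?_
    rw [lintegral_const, Measure.restrict_apply_univ, Real.volume_Ioo, sub_zero, mul_comm]
  -- Cauchy–Schwarz m² ≤ n·b, combined with the sup bound n ≤ h·2m, gives m² ≤ 2hmb. One factor `m`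
  -- cancels because it is finite.
  have mle : ∀ i, 2 * m i ≤ 4 * (ENNReal.ofReal (h q) * b i) := fun i => by
    have h1 : m i * m i ≤ m i * (2 * (ENNReal.ofReal (h q) * b i)) := by
      calc m i * m i = m i ^ 2 := (sq _).symm
        _ ≤ n i * b i := cs i
        _ ≤ ENNReal.ofReal (h q) * (2 * m i) * b i := by gcongr; exact nle i
        _ = _ := by ring
    have h2 : m i ≠ ⊤ := fun hc => by
      have := cs i
      rw [hc] at this
      simp only [ne_eq, OfNat.ofNat_ne_zero, not_false_eq_true, ENNReal.top_pow, top_le_iff] at this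
      exact ENNReal.mul_ne_top (fin i).1 (fin i).2 this
    by_cases h0 : m i = 0
    · rw [h0]; simp
    · have := (ENNReal.mul_le_mul_iff_right h0 h2).1 h1
      calc 2 * m i ≤ 2 * (2 * (ENNReal.ofReal (h q) * b i)) := by gcongr
        _ = _ := by ring
  have hle : ∀ i, 2 * m i ≤ velSq h u A q := fun i =>
    Finset.single_le_sum (f := fun i => 2 * m i) (fun _ _ => zero_le) (Finset.mem_univ i)
  refine ⟨?_, ?_, ?_, ?_, fun i => (htr i).2.mono fun z hz => hz.trans (hle i)⟩
  · unfold velSq fiberVel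
    rw [Finset.mul_sum, Finset.mul_sum]
    exact Finset.sum_le_sum fun i _ => mle i
  · have hmi : ∀ i, m i ≤ (fiberVel h u q * fiberVel h (fun p i => A p i 2) q) ^ (1 / 2 : ℝ) := by
      intro i
      have e : ∀ x : ℝ≥0∞, (x ^ 2) ^ (1 / 2 : ℝ) = x := fun x => by
        rw [← ENNReal.rpow_natCast, ← ENNReal.rpow_mul]; norm_num
      rw [← e (m i)]
      refine ENNReal.rpow_le_rpow ((cs i).trans ?_) (by norm_num)
      exact mul_le_mul' (Finset.single_le_sum (f := n) (fun _ _ => zero_le) (Finset.mem_univ i))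
        (Finset.single_le_sum (f := b) (fun _ _ => zero_le) (Finset.mem_univ i))
    have h6 : velSq h u A q
        ≤ 6 * (fiberVel h u q * fiberVel h (fun p i => A p i 2) q) ^ (1 / 2 : ℝ) := by
      unfold velSq
      refine (Finset.sum_le_sum (s := Finset.univ) fun i _ =>
        mul_le_mul_right (hmi i) (2 : ℝ≥0∞)).trans (le_of_eq ?_)
      rw [Finset.sum_const, Finset.card_univ, Fintype.card_fin, nsmul_eq_mul]
      push_cast
      ring
    refine (pow_le_pow_left' h6 2).trans (le_of_eq ?_)
    rw [mul_pow, ← ENNReal.rpow_natCast (_ ^ (1 / 2 : ℝ)), ← ENNReal.rpow_mul]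
    norm_num
  · unfold velSq fiberVel
    rw [Finset.mul_sum]
    exact Finset.sum_le_sum fun i _ => nle i
  · exact (htr 2).1.trans (hle 2)

theorem lintegral_fiberVel_grad_le (hs : IsSlice γ H S P h Dh D2h ρ u A v) :
    ∫⁻ q, fiberVel h (fun p i => A p i 2) q ≤ dissip h A := by
  unfold fiberVel dissip
  rw [lintegral_finsetSum' _ fun i _ => aemeasurable_fiberSq hs.cont (hs.A_memLp i 2)]
  refine Finset.sum_le_sum fun i _ => ?_
  rw [lintegral_fiberSq hs.cont (hs.A_memLp i 2)]
  exact Finset.single_le_sum (f := fun j => ∫⁻ p in fluidDomain h, ‖A p i j‖ₑ ^ 2)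
    (fun _ _ => zero_le) (Finset.mem_univ 2)

theorem aemeasurable_fiberVel_grad (hs : IsSlice γ H S P h Dh D2h ρ u A v) :
    AEMeasurable (fiberVel h (fun p i => A p i 2)) :=
  Finset.aemeasurable_fun_sum _ fun i _ => aemeasurable_fiberSq hs.cont (hs.A_memLp i 2)

theorem aemeasurable_fiberVel (hs : IsSlice γ H S P h Dh D2h ρ u A v) :
    AEMeasurable (fiberVel h u) :=
  Finset.aemeasurable_fun_sum _ fun i _ => aemeasurable_fiberSq hs.cont (hs.u_memLp i)

/-- Poincaré's inequality. -/
theorem lintegral_fiberVel_le (hs : IsSlice γ H S P h Dh D2h ρ u A v) :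
    ∫⁻ q, fiberVel h u q ≤ 4 * ENNReal.ofReal H ^ 2 * dissip h A := by
  have h1 : ∀ᵐ q, fiberVel h u q
      ≤ 4 * ENNReal.ofReal H ^ 2 * fiberVel h (fun p i => A p i 2) q := by
    filter_upwards [hs.fibre] with q hq
    have hl : ENNReal.ofReal (h q) ≤ ENNReal.ofReal H := ENNReal.ofReal_le_ofReal (hs.le q)
    calc fiberVel h u q ≤ ENNReal.ofReal (h q) * velSq h u A q := hq.2.2.1
      _ ≤ ENNReal.ofReal H * (4 * (ENNReal.ofReal H * fiberVel h (fun p i => A p i 2) q)) := by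
        gcongr
        exact hq.1.trans (by gcongr)
      _ = _ := by ring
  refine (lintegral_mono_ae h1).trans ?_
  rw [lintegral_const_mul'' _ hs.aemeasurable_fiberVel_grad]
  gcongr
  exact hs.lintegral_fiberVel_grad_le

theorem sum_h1Sq_le (hs : IsSlice γ H S P h Dh D2h ρ u A v) (i : Fin 3) :
    h1Sq h (fun p => u p i) (fun p => A p i) ≤ (4 * ENNReal.ofReal H ^ 2 + 1) * dissip h A := by
  unfold h1Sq
  rw [add_mul, one_mul]
  refine add_le_add (le_trans ?_ hs.lintegral_fiberVel_le) ?_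
  · rw [← lintegral_fiberSq hs.cont (hs.u_memLp i)]
    exact lintegral_mono fun q => Finset.single_le_sum (f := fun i => fiberSq h (fun p => u p i) q)
      (fun _ _ => zero_le) (Finset.mem_univ i)
  · exact Finset.single_le_sum (f := fun i => ∑ j, ∫⁻ p in fluidDomain h, ‖A p i j‖ₑ ^ 2)
      (fun _ _ => zero_le) (Finset.mem_univ i)

/-- The constant in the higher integrability estimate for the fibre integrals. -/
def fiberVelConst (L₁ L₂ : ℝ) [Fact (0 < L₁)] [Fact (0 < L₂)] (k : ℕ) (H S : ℝ) : ℝ≥0∞ :=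
  3 ^ (2 * k) * (3 * (ENNReal.ofReal (L₁⁻¹ + L₂⁻¹ + 2 * k) ^ (4 * k)
    * (2 * (4 * ENNReal.ofReal H ^ 2 + 1)) ^ (2 * k) * slopeConst L₁ L₂ k S))

theorem fiberVelConst_ne_top (k : ℕ) : fiberVelConst L₁ L₂ k H S ≠ ⊤ := by
  have := slopeConst_ne_top (L₁ := L₁) (L₂ := L₂) k S
  unfold fiberVelConst; finiteness

/-- Poincaré's inequality replaces the full H¹ norm in the embedding by the dissipation. The
resulting homogeneity in the dissipation makes the final convective bound linear. -/
theorem lintegral_fiberVel_pow_le (hs : IsSlice γ H S P h Dh D2h ρ u A v) {k : ℕ} (hk : 0 < k) :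
    ∫⁻ q, fiberVel h u q ^ (2 * k) ≤ fiberVelConst L₁ L₂ k H S * dissip h A ^ (2 * k) := by
  have tr : ∀ i, ∫⁻ q, fiberSq h (fun p => u p i) q ^ (2 * k)
      ≤ ENNReal.ofReal (L₁⁻¹ + L₂⁻¹ + 2 * k) ^ (4 * k)
        * (2 * ((4 * ENNReal.ofReal H ^ 2 + 1) * dissip h A)) ^ (2 * k)
        * slopeConst L₁ L₂ k S := fun i => by
    refine (((hs.trace i).estimates hs.cont hs.nonneg (hs.u_memLp i) (hs.A_memLp i) ?_).2
      hs.isH2 hk).trans ?_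
    · fin_cases i
      · exact aestronglyMeasurable_const
      · exact aestronglyMeasurable_const
      · exact hs.v_meas
    · exact mul_le_mul' (mul_le_mul_right (pow_le_pow_left'
        (mul_le_mul_right (hs.sum_h1Sq_le i) _) _) _) (slopeConst_mono k hs.lap)
  have hp : ∀ q, fiberVel h u q ^ (2 * k)
      ≤ 3 ^ (2 * k) * ∑ i, fiberSq h (fun p => u p i) q ^ (2 * k) := fun q => by
    obtain ⟨i, -, hi⟩ := Finset.exists_max_image Finset.univ
      (fun i => fiberSq h (fun p => u p i) q) ⟨0, Finset.mem_univ _⟩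
    have h1 : fiberVel h u q ≤ 3 * fiberSq h (fun p => u p i) q := by
      refine (Finset.sum_le_card_nsmul _ _ _ hi).trans (le_of_eq ?_)
      simp
    refine (pow_le_pow_left' h1 _).trans ?_
    rw [mul_pow]
    gcongr
    exact Finset.single_le_sum (f := fun i => fiberSq h (fun p => u p i) q ^ (2 * k))
      (fun _ _ => zero_le) (Finset.mem_univ i)
  refine (lintegral_mono hp).trans ?_
  have ms : ∀ i, AEMeasurable (fun q => fiberSq h (fun p => u p i) q ^ (2 * k)) := fun i =>
    (aemeasurable_fiberSq hs.cont (hs.u_memLp i)).pow_const _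
  rw [lintegral_const_mul'' _ (Finset.aemeasurable_fun_sum _ fun i _ => ms i),
    lintegral_finsetSum' _ fun i _ => ms i]
  refine (mul_le_mul_right (Finset.sum_le_sum fun i _ => tr i) _).trans (le_of_eq ?_)
  rw [Finset.sum_const, Finset.card_univ, Fintype.card_fin, nsmul_eq_mul]
  unfold fiberVelConst
  rw [mul_pow, mul_pow, mul_pow]
  push_cast
  ring

/-- Hölder's inequality on a fibre of length `h q`, against the constant one. -/
theorem lintegral_density_le (hs : IsSlice γ H S P h Dh D2h ρ u A v) (hγ : 1 < γ) :
    ∀ᵐ q, ∫⁻ z in Ioo 0 (h q), ‖ρ (q, z)‖ₑ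
      ≤ (∫⁻ z in Ioo 0 (h q), ‖ρ (q, z)‖ₑ ^ γ) ^ γ⁻¹ * ENNReal.ofReal (h q) ^ (1 - γ⁻¹) := by
  filter_upwards [aestronglyMeasurable_slab hs.cont hs.ρ_meas] with q hq
  have hc := Real.HolderConjugate.conjExponent hγ
  have := ENNReal.lintegral_mul_le_Lp_mul_Lq (volume.restrict (Ioo 0 (h q))) hc
    hq.enorm (aemeasurable_const (b := (1 : ℝ≥0∞)))
  simp only [Pi.mul_apply, mul_one, ENNReal.one_rpow, lintegral_const, one_mul,
    Measure.restrict_apply_univ, Real.volume_Ioo, sub_zero] at this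
  rw [one_div, one_div, show (γ.conjExponent)⁻¹ = 1 - γ⁻¹ by
    have := hc.inv_add_inv_eq_one; linarith] at this
  exact this

/-- The weighted integral controlling the convective terms. -/
theorem exists_convective_bound (L₁ L₂ : ℝ) [Fact (0 < L₁)] [Fact (0 < L₂)] {γ : ℝ} (hγ : 3 < γ)
    (H S : ℝ) {P : ℝ≥0∞} (hP : P ≠ ⊤) :
    ∃ K : ℝ≥0∞, K ≠ ⊤ ∧ ∀ {h : Torus L₁ L₂ → ℝ} {Dh : Torus L₁ L₂ → Fin 2 → ℝ}
      {D2h : Torus L₁ L₂ → Fin 2 → Fin 2 → ℝ} {ρ : Space L₁ L₂ → ℝ} {u : Space L₁ L₂ → Fin 3 → ℝ}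
      {A : Space L₁ L₂ → Fin 3 → Fin 3 → ℝ} {v : Torus L₁ L₂ → ℝ},
      IsSlice γ H S P h Dh D2h ρ u A v →
      ∫⁻ q, (∫⁻ z in Ioo 0 (h q), ‖ρ (q, z)‖ₑ) * (ENNReal.ofReal (h q))⁻¹ * velSq h u A q
        * ENNReal.ofReal (slope Dh q) ≤ K * dissip h A := by
  -- The gap 1/2 − 3/(2γ) left by pressure and dissipation is positive because γ > 3. A large `k`
  -- makes the exponents needed for the fibre velocity and the slope fit into it.
  obtain ⟨k, hk⟩ := exists_nat_gt (1 / (1 / 2 - 3 / 2 * γ⁻¹))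
  set a : ℝ := γ⁻¹ with ha
  have ha0 : 0 < a := inv_pos.2 (by linarith)
  have ha1 : a < 1 / 3 := by
    rw [ha, inv_eq_one_div]; exact one_div_lt_one_div_of_lt (by norm_num) hγ
  have he : 0 < 1 / 2 - 3 / 2 * a := by linarith
  have hk0 : (0 : ℝ) < k := lt_trans (by positivity) hk
  have hkpos : 0 < k := by exact_mod_cast hk0
  have hk1 : 1 / (k : ℝ) < 1 / 2 - 3 / 2 * a := by
    rw [div_lt_comm₀ hk0 he]; exact hk
  -- The unused Hölder exponent, given to the constant function so that the exponents sum to one.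
  set r : ℝ := 1 / 2 - 3 / 2 * a - (1 - a) / (4 * k) - 1 / (4 * k) with hr
  have hr0 : 0 ≤ r := by
    have e : (1 - a) / (4 * k) + 1 / (4 * k) = (2 - a) / 4 * (1 / (k : ℝ)) := by field_simp; ring
    have : (2 - a) / 4 * (1 / (k : ℝ)) ≤ 1 * (1 / (k : ℝ)) := by
      gcongr; linarith
    linarith
  set V := volume (univ : Set (Torus L₁ L₂))
  refine ⟨36 * (P ^ a * fiberVelConst L₁ L₂ k H S ^ ((1 - a) / (4 * k))
    * slopeConst L₁ L₂ k S ^ (1 / (4 * k) : ℝ) * V ^ r), ?_, ?_⟩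
  · have h1 := slopeConst_ne_top (L₁ := L₁) (L₂ := L₂) k S
    have h2 := fiberVelConst_ne_top (L₁ := L₁) (L₂ := L₂) (H := H) (S := S) k
    have h3 : V ≠ ⊤ := measure_ne_top _ _
    have e1 : 0 ≤ (1 - a) / (4 * k) := div_nonneg (by linarith) (by positivity)
    have e2 : (0 : ℝ) ≤ 1 / (4 * k) := by positivity
    refine ENNReal.mul_ne_top (by norm_num) (ENNReal.mul_ne_top (ENNReal.mul_ne_top
      (ENNReal.mul_ne_top ?_ ?_) ?_) ?_)
    · exact ENNReal.rpow_ne_top_of_nonneg ha0.le hP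
    · exact ENNReal.rpow_ne_top_of_nonneg e1 h2
    · exact ENNReal.rpow_ne_top_of_nonneg e2 h1
    · exact ENNReal.rpow_ne_top_of_nonneg hr0 h3
  intro h Dh D2h ρ u A v hs
  have mρ : AEMeasurable (fun p => ‖ρ p‖ₑ ^ γ) (volume.restrict (slab 0 h)) :=
    hs.ρ_meas.enorm.pow_const _
  set Q : Torus L₁ L₂ → ℝ≥0∞ := fun q => ∫⁻ z in Ioo 0 (h q), ‖ρ (q, z)‖ₑ ^ γ with hQ
  set U := fiberVel h (fun p i => A p i 2) with hU
  set N := fiberVel h u with hN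
  set κ : Torus L₁ L₂ → ℝ≥0∞ := fun q => ENNReal.ofReal (slope Dh q) with hκ
  have mQ : AEMeasurable Q := aemeasurable_lintegral_slab hs.cont mρ
  have mU : AEMeasurable U := hs.aemeasurable_fiberVel_grad
  have mN : AEMeasurable N := hs.aemeasurable_fiberVel
  have mκ : AEMeasurable κ := by
    have d0 := (hs.isH2.grad_memLp 0).aestronglyMeasurable.aemeasurable
    have d1 := (hs.isH2.grad_memLp 1).aestronglyMeasurable.aemeasurable
    exact ((aemeasurable_const.add d0.abs).add d1.abs).ennreal_ofReal
  have h4 : ((4 * k : ℕ) : ℝ) = 4 * k := by push_cast; ring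
  have h2' : ((2 * k : ℕ) : ℝ) = 2 * k := by push_cast; ring
  have step : ∀ᵐ q, (∫⁻ z in Ioo 0 (h q), ‖ρ (q, z)‖ₑ) * (ENNReal.ofReal (h q))⁻¹ * velSq h u A q
        * κ q ≤ 36 * ∏ i, (![Q, U, fun q => N q ^ (2 * k), fun q => κ q ^ (4 * k), fun _ => 1] i q)
          ^ ((![a, 1 / 2 + a / 2, (1 - a) / (4 * k), 1 / (4 * k), r] : Fin 5 → ℝ) i) := by
    filter_upwards [hs.fibre, hs.pos, hs.lintegral_density_le (by linarith)] with q hq hpos hd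
    have := fibre_interpolation ha0 (by linarith) (by simpa using hpos) ENNReal.ofReal_ne_top hd
      hq.1 hq.2.1
    refine (mul_le_mul_left this _).trans (le_of_eq ?_)
    simp only [Fin.prod_univ_five, Matrix.cons_val]
    rw [ENNReal.one_rpow, mul_one, ← ENNReal.rpow_natCast (N q), ← ENNReal.rpow_natCast (κ q),
      ← ENNReal.rpow_mul, ← ENNReal.rpow_mul, h4, h2',
      show 2 * (k : ℝ) * ((1 - a) / (4 * k)) = (1 - a) / 2 by field_simp; ring,
      show 4 * (k : ℝ) * (1 / (4 * k)) = 1 by field_simp, ENNReal.rpow_one]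
    ring
  refine (lintegral_mono_ae step).trans ?_
  rw [lintegral_const_mul' _ _ (by norm_num)]
  have hold := ENNReal.lintegral_prod_norm_pow_le (μ := (volume : Measure (Torus L₁ L₂)))
    (Finset.univ : Finset (Fin 5))
    (f := ![Q, U, fun q => N q ^ (2 * k), fun q => κ q ^ (4 * k), fun _ => 1])
    (p := ![a, 1 / 2 + a / 2, (1 - a) / (4 * k), 1 / (4 * k), r])
    (by
      intro i _
      fin_cases i
      · exact mQ
      · exact mU
      · exact mN.pow_const _
      · exact mκ.pow_const _
      · exact aemeasurable_const)
    (by simp [Fin.sum_univ_five, hr]; ring)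
    (by
      intro i _
      fin_cases i
      · exact ha0.le
      · simp; positivity
      · exact div_nonneg (by simp; linarith) (by positivity)
      · simp
      · exact hr0)
  rw [mul_assoc]
  refine mul_le_mul_right (hold.trans ?_) _
  simp only [Fin.prod_univ_five, Matrix.cons_val]
  have e1 : 0 ≤ (1 - a) / (4 * k) := div_nonneg (by linarith) (by positivity)
  have e2 : (0 : ℝ) ≤ 1 / (4 * k) := by positivity
  have b1 : ∫⁻ q, Q q ≤ P := (lintegral_slab hs.cont mρ).symm.le.trans hs.pressure
  have b2 : ∫⁻ q, U q ≤ dissip h A := hs.lintegral_fiberVel_grad_le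
  have b3 := hs.lintegral_fiberVel_pow_le hkpos
  have b4 := (hs.isH2.lintegral_slope_le hs.cont hkpos).trans (slopeConst_mono k hs.lap)
  have b5 : ∫⁻ _ : Torus L₁ L₂, (1 : ℝ≥0∞) = V := by simp [V]
  rw [b5]
  calc _ ≤ P ^ a * dissip h A ^ (1 / 2 + a / 2)
        * (fiberVelConst L₁ L₂ k H S * dissip h A ^ (2 * k)) ^ ((1 - a) / (4 * k))
        * slopeConst L₁ L₂ k S ^ (1 / (4 * k) : ℝ) * V ^ r := by gcongr
    _ = P ^ a * fiberVelConst L₁ L₂ k H S ^ ((1 - a) / (4 * k))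
        * slopeConst L₁ L₂ k S ^ (1 / (4 * k) : ℝ) * V ^ r
        * (dissip h A ^ (1 / 2 + a / 2) * dissip h A ^ ((1 - a) / 2)) := by
      rw [ENNReal.mul_rpow_of_nonneg _ _ e1, ← ENNReal.rpow_natCast (dissip h A),
        ← ENNReal.rpow_mul, h2',
        show 2 * (k : ℝ) * ((1 - a) / (4 * k)) = (1 - a) / 2 by field_simp; ring]
      ring
    _ = _ := by
      -- The exponents of the dissipation add up to exactly one; the time integral is thus bounded
      -- by the total dissipation.
      rw [← ENNReal.rpow_add_of_nonneg _ _ (by linarith) (by linarith),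
        show 1 / 2 + a / 2 + (1 - a) / 2 = 1 by ring, ENNReal.rpow_one]

end IsSlice

end

end FluidPlate

/-! ### The terms of the contact inequality at a fixed time -/

namespace FluidPlate

set_option linter.unusedSectionVars false

noncomputable section

variable {L₁ L₂ : ℝ} [Fact (0 < L₁)] [Fact (0 < L₂)]

namespace IsSlice

variable {γ H S : ℝ} {P : ℝ≥0∞} {h : Torus L₁ L₂ → ℝ} {Dh : Torus L₁ L₂ → Fin 2 → ℝ}
    {D2h : Torus L₁ L₂ → Fin 2 → Fin 2 → ℝ} {ρ : Space L₁ L₂ → ℝ} {u : Space L₁ L₂ → Fin 3 → ℝ}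
    {A : Space L₁ L₂ → Fin 3 → Fin 3 → ℝ} {v : Torus L₁ L₂ → ℝ}

/-- Inside the fibre z < b, so the weight z/b² costs only one inverse power of the height. -/
theorem enorm_weight_le {b x z : ℝ} (hz : z ∈ Ioo 0 b) :
    ‖z * x / b ^ 2‖ₑ ≤ ‖x‖ₑ * (ENNReal.ofReal b)⁻¹ := by
  have hb : 0 < b := hz.1.trans hz.2
  rw [← ENNReal.ofReal_inv_of_pos hb, Real.enorm_eq_ofReal_abs, Real.enorm_eq_ofReal_abs,
    ← ENNReal.ofReal_mul (abs_nonneg _)]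
  refine ENNReal.ofReal_le_ofReal ?_
  rw [abs_div, abs_mul, abs_of_pos hz.1, abs_of_pos (pow_pos hb 2), div_le_iff₀ (pow_pos hb 2)]
  have : |x| * b⁻¹ * b ^ 2 = |x| * b := by field_simp
  rw [this, mul_comm]
  exact mul_le_mul_of_nonneg_left hz.2.le (abs_nonneg _)

theorem le_rpow_half {x y : ℝ≥0∞} (h : x ^ 2 ≤ y) : x ≤ y ^ (1 / 2 : ℝ) := by
  have := ENNReal.rpow_le_rpow h (by norm_num : (0 : ℝ) ≤ 1 / 2)
  rwa [← ENNReal.rpow_natCast, ← ENNReal.rpow_mul, show ((2 : ℕ) : ℝ) * (1 / 2) = 1 by norm_num,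
    ENNReal.rpow_one] at this

theorem rpow_half_mul_self (y : ℝ≥0∞) : y ^ (1 / 2 : ℝ) * y ^ (1 / 2 : ℝ) = y := by
  rw [← ENNReal.rpow_add_of_nonneg _ _ (by norm_num) (by norm_num)]; norm_num

/-- The convective terms of the contact inequality. -/
theorem exists_convective_terms_le (L₁ L₂ : ℝ) [Fact (0 < L₁)] [Fact (0 < L₂)] {γ : ℝ}
    (hγ : 3 < γ) (H S : ℝ) {P : ℝ≥0∞} (hP : P ≠ ⊤) :
    ∃ K : ℝ≥0∞, K ≠ ⊤ ∧ ∀ {h : Torus L₁ L₂ → ℝ} {Dh : Torus L₁ L₂ → Fin 2 → ℝ}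
      {D2h : Torus L₁ L₂ → Fin 2 → Fin 2 → ℝ} {ρ : Space L₁ L₂ → ℝ} {u : Space L₁ L₂ → Fin 3 → ℝ}
      {A : Space L₁ L₂ → Fin 3 → Fin 3 → ℝ} {v : Torus L₁ L₂ → ℝ},
      IsSlice γ H S P h Dh D2h ρ u A v →
      ∫⁻ p in fluidDomain h, ‖ρ p * u p 2 * p.2 * (v p.1 / h p.1 ^ 2)‖ₑ ≤ K * dissip h A ∧
      ∀ i : Fin 2, ∫⁻ p in fluidDomain h,
        ‖ρ p * u p i.castSucc * u p 2 * (p.2 * Dh p.1 i / h p.1 ^ 2)‖ₑ ≤ K * dissip h A := by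
  obtain ⟨K, hK, hb⟩ := exists_convective_bound L₁ L₂ hγ H S hP
  refine ⟨K, hK, fun {h Dh D2h ρ u A v} hs => ?_⟩
  -- In each convective term two velocity factors, one of which may be the plate velocity, are
  -- bounded by the square root of `velSq`. The remaining factor is one or a slope, so all of them
  -- share this majorant.
  have key : ∀ F : Space L₁ L₂ → ℝ≥0∞, (∀ᵐ q, ∀ᵐ z ∂(volume.restrict (Ioo 0 (h q))),
      F (q, z) ≤ ‖ρ (q, z)‖ₑ * ((ENNReal.ofReal (h q))⁻¹ * velSq h u A q
        * ENNReal.ofReal (slope Dh q))) → ∫⁻ p in fluidDomain h, F p ≤ K * dissip h A := by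
    intro F hF
    refine (lintegral_slab_le hs.cont F).trans ((lintegral_mono_ae ?_).trans (hb hs))
    filter_upwards [hF, aestronglyMeasurable_slab hs.cont hs.ρ_meas] with q hq hm
    refine (lintegral_mono_ae hq).trans (le_of_eq ?_)
    rw [lintegral_mul_const'' _ hm.enorm]
    ring
  refine ⟨key _ ?_, fun i => key _ ?_⟩
  · filter_upwards [hs.fibre] with q hq
    filter_upwards [hq.2.2.2.2 2, ae_restrict_mem measurableSet_Ioo] with z hz hzm
    have hu := le_rpow_half hz
    have hv := le_rpow_half hq.2.2.2.1
    have e : ρ (q, z) * u (q, z) 2 * z * (v q / h q ^ 2)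
        = ρ (q, z) * (u (q, z) 2 * (z * v q / h q ^ 2)) := by ring
    have h1 : (1 : ℝ≥0∞) ≤ ENNReal.ofReal (slope Dh q) := by
      rw [← ENNReal.ofReal_one]; exact ENNReal.ofReal_le_ofReal (one_le_slope _ _)
    rw [e, enorm_mul, enorm_mul]
    refine mul_le_mul_right ?_ _
    calc _ ≤ velSq h u A q ^ (1 / 2 : ℝ)
          * (velSq h u A q ^ (1 / 2 : ℝ) * (ENNReal.ofReal (h q))⁻¹) := by
          gcongr
          exact (enorm_weight_le hzm).trans (by gcongr)
      _ = (ENNReal.ofReal (h q))⁻¹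
          * (velSq h u A q ^ (1 / 2 : ℝ) * velSq h u A q ^ (1 / 2 : ℝ)) * 1 := by ring
      _ ≤ _ := by rw [rpow_half_mul_self]; gcongr
  · filter_upwards [hs.fibre] with q hq
    filter_upwards [hq.2.2.2.2 2, hq.2.2.2.2 i.castSucc, ae_restrict_mem measurableSet_Ioo]
      with z hz hz' hzm
    have hu := le_rpow_half hz
    have hu' := le_rpow_half hz'
    have h1 : ‖Dh q i‖ₑ ≤ ENNReal.ofReal (slope Dh q) := by
      rw [Real.enorm_eq_ofReal_abs]
      exact ENNReal.ofReal_le_ofReal (by linarith [abs_le_slope Dh q i])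
    rw [mul_assoc, mul_assoc, enorm_mul, enorm_mul, enorm_mul]
    refine mul_le_mul_right ?_ _
    calc _ ≤ velSq h u A q ^ (1 / 2 : ℝ) * (velSq h u A q ^ (1 / 2 : ℝ)
          * (ENNReal.ofReal (slope Dh q) * (ENNReal.ofReal (h q))⁻¹)) := by
          gcongr
          exact (enorm_weight_le hzm).trans (by gcongr)
      _ = (ENNReal.ofReal (h q))⁻¹
          * (velSq h u A q ^ (1 / 2 : ℝ) * velSq h u A q ^ (1 / 2 : ℝ))
          * ENNReal.ofReal (slope Dh q) := by ring
      _ = _ := by rw [rpow_half_mul_self]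

/-- The constant in the estimate of the logarithmic gradient. -/
def gradConst (L₁ L₂ : ℝ) [Fact (0 < L₁)] [Fact (0 < L₂)] (S : ℝ) : ℝ≥0∞ :=
  ENNReal.ofReal (√(area L₁ L₂) * (3 * √S)) ^ (1 / 2 : ℝ)

theorem gradConst_ne_top : gradConst L₁ L₂ S ≠ ⊤ :=
  ENNReal.rpow_ne_top_of_nonneg (by norm_num) ENNReal.ofReal_ne_top

/-- The singular factor is the square root of |∂ᵢh|²/h, whose integral is bounded by interpolation;
Cauchy–Schwarz separates it from `F`. -/
theorem lintegral_grad_mul_le (hs : IsSlice γ H S P h Dh D2h ρ u A v) (i : Fin 2)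
    {F : Torus L₁ L₂ → ℝ≥0∞} (hF : AEMeasurable F) :
    ∫⁻ q, ‖Dh q i‖ₑ * (ENNReal.ofReal (h q))⁻¹ * ENNReal.ofReal (h q) ^ (1 / 2 : ℝ)
      * F q ^ (1 / 2 : ℝ) ≤ gradConst L₁ L₂ S * (∫⁻ q, F q) ^ (1 / 2 : ℝ) := by
  have e : ∀ᵐ q, ‖Dh q i‖ₑ * (ENNReal.ofReal (h q))⁻¹ * ENNReal.ofReal (h q) ^ (1 / 2 : ℝ)
      = ENNReal.ofReal (Dh q i ^ 2 / h q) ^ (1 / 2 : ℝ) := by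
    filter_upwards [hs.pos] with q hq
    rw [← ENNReal.ofReal_inv_of_pos hq, Real.enorm_eq_ofReal_abs,
      ENNReal.ofReal_rpow_of_pos hq, ENNReal.ofReal_rpow_of_nonneg (by positivity) (by norm_num),
      ← ENNReal.ofReal_mul (abs_nonneg _), ← ENNReal.ofReal_mul (by positivity)]
    congr 1
    rw [← Real.sqrt_eq_rpow, ← Real.sqrt_eq_rpow, Real.sqrt_div (sq_nonneg _), Real.sqrt_sq_eq_abs]
    have h1 : h q = √(h q) * √(h q) := (Real.mul_self_sqrt hq.le).symm
    have h2 : √(h q) ≠ 0 := (Real.sqrt_pos.2 hq).ne'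
    rw [mul_assoc, div_eq_mul_inv]
    congr 1
    field_simp
    rw [sq, ← h1]
  have mD : AEMeasurable fun q => ENNReal.ofReal (Dh q i ^ 2 / h q) ^ (1 / 2 : ℝ) :=
    ((((hs.isH2.grad_memLp i).aestronglyMeasurable.aemeasurable.pow_const 2).div
      hs.cont.measurable.aemeasurable).ennreal_ofReal).pow_const _
  have sq : ∀ x : ℝ≥0∞, (x ^ (1 / 2 : ℝ)) ^ 2 = x := fun x => by
    rw [_root_.sq, rpow_half_mul_self]
  have cs := lintegral_mul_sq_le mD (hF.pow_const (1 / 2 : ℝ))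
  simp only [sq] at cs
  have cs' := le_rpow_half cs
  rw [ENNReal.mul_rpow_of_nonneg _ _ (by norm_num)] at cs'
  refine (le_of_eq (lintegral_congr_ae ?_)).trans (cs'.trans (mul_le_mul_left ?_ _))
  · filter_upwards [e] with q hq
    rw [hq]
  · refine ENNReal.rpow_le_rpow ((hs.isH2.lintegral_grad_sq_div_le hs.cont hs.nonneg hs.pos i).trans
      (ENNReal.ofReal_le_ofReal ?_)) (by norm_num)
    have := Real.sqrt_le_sqrt hs.lap
    gcongr

/-- Cauchy–Schwarz on the fibre gains the square root of its length, exactly what turns |∂ᵢh|/h into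
the controlled quantity |∂ᵢh|/√h. -/
theorem lintegral_vertical_shear_le (hs : IsSlice γ H S P h Dh D2h ρ u A v) (i : Fin 2)
    {f : Space L₁ L₂ → ℝ} (hf : MemLp f 2 (volume.restrict (fluidDomain h))) :
    ∫⁻ p in fluidDomain h, ‖f p * (p.2 * Dh p.1 i / h p.1 ^ 2)‖ₑ
      ≤ gradConst L₁ L₂ S * (∫⁻ p in fluidDomain h, ‖f p‖ₑ ^ 2) ^ (1 / 2 : ℝ) := by
  rw [← lintegral_fiberSq hs.cont hf]
  refine (lintegral_slab_le hs.cont _).trans (le_trans (lintegral_mono_ae ?_)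
    (hs.lintegral_grad_mul_le i (aemeasurable_fiberSq hs.cont hf)))
  filter_upwards [memLp_slab hs.cont hf] with q hm
  have cs := lintegral_mul_sq_le hm.aestronglyMeasurable.enorm (aemeasurable_const (b := (1 : ℝ≥0∞)))
  simp only [mul_one, one_pow, lintegral_const, one_mul, Measure.restrict_apply_univ,
    Real.volume_Ioo, sub_zero] at cs
  have cs' := le_rpow_half cs
  rw [ENNReal.mul_rpow_of_nonneg _ _ (by norm_num)] at cs'
  calc ∫⁻ z in Ioo 0 (h q), ‖f (q, z) * (z * Dh q i / h q ^ 2)‖ₑ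
      ≤ ∫⁻ z in Ioo 0 (h q), ‖f (q, z)‖ₑ * (‖Dh q i‖ₑ * (ENNReal.ofReal (h q))⁻¹) := by
        refine setLIntegral_mono_ae' measurableSet_Ioo (Eventually.of_forall fun z hz => ?_)
        rw [enorm_mul]
        exact mul_le_mul_right (enorm_weight_le hz) _
    _ = (∫⁻ z in Ioo 0 (h q), ‖f (q, z)‖ₑ) * (‖Dh q i‖ₑ * (ENNReal.ofReal (h q))⁻¹) :=
        lintegral_mul_const'' _ hm.aestronglyMeasurable.enorm
    _ ≤ (fiberSq h f q ^ (1 / 2 : ℝ) * ENNReal.ofReal (h q) ^ (1 / 2 : ℝ))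
        * (‖Dh q i‖ₑ * (ENNReal.ofReal (h q))⁻¹) := by gcongr; exact cs'
    _ = _ := by ring

theorem lintegral_entry_le (i j : Fin 3) :
    ∫⁻ p in fluidDomain h, ‖A p i j‖ₑ ^ 2 ≤ dissip h A :=
  (Finset.single_le_sum (f := fun j => ∫⁻ p in fluidDomain h, ‖A p i j‖ₑ ^ 2)
    (fun _ _ => zero_le) (Finset.mem_univ j)).trans
  (Finset.single_le_sum (f := fun i => ∑ j, ∫⁻ p in fluidDomain h, ‖A p i j‖ₑ ^ 2)
    (fun _ _ => zero_le) (Finset.mem_univ i))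

/-- The viscous terms of the contact inequality. -/
theorem viscous_terms_le (hs : IsSlice γ H S P h Dh D2h ρ u A v) :
    (∀ i : Fin 2, ∫⁻ p in fluidDomain h,
      ‖(A p i.castSucc 2 + A p 2 i.castSucc) * (p.2 * Dh p.1 i / h p.1 ^ 2)‖ₑ
        ≤ 4 * gradConst L₁ L₂ S * dissip h A ^ (1 / 2 : ℝ)) ∧
    ∫⁻ p in fluidDomain h, ‖u p 0 * (Dh p.1 0 / h p.1 ^ 2) + u p 1 * (Dh p.1 1 / h p.1 ^ 2)‖ₑ
        ≤ 4 * gradConst L₁ L₂ S * dissip h A ^ (1 / 2 : ℝ) := by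
  constructor
  · intro i
    have m1 := hs.A_memLp i.castSucc 2
    have m2 := hs.A_memLp 2 i.castSucc
    refine (hs.lintegral_vertical_shear_le i (m1.add m2)).trans ?_
    rw [mul_comm (4 : ℝ≥0∞), mul_assoc]
    refine mul_le_mul_right ?_ _
    have hn : ∀ a b : Fin 3, eLpNorm (fun p => A p a b) 2 (volume.restrict (fluidDomain h))
        ≤ dissip h A ^ (1 / 2 : ℝ) := fun a b =>
      le_rpow_half ((eLpNorm_two_sq _ _).le.trans (lintegral_entry_le a b))
    have h1 := eLpNorm_add_le m1.aestronglyMeasurable m2.aestronglyMeasurable (p := 2) (by norm_num)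
    have h2 : ((∫⁻ p in fluidDomain h, ‖((fun p => A p i.castSucc 2)
        + fun p => A p 2 i.castSucc) p‖ₑ ^ 2) ^ (1 / 2 : ℝ))
        = eLpNorm ((fun p => A p i.castSucc 2) + fun p => A p 2 i.castSucc) 2
          (volume.restrict (fluidDomain h)) := by
      rw [← eLpNorm_two_sq, ← ENNReal.rpow_natCast, ← ENNReal.rpow_mul]
      norm_num
    rw [h2]
    refine h1.trans ((add_le_add (hn _ _) (hn _ _)).trans ?_)
    rw [← two_mul]
    gcongr
    norm_num
  · set U := fiberVel h (fun p i => A p i 2) with hU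
    have mU : AEMeasurable U := hs.aemeasurable_fiberVel_grad
    set T : Fin 2 → Torus L₁ L₂ → ℝ≥0∞ := fun i q => ‖Dh q i‖ₑ * (ENNReal.ofReal (h q))⁻¹
      * ENNReal.ofReal (h q) ^ (1 / 2 : ℝ) * U q ^ (1 / 2 : ℝ) with hT
    have mT : ∀ i, AEMeasurable (T i) := fun i =>
      (((hs.isH2.grad_memLp i).aestronglyMeasurable.enorm.mul
        hs.cont.measurable.aemeasurable.ennreal_ofReal.inv).mul
        (hs.cont.measurable.aemeasurable.ennreal_ofReal.pow_const _)).mul (mU.pow_const _)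
    -- There is no factor z here, so the weight has two inverse powers of the height. The fibre
    -- length cancels one, and the sup bound for the velocity supplies the square root of the
    -- height.
    have hpt : ∀ᵐ q, ∫⁻ z in Ioo 0 (h q), ‖u (q, z) 0 * (Dh q 0 / h q ^ 2)
        + u (q, z) 1 * (Dh q 1 / h q ^ 2)‖ₑ ≤ 2 * (T 0 q + T 1 q) := by
      filter_upwards [hs.fibre, hs.pos] with q hq hpos
      have hb0 : ENNReal.ofReal (h q) ≠ 0 := by simpa using hpos
      have hbt : ENNReal.ofReal (h q) ≠ ⊤ := ENNReal.ofReal_ne_top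
      have hM : velSq h u A q ^ (1 / 2 : ℝ)
          ≤ 2 * (ENNReal.ofReal (h q) ^ (1 / 2 : ℝ) * U q ^ (1 / 2 : ℝ)) := by
        have := ENNReal.rpow_le_rpow hq.1 (by norm_num : (0 : ℝ) ≤ 1 / 2)
        rw [ENNReal.mul_rpow_of_nonneg _ _ (by norm_num),
          ENNReal.mul_rpow_of_nonneg _ _ (by norm_num)] at this
        have e : (4 : ℝ≥0∞) ^ (1 / 2 : ℝ) = 2 := by
          rw [show (4 : ℝ≥0∞) = 2 ^ (2 : ℝ) by norm_num, ← ENNReal.rpow_mul]; norm_num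
        rwa [e] at this
      have hw : ∀ x : ℝ, ‖x / h q ^ 2‖ₑ = ‖x‖ₑ * ((ENNReal.ofReal (h q))⁻¹
          * (ENNReal.ofReal (h q))⁻¹) := fun x => by
        rw [← ENNReal.ofReal_inv_of_pos hpos, ← ENNReal.ofReal_mul (by positivity), div_eq_mul_inv,
          enorm_mul, Real.enorm_eq_ofReal_abs (h q ^ 2)⁻¹, abs_of_pos (by positivity)]
        congr 2
        field_simp
      have hz : ∀ᵐ z ∂(volume.restrict (Ioo 0 (h q))), ‖u (q, z) 0 * (Dh q 0 / h q ^ 2)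
          + u (q, z) 1 * (Dh q 1 / h q ^ 2)‖ₑ ≤ velSq h u A q ^ (1 / 2 : ℝ)
            * ((ENNReal.ofReal (h q))⁻¹ * (ENNReal.ofReal (h q))⁻¹ * (‖Dh q 0‖ₑ + ‖Dh q 1‖ₑ)) := by
        filter_upwards [hq.2.2.2.2 0, hq.2.2.2.2 1] with z h0 h1
        refine (enorm_add_le _ _).trans ?_
        rw [enorm_mul, enorm_mul, hw, hw]
        calc _ ≤ velSq h u A q ^ (1 / 2 : ℝ)
              * (‖Dh q 0‖ₑ * ((ENNReal.ofReal (h q))⁻¹ * (ENNReal.ofReal (h q))⁻¹))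
              + velSq h u A q ^ (1 / 2 : ℝ)
              * (‖Dh q 1‖ₑ * ((ENNReal.ofReal (h q))⁻¹ * (ENNReal.ofReal (h q))⁻¹)) := by
              gcongr
              · exact le_rpow_half h0
              · exact le_rpow_half h1
          _ = _ := by ring
      refine (lintegral_mono_ae hz).trans ?_
      rw [lintegral_const, Measure.restrict_apply_univ, Real.volume_Ioo, sub_zero]
      calc _ ≤ (2 * (ENNReal.ofReal (h q) ^ (1 / 2 : ℝ) * U q ^ (1 / 2 : ℝ)))
            * ((ENNReal.ofReal (h q))⁻¹ * (ENNReal.ofReal (h q))⁻¹ * (‖Dh q 0‖ₑ + ‖Dh q 1‖ₑ))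
            * ENNReal.ofReal (h q) := by gcongr
        _ = (2 * (ENNReal.ofReal (h q) ^ (1 / 2 : ℝ) * U q ^ (1 / 2 : ℝ)))
            * ((ENNReal.ofReal (h q))⁻¹ * (‖Dh q 0‖ₑ + ‖Dh q 1‖ₑ))
            * (ENNReal.ofReal (h q) * (ENNReal.ofReal (h q))⁻¹) := by ring
        _ = _ := by
          rw [ENNReal.mul_inv_cancel hb0 hbt, mul_one]
          simp only [hT]
          ring
    refine (lintegral_slab_le hs.cont _).trans ((lintegral_mono_ae hpt).trans ?_)
    have hX : (∫⁻ q, U q) ^ (1 / 2 : ℝ) ≤ dissip h A ^ (1 / 2 : ℝ) :=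
      ENNReal.rpow_le_rpow hs.lintegral_fiberVel_grad_le (by norm_num)
    rw [lintegral_const_mul' _ _ (by norm_num), lintegral_add_left' (mT 0)]
    have hTi : ∀ i, ∫⁻ q, T i q ≤ gradConst L₁ L₂ S * dissip h A ^ (1 / 2 : ℝ) := fun i =>
      (hs.lintegral_grad_mul_le i mU).trans (mul_le_mul_right hX _)
    calc _ ≤ 2 * (gradConst L₁ L₂ S * dissip h A ^ (1 / 2 : ℝ)
          + gradConst L₁ L₂ S * dissip h A ^ (1 / 2 : ℝ)) := by
          gcongr
          · exact hTi 0
          · exact hTi 1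
      _ = _ := by ring

/-- The rate at which pressure acts under contact. -/
def pressureRate (L₁ L₂ : ℝ) [Fact (0 < L₁)] [Fact (0 < L₂)] (γ m H : ℝ) : ℝ :=
  m / 2 * (m / (2 * (H * area L₁ L₂))) ^ (γ - 1) / H

theorem pressureRate_pos {m : ℝ} (hm : 0 < m) (hH : 0 < H) : 0 < pressureRate L₁ L₂ γ m H := by
  have := area_pos (L₁ := L₁) (L₂ := L₂)
  unfold pressureRate; positivity

/-- Lower bound for the pressure term. -/
theorem pressureRate_le {m : ℝ} (hc : Continuous h) (hle : ∀ q, h q ≤ H) (hm : 0 < m)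
    (hH : 0 < H) (hγ : 1 < γ) (hρ : ∀ᵐ p ∂(volume.restrict (fluidDomain h)), 0 ≤ ρ p)
    (hmass : ∫ p in fluidDomain h, ρ p = m) :
    ENNReal.ofReal (pressureRate L₁ L₂ γ m H)
      ≤ ∫⁻ p in fluidDomain h, ENNReal.ofReal (ρ p ^ γ / h p.1) := by
  have hS : MeasurableSet (fluidDomain h) := measurableSet_slab 0 hc
  have har := area_pos (L₁ := L₁) (L₂ := L₂)
  -- The integral of a non-integrable function is zero by convention, which is excluded by the
  -- positive mass.
  have hint : Integrable ρ (volume.restrict (fluidDomain h)) := by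
    by_contra hni
    rw [integral_undef hni] at hmass
    exact hm.ne hmass
  have hvol : volume (fluidDomain h) ≤ ENNReal.ofReal (H * area L₁ L₂) := by
    have h1 := lintegral_slab_le (a := 0) hc (fun _ => 1)
    simp only [lintegral_const, one_mul, Measure.restrict_apply_univ, Real.volume_Ioo,
      sub_zero] at h1
    refine h1.trans ((lintegral_mono fun q => ENNReal.ofReal_le_ofReal (hle q)).trans ?_)
    rw [lintegral_const, ENNReal.ofReal_mul hH.le]
    gcongr
    unfold area Measure.real
    rw [ENNReal.ofReal_toReal (measure_ne_top _ _)]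
  -- Half of the least possible mean density. The region with ρ ≤ a carries at most half of the
  -- mass; elsewhere ρ is bounded by ρ^γ a^(1−γ), so the pressure must carry the other half.
  set a : ℝ := m / (2 * (H * area L₁ L₂)) with ha
  have ha0 : 0 < a := by positivity
  have hpt : ∀ᵐ p ∂(volume.restrict (fluidDomain h)), ENNReal.ofReal (ρ p) ≤ ENNReal.ofReal a
      + ENNReal.ofReal (H / a ^ (γ - 1)) * ENNReal.ofReal (ρ p ^ γ / h p.1) := by
    filter_upwards [hρ, ae_restrict_mem hS] with p hp hpm
    have hh : 0 < h p.1 := hpm.1.trans hpm.2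
    rw [← ENNReal.ofReal_mul (by positivity), ← ENNReal.ofReal_add ha0.le (by positivity)]
    refine ENNReal.ofReal_le_ofReal ?_
    rcases le_total (ρ p) a with h1 | h1
    · have : 0 ≤ H / a ^ (γ - 1) * (ρ p ^ γ / h p.1) := by positivity
      linarith
    · have h2 : ρ p * a ^ (γ - 1) ≤ ρ p ^ γ := by
        have h3 : ρ p ^ γ = ρ p * ρ p ^ (γ - 1) := by
          rw [← Real.rpow_one_add' hp (by linarith)]; congr 1; ring
        rw [h3]
        exact mul_le_mul_of_nonneg_left (Real.rpow_le_rpow ha0.le h1 (by linarith)) hp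
      have h4 : ρ p ≤ H / a ^ (γ - 1) * (ρ p ^ γ / h p.1) := by
        have ha' : 0 < a ^ (γ - 1) := by positivity
        rw [div_mul_div_comm, le_div_iff₀ (mul_pos ha' hh)]
        calc ρ p * (a ^ (γ - 1) * h p.1) = (ρ p * a ^ (γ - 1)) * h p.1 := by ring
          _ ≤ ρ p ^ γ * H := mul_le_mul h2 (hle _) hh.le (by positivity)
          _ = _ := mul_comm _ _
      linarith
  have h1 := lintegral_mono_ae hpt
  rw [← ofReal_integral_eq_lintegral_ofReal hint hρ, hmass, lintegral_add_left measurable_const,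
    lintegral_const, Measure.restrict_apply_univ, lintegral_const_mul' _ _ ENNReal.ofReal_ne_top]
    at h1
  set I := ∫⁻ p in fluidDomain h, ENNReal.ofReal (ρ p ^ γ / h p.1) with hI
  by_cases hIt : I = ⊤
  · rw [hIt]; exact le_top
  have h2 : ENNReal.ofReal m ≤ ENNReal.ofReal (a * (H * area L₁ L₂) + H / a ^ (γ - 1) * I.toReal) := by
    rw [ENNReal.ofReal_add (by positivity) (by positivity), ENNReal.ofReal_mul ha0.le,
      ENNReal.ofReal_mul (p := H / a ^ (γ - 1)) (by positivity), ENNReal.ofReal_toReal hIt]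
    exact h1.trans (by gcongr)
  have h3 := (ENNReal.ofReal_le_ofReal_iff (by positivity)).1 h2
  rw [← ENNReal.ofReal_toReal hIt]
  refine ENNReal.ofReal_le_ofReal ?_
  have e1 : a * (H * area L₁ L₂) = m / 2 := by rw [ha]; field_simp
  rw [e1] at h3
  unfold pressureRate
  rw [← ha, div_le_iff₀ hH]
  have ha' : 0 < a ^ (γ - 1) := by positivity
  have h5 : m / 2 ≤ H / a ^ (γ - 1) * I.toReal := by linarith
  calc m / 2 * a ^ (γ - 1) ≤ H / a ^ (γ - 1) * I.toReal * a ^ (γ - 1) := by gcongr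
    _ = I.toReal * H := by field_simp

end IsSlice

end

end FluidPlate

namespace FluidPlate

set_option linter.unusedSectionVars false

noncomputable section

variable {L₁ L₂ : ℝ} [Fact (0 < L₁)] [Fact (0 < L₂)]

/-! ### Fubini on space-time domains -/

section Cylinder

variable {η : ℝ → Torus L₁ L₂ → ℝ} {I : Set ℝ}

theorem continuous_slice (hη : ContinuousOn (fun q : ℝ × Torus L₁ L₂ => η q.1 q.2) (Ici 0 ×ˢ univ))
    {t : ℝ} (ht : 0 ≤ t) : Continuous (η t) :=
  hη.comp_continuous (f := fun p => (t, p)) (Continuous.prodMk_right t) fun _ => ⟨ht, mem_univ _⟩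

theorem measurableSet_cylinder
    (hη : ContinuousOn (fun q : ℝ × Torus L₁ L₂ => η q.1 q.2) (Ici 0 ×ˢ univ))
    (hI : MeasurableSet I) (hI0 : I ⊆ Ioi 0) : MeasurableSet (cylinder η I) := by
  -- η is continuous for nonnegative times only. Freezing it at negative times gives a globally
  -- continuous function and hence an open region.
  have hc : Continuous fun q : ℝ × Space L₁ L₂ => η (max q.1 0) q.2.1 :=
    hη.comp_continuous (f := fun q : ℝ × Space L₁ L₂ => (max q.1 0, q.2.1)) (by fun_prop)
      fun q => ⟨show (0 : ℝ) ≤ max q.1 0 from le_max_right _ _, mem_univ _⟩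
  have e : cylinder η I = (Prod.fst ⁻¹' I) ∩ ({q : ℝ × Space L₁ L₂ | 0 < q.2.2}
      ∩ {q | q.2.2 < η (max q.1 0) q.2.1}) := by
    ext q
    simp only [cylinder, fluidDomain, mem_ofPred_eq, mem_inter_iff, mem_preimage]
    refine and_congr_right fun hq => ?_
    rw [max_eq_left (hI0 hq : (0 : ℝ) < q.1).le]
  rw [e]
  refine (hI.preimage measurable_fst).inter (MeasurableSet.inter ?_ ?_)
  · exact (isOpen_lt continuous_const (continuous_snd.comp continuous_snd)).measurableSet
  · exact (isOpen_lt (continuous_snd.comp continuous_snd) hc).measurableSet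

theorem lintegral_indicator_cylinder
    (hη : ContinuousOn (fun q : ℝ × Torus L₁ L₂ => η q.1 q.2) (Ici 0 ×ˢ univ))
    (hI : MeasurableSet I) (hI0 : I ⊆ Ioi 0) (F : ℝ × Space L₁ L₂ → ℝ≥0∞) :
    ∫⁻ s, ∫⁻ p, (cylinder η I).indicator F (s, p)
      = ∫⁻ s in I, ∫⁻ p in fluidDomain (η s), F (s, p) := by
  rw [← lintegral_indicator hI]
  refine lintegral_congr fun s => ?_
  by_cases hs : s ∈ I
  · have hS : MeasurableSet (fluidDomain (η s)) :=
      measurableSet_slab 0 (continuous_slice hη (hI0 hs : (0 : ℝ) < s).le)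
    rw [indicator_of_mem hs, ← lintegral_indicator hS]
    refine lintegral_congr fun p => ?_
    by_cases hp : p ∈ fluidDomain (η s)
    · rw [indicator_of_mem hp, indicator_of_mem (show (s, p) ∈ cylinder η I from ⟨hs, hp⟩)]
    · rw [indicator_of_notMem hp, indicator_of_notMem fun hc : (s, p) ∈ cylinder η I => hp hc.2]
  · rw [indicator_of_notMem hs]
    refine (lintegral_congr fun p => indicator_of_notMem
      (fun hc : (s, p) ∈ cylinder η I => hs hc.1) _).trans lintegral_zero

theorem lintegral_cylinder_le
    (hη : ContinuousOn (fun q : ℝ × Torus L₁ L₂ => η q.1 q.2) (Ici 0 ×ˢ univ))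
    (hI : MeasurableSet I) (hI0 : I ⊆ Ioi 0) (F : ℝ × Space L₁ L₂ → ℝ≥0∞) :
    ∫⁻ q in cylinder η I, F q ≤ ∫⁻ s in I, ∫⁻ p in fluidDomain (η s), F (s, p) := by
  rw [← lintegral_indicator (measurableSet_cylinder hη hI hI0),
    ← lintegral_indicator_cylinder hη hI hI0]
  exact lintegral_prod_le (μ := (volume : Measure ℝ)) (ν := (volume : Measure (Space L₁ L₂))) _

theorem lintegral_cylinder
    (hη : ContinuousOn (fun q : ℝ × Torus L₁ L₂ => η q.1 q.2) (Ici 0 ×ˢ univ))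
    (hI : MeasurableSet I) (hI0 : I ⊆ Ioi 0) {F : ℝ × Space L₁ L₂ → ℝ≥0∞}
    (hF : AEMeasurable F (volume.restrict (cylinder η I))) :
    ∫⁻ q in cylinder η I, F q = ∫⁻ s in I, ∫⁻ p in fluidDomain (η s), F (s, p) := by
  have hS := measurableSet_cylinder hη hI hI0
  rw [← lintegral_indicator hS, ← lintegral_indicator_cylinder hη hI hI0]
  exact lintegral_prod (μ := (volume : Measure ℝ)) (ν := (volume : Measure (Space L₁ L₂))) _
    ((aemeasurable_indicator_iff hS).2 hF)

theorem ae_cylinder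
    (hη : ContinuousOn (fun q : ℝ × Torus L₁ L₂ => η q.1 q.2) (Ici 0 ×ˢ univ))
    (hI : MeasurableSet I) (hI0 : I ⊆ Ioi 0) {P : ℝ × Space L₁ L₂ → Prop}
    (hP : ∀ᵐ q ∂(volume.restrict (cylinder η I)), P q) :
    ∀ᵐ s ∂(volume.restrict I), ∀ᵐ p ∂(volume.restrict (fluidDomain (η s))), P (s, p) := by
  rw [ae_restrict_iff' (measurableSet_cylinder hη hI hI0)] at hP
  have h1 := Measure.ae_ae_of_ae_prod (μ := (volume : Measure ℝ))
    (ν := (volume : Measure (Space L₁ L₂))) hP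
  rw [ae_restrict_iff' hI]
  filter_upwards [h1] with s hs hsI
  have hS : MeasurableSet (fluidDomain (η s)) :=
    measurableSet_slab 0 (continuous_slice hη (hI0 hsI : (0 : ℝ) < s).le)
  rw [ae_restrict_iff' hS]
  filter_upwards [hs] with p hp hpm
  exact hp ⟨hsI, hpm⟩

theorem aestronglyMeasurable_cylinder
    (hη : ContinuousOn (fun q : ℝ × Torus L₁ L₂ => η q.1 q.2) (Ici 0 ×ˢ univ))
    (hI : MeasurableSet I) (hI0 : I ⊆ Ioi 0) {F : ℝ × Space L₁ L₂ → ℝ}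
    (hF : AEStronglyMeasurable F (volume.restrict (cylinder η I))) :
    ∀ᵐ s ∂(volume.restrict I),
      AEStronglyMeasurable (fun p => F (s, p)) (volume.restrict (fluidDomain (η s))) := by
  have h1 : AEStronglyMeasurable ((cylinder η I).indicator F)
      ((volume : Measure ℝ).prod (volume : Measure (Space L₁ L₂))) :=
    (aestronglyMeasurable_indicator_iff (measurableSet_cylinder hη hI hI0)).2 hF
  rw [ae_restrict_iff' hI]
  filter_upwards [h1.prodMk_left] with s hs hsI
  have hS : MeasurableSet (fluidDomain (η s)) :=
    measurableSet_slab 0 (continuous_slice hη (hI0 hsI : (0 : ℝ) < s).le)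
  rw [← aestronglyMeasurable_indicator_iff hS]
  refine hs.congr (Eventually.of_forall fun p => ?_)
  by_cases hp : p ∈ fluidDomain (η s)
  · simp only [indicator_of_mem hp, indicator_of_mem (show (s, p) ∈ cylinder η I from ⟨hsI, hp⟩)]
  · simp only [indicator_of_notMem hp,
      indicator_of_notMem fun hc : (s, p) ∈ cylinder η I => hp hc.2]

theorem integral_cylinder
    (hη : ContinuousOn (fun q : ℝ × Torus L₁ L₂ => η q.1 q.2) (Ici 0 ×ˢ univ))
    (hI : MeasurableSet I) (hI0 : I ⊆ Ioi 0) {F : ℝ × Space L₁ L₂ → ℝ}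
    (hF : IntegrableOn F (cylinder η I)) :
    IntegrableOn (fun s => ∫ p in fluidDomain (η s), F (s, p)) I ∧
    ∫ q in cylinder η I, F q = ∫ s in I, ∫ p in fluidDomain (η s), F (s, p) := by
  have hS := measurableSet_cylinder hη hI hI0
  have hi : Integrable ((cylinder η I).indicator F)
      ((volume : Measure ℝ).prod (volume : Measure (Space L₁ L₂))) :=
    (integrable_indicator_iff hS).2 hF
  have e : (fun s => ∫ p, (cylinder η I).indicator F (s, p))
      = I.indicator fun s => ∫ p in fluidDomain (η s), F (s, p) := by
    funext s
    by_cases hs : s ∈ I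
    · have hS : MeasurableSet (fluidDomain (η s)) :=
        measurableSet_slab 0 (continuous_slice hη (hI0 hs : (0 : ℝ) < s).le)
      rw [indicator_of_mem hs, ← integral_indicator hS]
      refine integral_congr_ae (Eventually.of_forall fun p => ?_)
      by_cases hp : p ∈ fluidDomain (η s)
      · simp only [indicator_of_mem hp, indicator_of_mem (show (s, p) ∈ cylinder η I from ⟨hs, hp⟩)]
      · simp only [indicator_of_notMem hp,
          indicator_of_notMem fun hc : (s, p) ∈ cylinder η I => hp hc.2]
    · rw [indicator_of_notMem hs]
      refine (integral_congr_ae (Eventually.of_forall fun p => indicator_of_notMem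
        (fun hc : (s, p) ∈ cylinder η I => hs hc.1) _)).trans (by simp)
  constructor
  · have := hi.integral_prod_left
    rw [e] at this
    exact (integrable_indicator_iff hI).1 this
  · rw [← integral_indicator hS, ← integral_indicator hI, ← e]
    exact integral_prod _ hi

/-- Needs no measurability or integrability of `F`: the norm of the integral is bounded by the lower
integral of the norm in any case. All error terms of the contact inequality pass through this. -/
theorem abs_integral_cylinder_le
    (hη : ContinuousOn (fun q : ℝ × Torus L₁ L₂ => η q.1 q.2) (Ici 0 ×ˢ univ))
    (hI : MeasurableSet I) (hI0 : I ⊆ Ioi 0) {F : ℝ × Space L₁ L₂ → ℝ} {Φ : ℝ → ℝ≥0∞} {C : ℝ}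
    (hC : 0 ≤ C)
    (hF : ∀ᵐ s ∂(volume.restrict I), ∫⁻ p in fluidDomain (η s), ‖F (s, p)‖ₑ ≤ Φ s)
    (hΦ : ∫⁻ s in I, Φ s ≤ ENNReal.ofReal C) : |∫ q in cylinder η I, F q| ≤ C := by
  have h1 := enorm_integral_le_lintegral_enorm (μ := volume.restrict (cylinder η I)) F
  rw [Real.enorm_eq_ofReal_abs] at h1
  exact (ENNReal.ofReal_le_ofReal_iff hC).1 (h1.trans ((lintegral_cylinder_le hη hI hI0 _).trans
    ((lintegral_mono_ae hF).trans hΦ)))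

end Cylinder

/-- The set of negative values is open and null, hence empty. -/
theorem nonneg_of_ae_pos {f : Torus L₁ L₂ → ℝ} (hf : Continuous f) (hp : ∀ᵐ p, 0 < f p)
    (p : Torus L₁ L₂) : 0 ≤ f p := by
  by_contra! hc
  have ho : IsOpen {q | f q < 0} := isOpen_lt hf continuous_const
  have h0 : volume {q | f q < 0} = 0 :=
    measure_mono_null (fun q (hq : f q < 0) => not_lt.2 hq.le) hp
  exact (ho.measure_pos volume ⟨p, hc⟩).ne' h0

/-! ### Weak solutions on almost every time slice, and their dissipation -/

section Weak

variable {μ lam γ : ℝ} {d : InitialData L₁ L₂} {ρ : ℝ → Space L₁ L₂ → ℝ}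
  {u : ℝ → Space L₁ L₂ → Fin 3 → ℝ} {η : ℝ → Torus L₁ L₂ → ℝ}
  {Du : ℝ → Space L₁ L₂ → Fin 3 → Fin 3 → ℝ} {v : ℝ → Torus L₁ L₂ → ℝ}
  {Dη : ℝ → Torus L₁ L₂ → Fin 2 → ℝ} {D2η : ℝ → Torus L₁ L₂ → Fin 2 → Fin 2 → ℝ}

theorem ae_of_forall_Ioo {P : ℝ → Prop} (h : ∀ T, 0 < T → ∀ᵐ t ∂(volume.restrict (Ioo 0 T)), P t) :
    ∀ᵐ t ∂(volume.restrict (Ioi (0 : ℝ))), P t := by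
  rw [ae_restrict_iff' measurableSet_Ioi]
  have h1 : ∀ n : ℕ, ∀ᵐ t : ℝ, t ∈ Ioo (0 : ℝ) (n + 1) → P t := fun n =>
    (ae_restrict_iff' measurableSet_Ioo).1 (h _ (by positivity))
  filter_upwards [ae_all_iff.2 h1] with t ht ht0
  obtain ⟨n, hn⟩ := exists_nat_gt t
  exact ht n ⟨ht0, by linarith⟩

/-- Provides one late time at which all statements valid almost everywhere hold together. -/
theorem exists_gt_of_ae {P : ℝ → Prop} (h : ∀ᵐ t ∂(volume.restrict (Ioi (0 : ℝ))), P t) (N : ℝ) :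
    ∃ t, 0 < t ∧ N < t ∧ P t := by
  have h1 : ∀ᵐ t ∂(volume.restrict (Ioi (max N 0))), P t :=
    ae_restrict_of_ae_restrict_of_subset (Ioi_subset_Ioi (le_max_right _ _)) h
  have : NeBot (ae (volume.restrict (Ioi (max N 0)))) := by
    rw [ae_neBot, Ne, Measure.restrict_eq_zero]
    simp
  obtain ⟨t, ht, htm⟩ := (h1.and (ae_restrict_mem measurableSet_Ioi)).exists
  exact ⟨t, (le_max_right _ _).trans_lt htm, (le_max_left _ _).trans_lt htm, ht⟩

/-- The total energy, with a reduced weight of the elastic part. -/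
def reducedEnergy (μ lam γ : ℝ) (ρ : ℝ → Space L₁ L₂ → ℝ) (u : ℝ → Space L₁ L₂ → Fin 3 → ℝ)
    (η : ℝ → Torus L₁ L₂ → ℝ) (Du : ℝ → Space L₁ L₂ → Fin 3 → Fin 3 → ℝ)
    (v : ℝ → Torus L₁ L₂ → ℝ) (D2η : ℝ → Torus L₁ L₂ → Fin 2 → Fin 2 → ℝ) (t : ℝ) : ℝ :=
  (∫ p in fluidDomain (η t), (1 / 2 * ρ t p * (∑ i, u t p i ^ 2) + ρ t p ^ γ / (γ - 1)))
    + 1 / 2 * (∫ p, v t p ^ 2) + 1 / 4 * lapSq (D2η t)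
    + ∫ q in cylinder η (Ioo 0 t), ∑ i, ∑ j, stress μ lam (Du q.1 q.2) i j * Du q.1 q.2 i j

/-- Measurability and sign on almost every time slice. -/
theorem RegularityClass.slice (R : RegularityClass γ d ρ u η Du v Dη D2η) (hγ : 1 < γ) :
    ∀ᵐ t ∂(volume.restrict (Ioi (0 : ℝ))),
      AEStronglyMeasurable (v t) volume ∧
      AEStronglyMeasurable (ρ t) (volume.restrict (fluidDomain (η t))) ∧
      (∀ᵐ p ∂(volume.restrict (fluidDomain (η t))), 0 ≤ ρ t p) ∧
      Integrable (fun p => ρ t p ^ γ) (volume.restrict (fluidDomain (η t))) ∧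
      Integrable (fun p => ρ t p * ∑ i, u t p i ^ 2) (volume.restrict (fluidDomain (η t))) ∧
      MemLp (v t) 2 volume := by
  have hv : ∀ᵐ t ∂(volume.restrict (Ioi (0 : ℝ))), AEStronglyMeasurable (v t) volume := by
    have h1 := R.v_meas
    rw [show (volume : Measure (ℝ × Torus L₁ L₂)) = (volume : Measure ℝ).prod volume from rfl,
      ← Measure.prod_restrict, Measure.restrict_univ] at h1
    exact h1.prodMk_left
  have hρ := aestronglyMeasurable_cylinder R.η_cont measurableSet_Ioi subset_rfl R.ρ_meas
  have hρ0 := ae_cylinder R.η_cont measurableSet_Ioi subset_rfl R.ρ_nonneg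
  have hρb : ∀ᵐ t ∂(volume.restrict (Ioi (0 : ℝ))),
      eLpNorm (ρ t) (ENNReal.ofReal γ) (volume.restrict (fluidDomain (η t))) < ⊤ :=
    ae_of_forall_Ioo fun T hT => by
      obtain ⟨C, hC⟩ := R.ρ_bound T hT
      exact hC.mono fun t ht => ht.trans_lt ENNReal.coe_lt_top
  have hkb : ∀ᵐ t ∂(volume.restrict (Ioi (0 : ℝ))),
      eLpNorm (fun p => ρ t p * ∑ i, u t p i ^ 2) 1 (volume.restrict (fluidDomain (η t))) < ⊤ :=
    ae_of_forall_Ioo fun T hT => by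
      obtain ⟨C, hC⟩ := R.kinetic_bound T hT
      exact hC.mono fun t ht => ht.trans_lt ENNReal.coe_lt_top
  have hvb : ∀ᵐ t ∂(volume.restrict (Ioi (0 : ℝ))), eLpNorm (v t) 2 volume < ⊤ :=
    ae_of_forall_Ioo fun T hT => by
      obtain ⟨C, hC⟩ := R.v_bound T hT
      exact hC.mono fun t ht => ht.trans_lt ENNReal.coe_lt_top
  filter_upwards [hv, hρ, hρ0, hρb, hkb, hvb, R.u_H1] with t h1 h2 h3 h4 h5 h6 h7
  refine ⟨h1, h2, h3, ?_, ?_, ⟨h1, h6⟩⟩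
  · have hm : MemLp (ρ t) (ENNReal.ofReal γ) (volume.restrict (fluidDomain (η t))) := ⟨h2, h4⟩
    have := hm.integrable_norm_rpow (by simp; linarith) ENNReal.ofReal_ne_top
    rw [ENNReal.toReal_ofReal (by linarith)] at this
    refine this.congr ?_
    filter_upwards [h3] with p hp
    rw [Real.norm_of_nonneg hp]
  · refine memLp_one_iff_integrable.1 ⟨?_, h5⟩
    refine h2.mul ?_
    have : ∀ i, AEStronglyMeasurable (fun p => u t p i ^ 2)
        (volume.restrict (fluidDomain (η t))) := fun i =>
      (h7 i).isH1.memLp.aestronglyMeasurable.pow 2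
    exact Finset.aestronglyMeasurable_fun_sum _ fun i _ => this i

/-- The dissipation is controlled by the viscous energy. -/
theorem RegularityClass.lintegral_dissip_le (R : RegularityClass γ d ρ u η Du v Dη D2η)
    (hμ : 0 < μ) (hlam : 0 ≤ lam) {t : ℝ} (ht : 0 < t) :
    0 ≤ (∫ q in cylinder η (Ioo 0 t), ∑ i, ∑ j, stress μ lam (Du q.1 q.2) i j * Du q.1 q.2 i j) ∧
    ∫⁻ s in Ioo 0 t, dissip (η s) (Du s) ≤ ENNReal.ofReal
      ((∫ q in cylinder η (Ioo 0 t), ∑ i, ∑ j, stress μ lam (Du q.1 q.2) i j * Du q.1 q.2 i j)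
        / μ) := by
  have hI0 : Ioo 0 t ⊆ Ioi (0 : ℝ) := fun s hs => hs.1
  have m2 := R.Du_L2 t ht
  have I2 : ∀ i j k l, Integrable (fun q : ℝ × Space L₁ L₂ => Du q.1 q.2 i j * Du q.1 q.2 k l)
      (volume.restrict (cylinder η (Ioo 0 t))) := fun i j k l => (m2 i j).integrable_mul (m2 k l)
  have hN : IntegrableOn (fun q : ℝ × Space L₁ L₂ => ∑ i, ∑ j, Du q.1 q.2 i j ^ 2)
      (cylinder η (Ioo 0 t)) :=
    integrable_finsetSum _ fun i _ => integrable_finsetSum _ fun j _ => (m2 i j).integrable_sq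
  have hSt : IntegrableOn (fun q : ℝ × Space L₁ L₂ =>
      ∑ i, ∑ j, stress μ lam (Du q.1 q.2) i j * Du q.1 q.2 i j) (cylinder η (Ioo 0 t)) := by
    refine integrable_finsetSum _ fun i _ => integrable_finsetSum _ fun j _ => ?_
    have e : (fun q : ℝ × Space L₁ L₂ => stress μ lam (Du q.1 q.2) i j * Du q.1 q.2 i j)
        = fun q => μ * (Du q.1 q.2 i j * Du q.1 q.2 i j) + μ * (Du q.1 q.2 j i * Du q.1 q.2 i j)
          + ((lam - 2 / 3 * μ) * if i = j then 1 else 0)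
            * ∑ k, Du q.1 q.2 k k * Du q.1 q.2 i j := by
      funext q
      rw [← Finset.sum_mul]
      unfold stress
      ring
    rw [e]
    exact (((I2 i j i j).const_mul _).add ((I2 j i i j).const_mul _)).add
      ((integrable_finsetSum _ fun k _ => I2 k k i j).const_mul _)
  obtain ⟨iN, eN⟩ := integral_cylinder R.η_cont measurableSet_Ioo hI0 hN
  obtain ⟨iS, eS⟩ := integral_cylinder R.η_cont measurableSet_Ioo hI0 hSt
  -- Korn's inequality holds only after integration over a slice, so Fubini comes first and the
  -- slices are then integrated in time.
  have hk : μ * ∫ q in cylinder η (Ioo 0 t), ∑ i, ∑ j, Du q.1 q.2 i j ^ 2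
      ≤ ∫ q in cylinder η (Ioo 0 t), ∑ i, ∑ j, stress μ lam (Du q.1 q.2) i j * Du q.1 q.2 i j := by
    rw [eN, eS, ← integral_const_mul]
    refine integral_mono_ae (iN.const_mul μ) iS ?_
    have hsub := ae_restrict_of_ae_restrict_of_subset hI0
      (R.u_H1.and (R.coupling.and R.η_H2))
    filter_upwards [hsub, ae_restrict_mem measurableSet_Ioo] with s hs hsm
    have hc := continuous_slice R.η_cont hsm.1.le
    exact (integral_stress_ge hμ hlam hs.2.1 hs.2.2 hc
      (nonneg_of_ae_pos hc (R.η_pos s hsm.1.le)) (fun i => (hs.1 i).isH1.memLp)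
      fun i j => (hs.1 i).isH1.grad_memLp j).2
  have hN0 : 0 ≤ ∫ q in cylinder η (Ioo 0 t), ∑ i, ∑ j, Du q.1 q.2 i j ^ 2 :=
    integral_nonneg fun q => Finset.sum_nonneg fun i _ => Finset.sum_nonneg fun j _ => sq_nonneg _
  refine ⟨le_trans (by positivity) hk, ?_⟩
  have h1 : ∫⁻ s in Ioo 0 t, dissip (η s) (Du s)
      = ENNReal.ofReal (∫ q in cylinder η (Ioo 0 t), ∑ i, ∑ j, Du q.1 q.2 i j ^ 2) := by
    rw [ofReal_integral_eq_lintegral_ofReal hN (Eventually.of_forall fun q =>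
      Finset.sum_nonneg fun i _ => Finset.sum_nonneg fun j _ => sq_nonneg _),
      lintegral_cylinder R.η_cont measurableSet_Ioo hI0
        hN.aestronglyMeasurable.aemeasurable.ennreal_ofReal]
    refine lintegral_congr_ae ?_
    filter_upwards [ae_restrict_of_ae_restrict_of_subset hI0 R.u_H1] with s hs
    unfold dissip
    have mm : ∀ i j, AEMeasurable (fun p => ‖Du s p i j‖ₑ ^ 2)
        (volume.restrict (fluidDomain (η s))) := fun i j =>
      ((hs i).isH1.grad_memLp j).aestronglyMeasurable.enorm.pow_const _
    simp only [← lintegral_finsetSum' Finset.univ fun j _ => mm _ j]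
    rw [← lintegral_finsetSum' Finset.univ fun i _ => Finset.aemeasurable_fun_sum _ fun j _ => mm i j]
    refine lintegral_congr fun p => ?_
    rw [ENNReal.ofReal_sum_of_nonneg fun i _ => Finset.sum_nonneg fun j _ => sq_nonneg _]
    refine Finset.sum_congr rfl fun i _ => ?_
    rw [ENNReal.ofReal_sum_of_nonneg fun j _ => sq_nonneg _]
    refine Finset.sum_congr rfl fun j _ => ?_
    rw [Real.enorm_eq_ofReal_abs, ← ENNReal.ofReal_pow (abs_nonneg _), sq_abs]
  rw [h1]
  refine ENNReal.ofReal_le_ofReal ?_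
  rw [le_div_iff₀ hμ, mul_comm]
  exact hk

end Weak

end

end FluidPlate

/-! ### Permanent contact contradicts a uniform energy bound -/

namespace FluidPlate

set_option linter.unusedSectionVars false

noncomputable section

variable {L₁ L₂ : ℝ} [Fact (0 < L₁)] [Fact (0 < L₂)]

/-- Splits the root of the dissipation into a small constant, which grows slowly when integrated in
time, and a multiple of the dissipation, which is integrable on the whole half line. -/
theorem rpow_half_le (x : ℝ≥0∞) {δ : ℝ} (hδ : 0 < δ) :
    x ^ (1 / 2 : ℝ) ≤ ENNReal.ofReal δ + (ENNReal.ofReal δ)⁻¹ * x := by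
  have hd0 : ENNReal.ofReal δ ≠ 0 := by simpa using hδ
  set y := x ^ (1 / 2 : ℝ) with hy
  have hx : x = y * y := (IsSlice.rpow_half_mul_self x).symm
  rcases le_total y (ENNReal.ofReal δ) with h | h
  · exact h.trans le_self_add
  · refine le_trans ?_ le_add_self
    rw [hx, ← mul_assoc]
    calc y = (ENNReal.ofReal δ)⁻¹ * ENNReal.ofReal δ * y := by
          rw [ENNReal.inv_mul_cancel hd0 ENNReal.ofReal_ne_top, one_mul]
      _ ≤ _ := by gcongr

section Weak

variable {μ lam γ : ℝ} {d : InitialData L₁ L₂} {ρ : ℝ → Space L₁ L₂ → ℝ}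
  {u : ℝ → Space L₁ L₂ → Fin 3 → ℝ} {η : ℝ → Torus L₁ L₂ → ℝ}
  {Du : ℝ → Space L₁ L₂ → Fin 3 → Fin 3 → ℝ} {v : ℝ → Torus L₁ L₂ → ℝ}
  {Dη : ℝ → Torus L₁ L₂ → Fin 2 → ℝ} {D2η : ℝ → Torus L₁ L₂ → Fin 2 → Fin 2 → ℝ}

/-- The upper bound of a plate in contact at energy `E`. -/
def contactHeight (L₁ L₂ : ℝ) [Fact (0 < L₁)] [Fact (0 < L₂)] (E : ℝ) : ℝ :=
  oscConst L₁ L₂ * √(4 * E) + 1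

theorem contactHeight_pos (E : ℝ) : 0 < contactHeight L₁ L₂ E := by
  have := oscConst_nonneg (L₁ := L₁) (L₂ := L₂)
  unfold contactHeight; positivity

/-- Consequences of an energy bound on almost every time slice, under contact. -/
theorem RegularityClass.energy_consequences (R : RegularityClass γ d ρ u η Du v Dη D2η)
    (hγ : 1 < γ) (hμ : 0 < μ) (hlam : 0 ≤ lam) (hcon : ∀ t, 0 < t → ∃ p, η t p ≤ 0) {E : ℝ}
    (hE : ∀ᵐ t ∂(volume.restrict (Ioi (0 : ℝ))),
      reducedEnergy μ lam γ ρ u η Du v D2η t ≤ E) :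
    ∀ᵐ t ∂(volume.restrict (Ioi (0 : ℝ))),
      IsSlice γ (contactHeight L₁ L₂ E) (4 * E) (ENNReal.ofReal ((γ - 1) * E)) (η t) (Dη t) (D2η t)
        (ρ t) (u t) (Du t) (v t) ∧
      ∫ p in fluidDomain (η t), ρ t p * ∑ i, u t p i ^ 2 ≤ 2 * E ∧
      ∫ p, v t p ^ 2 ≤ 2 * E ∧
      ∫⁻ s in Ioo 0 t, dissip (η s) (Du s) ≤ ENNReal.ofReal (E / μ) := by
  filter_upwards [hE, R.slice hγ, R.u_H1, R.coupling, R.η_H2, ae_restrict_mem measurableSet_Ioi]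
    with t ht ⟨s1, s2, s3, s4, s5, s6⟩ hu hcp hh ht0
  have ht0 : 0 < t := ht0
  have hc := continuous_slice R.η_cont ht0.le
  have h0 := nonneg_of_ae_pos hc (R.η_pos t ht0.le)
  obtain ⟨hd0, hd1⟩ := R.lintegral_dissip_le hμ hlam ht0
  have e1 : ∫ p in fluidDomain (η t), (1 / 2 * ρ t p * (∑ i, u t p i ^ 2) + ρ t p ^ γ / (γ - 1))
      = 1 / 2 * (∫ p in fluidDomain (η t), ρ t p * ∑ i, u t p i ^ 2)
        + (∫ p in fluidDomain (η t), ρ t p ^ γ) / (γ - 1) := by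
    rw [← integral_const_mul, ← integral_div, ← integral_add (s5.const_mul _) (s4.div_const _)]
    refine integral_congr_ae (Eventually.of_forall fun p => ?_)
    simp only
    ring
  have n1 : 0 ≤ ∫ p in fluidDomain (η t), ρ t p * ∑ i, u t p i ^ 2 :=
    integral_nonneg_of_ae (s3.mono fun p hp =>
      mul_nonneg hp (Finset.sum_nonneg fun i _ => sq_nonneg _))
  have n2 : 0 ≤ ∫ p in fluidDomain (η t), ρ t p ^ γ :=
    integral_nonneg_of_ae (s3.mono fun p hp => Real.rpow_nonneg hp _)
  have n3 : 0 ≤ ∫ p, v t p ^ 2 := integral_nonneg fun _ => sq_nonneg _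
  have n4 := lapSq_nonneg (D2η t)
  unfold reducedEnergy at ht
  rw [e1] at ht
  have n2' : 0 ≤ (∫ p in fluidDomain (η t), ρ t p ^ γ) / (γ - 1) :=
    div_nonneg n2 (by linarith)
  have hlap : lapSq (D2η t) ≤ 4 * E := by linarith
  have hp : ∫ p in fluidDomain (η t), ρ t p ^ γ ≤ (γ - 1) * E := by
    have : (∫ p in fluidDomain (η t), ρ t p ^ γ) / (γ - 1) ≤ E := by linarith
    rw [div_le_iff₀ (by linarith)] at this
    linarith
  refine ⟨⟨hc, h0, R.η_pos t ht0.le, fun q => ?_, hh, hlap, hcp, fun i => (hu i).isH1.memLp,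
    fun i j => (hu i).isH1.grad_memLp j, s1, s2, ?_⟩, by linarith, by linarith,
    hd1.trans (ENNReal.ofReal_le_ofReal (by gcongr; linarith))⟩
  -- Contact is used here: the height at `p` is at most zero, so the oscillation bounds the height
  -- everywhere.
  · obtain ⟨p, hp0⟩ := hcon t ht0
    have h1 := (abs_le.1 (hh.abs_sub_le hc p q)).2
    have h2 : oscConst L₁ L₂ * √(lapSq (D2η t)) ≤ oscConst L₁ L₂ * √(4 * E) :=
      mul_le_mul_of_nonneg_left (Real.sqrt_le_sqrt hlap) oscConst_nonneg
    unfold contactHeight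
    linarith
  · refine le_trans (le_of_eq ?_) (ENNReal.ofReal_le_ofReal hp)
    rw [ofReal_integral_eq_lintegral_ofReal s4 (s3.mono fun p hp => Real.rpow_nonneg hp _)]
    refine lintegral_congr_ae (s3.mono fun p hp => ?_)
    simp only [Real.enorm_eq_ofReal hp, ENNReal.ofReal_rpow_of_nonneg hp (by linarith : 0 ≤ γ)]

theorem RegularityClass.pressure_ge (R : RegularityClass γ d ρ u η Du v Dη D2η) (hγ : 1 < γ)
    (hm : 0 < d.mass) {H : ℝ} (hH : 0 < H)
    (hle : ∀ᵐ t ∂(volume.restrict (Ioi (0 : ℝ))), ∀ q, η t q ≤ H) {t : ℝ} (ht : 0 < t) :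
    IsSlice.pressureRate L₁ L₂ γ d.mass H * t
      ≤ ∫ q in cylinder η (Ioo 0 t), ρ q.1 q.2 ^ γ / η q.1 q.2.1 := by
  have hI0 : Ioo 0 t ⊆ Ioi (0 : ℝ) := fun s hs => hs.1
  have hi := R.pressure_int t ht
  have hsub : cylinder η (Ioo 0 t) ⊆ cylinder η (Ioi 0) := fun q hq => ⟨hI0 hq.1, hq.2⟩
  have hS := measurableSet_cylinder R.η_cont measurableSet_Ioo hI0
  have h0 : ∀ᵐ q ∂(volume.restrict (cylinder η (Ioo 0 t))),
      0 ≤ ρ q.1 q.2 ^ γ / η q.1 q.2.1 := by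
    filter_upwards [ae_restrict_of_ae_restrict_of_subset hsub R.ρ_nonneg, ae_restrict_mem hS]
      with q hq hqm
    exact div_nonneg (Real.rpow_nonneg hq _) (hqm.2.1.trans hqm.2.2).le
  have hint0 : 0 ≤ ∫ q in cylinder η (Ioo 0 t), ρ q.1 q.2 ^ γ / η q.1 q.2.1 :=
    integral_nonneg_of_ae h0
  have hc0 := (IsSlice.pressureRate_pos (L₁ := L₁) (L₂ := L₂) (γ := γ) hm hH).le
  refine (ENNReal.ofReal_le_ofReal_iff hint0).1 ?_
  rw [ofReal_integral_eq_lintegral_ofReal hi h0, lintegral_cylinder R.η_cont measurableSet_Ioo hI0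
    hi.aestronglyMeasurable.aemeasurable.ennreal_ofReal]
  have e : ENNReal.ofReal (IsSlice.pressureRate L₁ L₂ γ d.mass H * t)
      = ∫⁻ _ in Ioo 0 t, ENNReal.ofReal (IsSlice.pressureRate L₁ L₂ γ d.mass H) := by
    rw [lintegral_const, Measure.restrict_apply_univ, Real.volume_Ioo, sub_zero,
      ENNReal.ofReal_mul hc0]
  rw [e]
  refine lintegral_mono_ae ?_
  filter_upwards [ae_restrict_of_ae_restrict_of_subset hI0 ((R.slice hγ).and hle),
    ae_restrict_mem measurableSet_Ioo] with s hs hsm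
  exact IsSlice.pressureRate_le (continuous_slice R.η_cont hsm.1.le) hs.2 hm hH hγ hs.1.2.2.1
    (R.mass s hsm.1.le)

theorem RegularityClass.vertical_nonneg (R : RegularityClass γ d ρ u η Du v Dη D2η) {t : ℝ} :
    0 ≤ ∫ q in cylinder η (Ioo 0 t), ρ q.1 q.2 * u q.1 q.2 2 ^ 2 / η q.1 q.2.1 := by
  have hI0 : Ioo 0 t ⊆ Ioi (0 : ℝ) := fun s hs => hs.1
  have hsub : cylinder η (Ioo 0 t) ⊆ cylinder η (Ioi 0) := fun q hq => ⟨hI0 hq.1, hq.2⟩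
  refine integral_nonneg_of_ae ?_
  filter_upwards [ae_restrict_of_ae_restrict_of_subset hsub R.ρ_nonneg,
    ae_restrict_mem (measurableSet_cylinder R.η_cont measurableSet_Ioo hI0)] with q hq hqm
  exact div_nonneg (mul_nonneg hq (sq_nonneg _)) (hqm.2.1.trans hqm.2.2).le

theorem abs_integral_le_of_sq {f : Torus L₁ L₂ → ℝ} {c : ℝ} (hf : MemLp f 2)
    (hc : ∫ p, f p ^ 2 ≤ c) : |∫ p, f p| ≤ 1 / 2 * (area L₁ L₂ + c) := by
  have h1 : |∫ p, f p| ≤ ∫ p, 1 / 2 * (1 + f p ^ 2) := by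
    rw [← Real.norm_eq_abs]
    refine norm_integral_le_of_norm_le
      (((integrable_const 1).add hf.integrable_sq).const_mul _) (Eventually.of_forall fun p => ?_)
    rw [Real.norm_eq_abs]
    nlinarith [sq_nonneg (|f p| - 1), sq_abs (f p)]
  rw [integral_const_mul, integral_add (integrable_const 1) hf.integrable_sq, integral_const,
    smul_eq_mul, mul_one] at h1
  have h2 : (volume : Measure (Torus L₁ L₂)).real univ = area L₁ L₂ := rfl
  rw [h2] at h1
  linarith

/-- The weight z/h is at most one and |w₃| ≤ (1 + |w|²)/2, so mass and kinetic energy suffice,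
uniformly in the height. -/
theorem abs_vertical_momentum_le {h : Torus L₁ L₂ → ℝ} {r : Space L₁ L₂ → ℝ}
    {w : Space L₁ L₂ → Fin 3 → ℝ} {m c : ℝ} (hh : Continuous h) (hm : 0 < m)
    (hr : ∀ᵐ p ∂(volume.restrict (fluidDomain h)), 0 ≤ r p)
    (hk : Integrable (fun p => r p * ∑ i, w p i ^ 2) (volume.restrict (fluidDomain h)))
    (hmass : ∫ p in fluidDomain h, r p = m)
    (hc : ∫ p in fluidDomain h, r p * ∑ i, w p i ^ 2 ≤ c) :
    |∫ p in fluidDomain h, r p * w p 2 * (p.2 / h p.1)| ≤ 1 / 2 * (m + c) := by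
  have hS : MeasurableSet (fluidDomain h) := measurableSet_slab 0 hh
  have hi : Integrable r (volume.restrict (fluidDomain h)) := by
    by_contra hni
    rw [integral_undef hni] at hmass
    exact hm.ne hmass
  have h1 : |∫ p in fluidDomain h, r p * w p 2 * (p.2 / h p.1)|
      ≤ ∫ p in fluidDomain h, 1 / 2 * (r p + r p * ∑ i, w p i ^ 2) := by
    rw [← Real.norm_eq_abs]
    refine norm_integral_le_of_norm_le ((hi.add hk).const_mul _) ?_
    filter_upwards [hr, ae_restrict_mem hS] with p hp hpm
    have hh : 0 < h p.1 := hpm.1.trans hpm.2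
    have hz1 : p.2 / h p.1 ≤ 1 := (div_le_one hh).2 hpm.2.le
    have hz0 : 0 ≤ p.2 / h p.1 := div_nonneg hpm.1.le hh.le
    rw [norm_mul, norm_mul, Real.norm_of_nonneg hp, Real.norm_of_nonneg hz0, Real.norm_eq_abs]
    have h2 : w p 2 ^ 2 ≤ ∑ i, w p i ^ 2 :=
      Finset.single_le_sum (f := fun i => w p i ^ 2) (fun _ _ => sq_nonneg _) (Finset.mem_univ 2)
    have h3 : |w p 2| ≤ 1 / 2 * (1 + ∑ i, w p i ^ 2) := by
      nlinarith [sq_nonneg (|w p 2| - 1), sq_abs (w p 2)]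
    calc r p * |w p 2| * (p.2 / h p.1) ≤ r p * |w p 2| * 1 :=
          mul_le_mul_of_nonneg_left hz1 (mul_nonneg hp (abs_nonneg _))
      _ ≤ r p * (1 / 2 * (1 + ∑ i, w p i ^ 2)) := by
          rw [mul_one]; exact mul_le_mul_of_nonneg_left h3 hp
      _ = _ := by ring
  rw [integral_const_mul, integral_add hi hk, hmass] at h1
  linarith

/-- Permanent contact contradicts a uniform energy bound. -/
theorem contact_absurd (hγ : 3 < γ) (hd : d.Admissible γ) (hμ : 0 < μ) (hlam : 0 ≤ lam)
    (R : RegularityClass γ d ρ u η Du v Dη D2η) (hcon : ∀ t, 0 < t → ∃ p, η t p ≤ 0)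
    {F : ℝ → Torus L₁ L₂ → ℝ} {E a B : ℝ}
    (hE : ∀ᵐ t ∂(volume.restrict (Ioi (0 : ℝ))),
      reducedEnergy μ lam γ ρ u η Du v D2η t ≤ E)
    (hCI : ∀ᵐ t ∂(volume.restrict (Ioi (0 : ℝ))),
      ContactInequality μ lam γ d F ρ u η Du v Dη t)
    (hF : ∀ t, 0 < t → -(a * t) - B ≤ ∫ q in Ioo 0 t ×ˢ (univ : Set (Torus L₁ L₂)), F q.1 q.2)
    (ha : a < IsSlice.pressureRate L₁ L₂ γ d.mass (contactHeight L₁ L₂ E)) : False := by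
  set H := contactHeight L₁ L₂ E with hH
  have hHpos : 0 < H := contactHeight_pos E
  set c₀ := IsSlice.pressureRate L₁ L₂ γ d.mass H with hc₀
  have hcons := R.energy_consequences (by linarith) hμ hlam hcon hE
  obtain ⟨K, hK, hKb⟩ := IsSlice.exists_convective_terms_le L₁ L₂ hγ H (4 * E)
    (P := ENNReal.ofReal ((γ - 1) * E)) ENNReal.ofReal_ne_top
  set G := 4 * IsSlice.gradConst L₁ L₂ (4 * E) with hG
  have hGt : G ≠ ⊤ := ENNReal.mul_ne_top (by norm_num) IsSlice.gradConst_ne_top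
  -- `E` is only known as an upper bound; it is nonnegative because it dominates a kinetic energy at
  -- some time.
  have hE0 : 0 ≤ E := by
    obtain ⟨t, -, -, ht⟩ := exists_gt_of_ae hcons 0
    have : 0 ≤ ∫ p, v t p ^ 2 := integral_nonneg fun _ => sq_nonneg _
    linarith [ht.2.2.1]
  set w := 2 * μ + |lam - 2 * μ / 3| with hw
  have hw0 : 0 < w := by positivity
  -- Chosen so that the linear growth of the three viscous terms, with total weight at most `w`,
  -- uses no more than half of the surplus of the pressure over the force.
  set δ := (c₀ - a) / (2 * w * (G.toReal + 1)) with hδdef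
  have hδ : 0 < δ := div_pos (by linarith) (by positivity)
  have hδ2 : w * (G.toReal * δ) ≤ (c₀ - a) / 2 := by
    rw [hδdef]
    have h1 : G.toReal / (G.toReal + 1) ≤ 1 := by
      rw [div_le_one (by positivity)]; linarith
    have e : w * (G.toReal * ((c₀ - a) / (2 * w * (G.toReal + 1))))
        = (c₀ - a) / 2 * (G.toReal / (G.toReal + 1)) := by field_simp
    rw [e]
    exact mul_le_of_le_one_right (by linarith) h1
  -- All contributions that stay bounded in time.
  set C := 3 * (K.toReal * (E / μ)) + w * (G.toReal * (δ⁻¹ * (E / μ))) + B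
    + (4 * μ / 3 + lam) * (H * area L₁ L₂)
    + |(4 * μ / 3 + lam) * ∫ p, Real.log (d.η₀ p)| + 1 / 2 * (d.mass + 2 * E)
    + |∫ p in d.dom, d.q₀ p 2 * (p.2 / d.η₀ p.1)| + 1 / 2 * (area L₁ L₂ + 2 * E)
    + |∫ p, d.v₀ p| with hC
  obtain ⟨t, ht0, htC, ⟨hs, hke, hv2, hdis⟩, hci, hsl⟩ := exists_gt_of_ae
    (hcons.and (hCI.and (R.slice (by linarith)))) (C / ((c₀ - a) / 2))
  rw [div_lt_iff₀ (by linarith)] at htC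
  have hI0 : Ioo 0 t ⊆ Ioi (0 : ℝ) := fun s hs => hs.1
  have hcs := ae_restrict_of_ae_restrict_of_subset hI0 hcons
  -- the convective terms
  have conv : ∀ {f : ℝ × Space L₁ L₂ → ℝ}, (∀ᵐ s ∂(volume.restrict (Ioo 0 t)),
      ∫⁻ p in fluidDomain (η s), ‖f (s, p)‖ₑ ≤ K * dissip (η s) (Du s)) →
      |∫ q in cylinder η (Ioo 0 t), f q| ≤ K.toReal * (E / μ) := fun hf => by
    refine abs_integral_cylinder_le R.η_cont measurableSet_Ioo hI0 (by positivity) hf ?_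
    rw [lintegral_const_mul' _ _ hK, ENNReal.ofReal_mul ENNReal.toReal_nonneg,
      ENNReal.ofReal_toReal hK]
    gcongr
  have visc : ∀ {f : ℝ × Space L₁ L₂ → ℝ}, (∀ᵐ s ∂(volume.restrict (Ioo 0 t)),
      ∫⁻ p in fluidDomain (η s), ‖f (s, p)‖ₑ ≤ G * dissip (η s) (Du s) ^ (1 / 2 : ℝ)) →
      |∫ q in cylinder η (Ioo 0 t), f q| ≤ G.toReal * (δ * t + δ⁻¹ * (E / μ)) := fun hf => by
    refine abs_integral_cylinder_le R.η_cont measurableSet_Ioo hI0 (by positivity) hf ?_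
    rw [lintegral_const_mul' _ _ hGt, ENNReal.ofReal_mul ENNReal.toReal_nonneg,
      ENNReal.ofReal_toReal hGt]
    refine mul_le_mul_right ((lintegral_mono fun s => rpow_half_le _ hδ).trans ?_) _
    rw [lintegral_add_left measurable_const, lintegral_const, Measure.restrict_apply_univ,
      Real.volume_Ioo, sub_zero, lintegral_const_mul' _ _ (by simpa using hδ),
      ENNReal.ofReal_add (by positivity) (by positivity), ENNReal.ofReal_mul hδ.le,
      ENNReal.ofReal_mul (p := δ⁻¹) (by positivity), ENNReal.ofReal_inv_of_pos hδ]
    gcongr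
  have T1 := conv (f := fun q => ρ q.1 q.2 * u q.1 q.2 2 * q.2.2 * (v q.1 q.2.1 / η q.1 q.2.1 ^ 2))
    (hcs.mono fun s hs => (hKb hs.1).1)
  have T2 := conv (f := fun q => ρ q.1 q.2 * u q.1 q.2 0 * u q.1 q.2 2
    * (q.2.2 * Dη q.1 q.2.1 0 / η q.1 q.2.1 ^ 2)) (hcs.mono fun s hs => (hKb hs.1).2 0)
  have T3 := conv (f := fun q => ρ q.1 q.2 * u q.1 q.2 1 * u q.1 q.2 2
    * (q.2.2 * Dη q.1 q.2.1 1 / η q.1 q.2.1 ^ 2)) (hcs.mono fun s hs => (hKb hs.1).2 1)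
  have T4 := visc (f := fun q => (Du q.1 q.2 0 2 + Du q.1 q.2 2 0)
    * (q.2.2 * Dη q.1 q.2.1 0 / η q.1 q.2.1 ^ 2)) (hcs.mono fun s hs => hs.1.viscous_terms_le.1 0)
  have T5 := visc (f := fun q => (Du q.1 q.2 1 2 + Du q.1 q.2 2 1)
    * (q.2.2 * Dη q.1 q.2.1 1 / η q.1 q.2.1 ^ 2)) (hcs.mono fun s hs => hs.1.viscous_terms_le.1 1)
  have T6 := visc (f := fun q => u q.1 q.2 0 * (Dη q.1 q.2.1 0 / η q.1 q.2.1 ^ 2)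
    + u q.1 q.2 1 * (Dη q.1 q.2.1 1 / η q.1 q.2.1 ^ 2))
    (hcs.mono fun s hs => hs.1.viscous_terms_le.2)
  -- the remaining terms
  have hPr := R.pressure_ge (by linarith) hd.mass_pos hHpos (hcons.mono fun s hs => hs.1.le) ht0
  have hVe := R.vertical_nonneg (t := t)
  -- Only an upper bound of the logarithm is needed, so degeneration of η does no harm.
  have hlog : ∫ p, Real.log (η t p) ≤ H * area L₁ L₂ := by
    have h1 : ∫ p, Real.log (η t p) ≤ ∫ _ : Torus L₁ L₂, H := by
      refine integral_mono_ae (R.log_int t ht0.le) (integrable_const _) ?_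
      filter_upwards [R.η_pos t ht0.le] with p hp
      exact (Real.log_le_self hp.le).trans (hs.le p)
    refine h1.trans (le_of_eq ?_)
    rw [integral_const, smul_eq_mul, mul_comm]
    rfl
  obtain ⟨-, -, s3, -, s5, s6⟩ := hsl
  have hmass := R.mass t ht0.le
  have hmom := abs_vertical_momentum_le hs.cont hd.mass_pos s3 s5 hmass hke
  have hvel := abs_integral_le_of_sq s6 hv2
  have hFt := hF t ht0
  unfold ContactInequality at hci
  have hmul : ∀ {x y b : ℝ}, |x| ≤ b → y * x ≤ |y| * b := fun {x y b} h =>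
    (le_abs_self _).trans (by rw [abs_mul]; exact mul_le_mul_of_nonneg_left h (abs_nonneg _))
  have m4 := hmul (y := -μ) T4
  have m5 := hmul (y := -μ) T5
  have m6 := hmul (y := lam - 2 * μ / 3) T6
  rw [abs_neg, abs_of_pos hμ] at m4 m5
  have hl2 : (4 * μ / 3 + lam) * (∫ p, Real.log (η t p))
      ≤ (4 * μ / 3 + lam) * (H * area L₁ L₂) :=
    mul_le_mul_of_nonneg_left hlog (by positivity)
  have a1 := (abs_le.1 T1).2
  have a2 := (abs_le.1 T2).2
  have a3 := (abs_le.1 T3).2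
  have a7 := neg_abs_le ((4 * μ / 3 + lam) * ∫ p, Real.log (d.η₀ p))
  have a8 := (abs_le.1 hmom).2
  have a9 := neg_abs_le (∫ p in d.dom, d.q₀ p 2 * (p.2 / d.η₀ p.1))
  have a10 := (abs_le.1 hvel).2
  have a11 := neg_abs_le (∫ p, d.v₀ p)
  have hsum : μ * (G.toReal * (δ * t + δ⁻¹ * (E / μ))) + μ * (G.toReal * (δ * t + δ⁻¹ * (E / μ)))
      + |lam - 2 * μ / 3| * (G.toReal * (δ * t + δ⁻¹ * (E / μ)))
      = w * (G.toReal * δ) * t + w * (G.toReal * (δ⁻¹ * (E / μ))) := by rw [hw]; ring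
  have hδt := mul_le_mul_of_nonneg_right hδ2 ht0.le
  rw [← hc₀] at hPr
  -- The contact inequality collected; it fails because `t` was taken larger than `C / ((c₀ - a) /
  -- 2)`.
  have hfin : (c₀ - a) * t ≤ (c₀ - a) / 2 * t + C := by
    rw [hC]
    linarith
  linarith

end Weak

end

end FluidPlate

/-! ### Uniform energy bounds for both kinds of force -/

namespace FluidPlate

set_option linter.unusedSectionVars false

noncomputable section

variable {L₁ L₂ : ℝ} [Fact (0 < L₁)] [Fact (0 < L₂)]

section Weak

variable {μ lam γ : ℝ} {d : InitialData L₁ L₂} {ρ : ℝ → Space L₁ L₂ → ℝ}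
  {u : ℝ → Space L₁ L₂ → Fin 3 → ℝ} {η : ℝ → Torus L₁ L₂ → ℝ}
  {Du : ℝ → Space L₁ L₂ → Fin 3 → Fin 3 → ℝ} {v : ℝ → Torus L₁ L₂ → ℝ}
  {Dη : ℝ → Torus L₁ L₂ → Fin 2 → ℝ} {D2η : ℝ → Torus L₁ L₂ → Fin 2 → Fin 2 → ℝ}

/-- The initial energy, with elastic energy `S / 2`. -/
def initialEnergy (γ : ℝ) (d : InitialData L₁ L₂) (S : ℝ) : ℝ :=
  (∫ p in d.dom, ((∑ i, d.q₀ p i ^ 2) / (2 * d.ρ₀ p) + d.ρ₀ p ^ γ / (γ - 1)))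
    + (1 / 2 * (∫ p, d.v₀ p ^ 2) + 1 / 2 * S)

theorem integral_plate_energy {f : Torus L₁ L₂ → ℝ} {h : Torus L₁ L₂ → ℝ}
    {Dh : Torus L₁ L₂ → Fin 2 → ℝ} {D2h : Torus L₁ L₂ → Fin 2 → Fin 2 → ℝ} (hf : MemLp f 2)
    (hh : IsH2 h Dh D2h) : ∫ p, (1 / 2 * f p ^ 2 + 1 / 2 * (∑ i, D2h p i i) ^ 2)
      = 1 / 2 * (∫ p, f p ^ 2) + 1 / 2 * lapSq D2h := by
  have h1 : Integrable (fun p => (∑ i, D2h p i i) ^ 2) := by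
    simp only [Fin.sum_univ_two]
    exact ((hh.hess_memLp 0 0).add (hh.hess_memLp 1 1)).integrable_sq
  rw [integral_add (hf.integrable_sq.const_mul _) (h1.const_mul _), integral_const_mul,
    integral_const_mul]
  rfl

/-- Half of the elastic energy is kept apart from the reduced energy, to absorb the work of a static
force. -/
theorem RegularityClass.reducedEnergy_le (R : RegularityClass γ d ρ u η Du v Dη D2η)
    (hγ : 1 < γ) (hv₀ : MemLp d.v₀ 2) {Dη₀ : Torus L₁ L₂ → Fin 2 → ℝ}
    {D2η₀ : Torus L₁ L₂ → Fin 2 → Fin 2 → ℝ} (h₀ : IsH2 d.η₀ Dη₀ D2η₀) {W : ℝ → ℝ}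
    (hE : ∀ᵐ t ∂(volume.restrict (Ioi (0 : ℝ))),
      EnergyInequality μ lam γ d D2η₀ ρ u η Du v D2η (W t) t) :
    ∀ᵐ t ∂(volume.restrict (Ioi (0 : ℝ))),
      reducedEnergy μ lam γ ρ u η Du v D2η t + 1 / 4 * lapSq (D2η t)
        ≤ initialEnergy γ d (lapSq D2η₀) + W t := by
  filter_upwards [hE, R.slice hγ, R.η_H2] with t ht hs hh
  unfold EnergyInequality at ht
  rw [integral_plate_energy hs.2.2.2.2.2 hh, integral_plate_energy hv₀ h₀] at ht
  unfold reducedEnergy initialEnergy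
  linarith

/-- All other parts of the energy are nonnegative; for the accumulated viscous part this rests on
Korn's inequality. -/
theorem RegularityClass.plate_le_reducedEnergy (R : RegularityClass γ d ρ u η Du v Dη D2η)
    (hγ : 1 < γ) (hμ : 0 < μ) (hlam : 0 ≤ lam) : ∀ᵐ t ∂(volume.restrict (Ioi (0 : ℝ))),
      1 / 2 * ∫ p, v t p ^ 2 ≤ reducedEnergy μ lam γ ρ u η Du v D2η t := by
  filter_upwards [R.slice hγ, ae_restrict_mem measurableSet_Ioi] with t hs ht
  have h1 := (R.lintegral_dissip_le hμ hlam ht).1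
  have h2 := lapSq_nonneg (D2η t)
  have h3 : 0 ≤ ∫ p in fluidDomain (η t),
      (1 / 2 * ρ t p * (∑ i, u t p i ^ 2) + ρ t p ^ γ / (γ - 1)) := by
    refine integral_nonneg_of_ae (hs.2.2.1.mono fun p hp => ?_)
    have e1 : 0 ≤ ∑ i, u t p i ^ 2 := Finset.sum_nonneg fun i _ => sq_nonneg _
    have e2 : 0 ≤ ρ t p ^ γ / (γ - 1) := div_nonneg (Real.rpow_nonneg hp _) (by linarith)
    simp only [Pi.zero_apply]
    positivity
  unfold reducedEnergy
  linarith

/-- The work of a force in `L¹(0,∞; L²)`. -/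
theorem MemL1L2.abs_integral_mul_le {F : ℝ → Torus L₁ L₂ → ℝ} (hF : MemL1L2 F)
    {k : ℝ → Torus L₁ L₂ → ℝ} {y t : ℝ} (hy : 0 ≤ y)
    (hk : ∀ᵐ s ∂(volume.restrict (Ioo 0 t)),
      AEStronglyMeasurable (k s) volume ∧ eLpNorm (k s) 2 volume ≤ ENNReal.ofReal y) :
    |∫ q in Ioo 0 t ×ˢ (univ : Set (Torus L₁ L₂)), F q.1 q.2 * k q.1 q.2|
      ≤ y * (∫⁻ s in Ioi (0 : ℝ), eLpNorm (F s) 2 volume).toReal := by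
  have hI0 : Ioo 0 t ⊆ Ioi (0 : ℝ) := fun s hs => hs.1
  have hFm : ∀ᵐ s ∂(volume.restrict (Ioi (0 : ℝ))), AEStronglyMeasurable (F s) volume := by
    have h1 := hF.1
    rw [show (volume : Measure (ℝ × Torus L₁ L₂)) = (volume : Measure ℝ).prod volume from rfl,
      ← Measure.prod_restrict, Measure.restrict_univ] at h1
    exact h1.prodMk_left
  have h1 := enorm_integral_le_lintegral_enorm
    (μ := volume.restrict (Ioo 0 t ×ˢ (univ : Set (Torus L₁ L₂))))
    (fun q : ℝ × Torus L₁ L₂ => F q.1 q.2 * k q.1 q.2)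
  have h2 : ∫⁻ q in Ioo 0 t ×ˢ (univ : Set (Torus L₁ L₂)), ‖F q.1 q.2 * k q.1 q.2‖ₑ
      ≤ ∫⁻ s in Ioo 0 t, ∫⁻ p, ‖F s p * k s p‖ₑ := by
    rw [show (volume : Measure (ℝ × Torus L₁ L₂)) = (volume : Measure ℝ).prod volume from rfl,
      ← Measure.prod_restrict, Measure.restrict_univ]
    exact lintegral_prod_le _
  have h3 : ∫⁻ s in Ioo 0 t, ∫⁻ p, ‖F s p * k s p‖ₑ
      ≤ ∫⁻ s in Ioo 0 t, ENNReal.ofReal y * eLpNorm (F s) 2 volume := by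
    refine lintegral_mono_ae ?_
    filter_upwards [hk, ae_restrict_of_ae_restrict_of_subset hI0 hFm] with s hs hm
    simp only [enorm_mul]
    have cs := lintegral_mul_sq_le (μ := (volume : Measure (Torus L₁ L₂))) hm.enorm hs.1.enorm
    rw [← eLpNorm_two_sq, ← eLpNorm_two_sq, ← mul_pow] at cs
    have := IsSlice.le_rpow_half cs
    rw [← ENNReal.rpow_natCast, ← ENNReal.rpow_mul, show ((2 : ℕ) : ℝ) * (1 / 2) = 1 by norm_num,
      ENNReal.rpow_one, mul_comm] at this
    exact this.trans (mul_le_mul_left hs.2 _)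
  rw [lintegral_const_mul' _ _ ENNReal.ofReal_ne_top] at h3
  rw [Real.enorm_eq_ofReal_abs] at h1
  refine (ENNReal.ofReal_le_ofReal_iff (by positivity)).1 (h1.trans (h2.trans (h3.trans ?_)))
  rw [ENNReal.ofReal_mul hy, ENNReal.ofReal_toReal hF.2.ne]
  exact mul_le_mul_right (lintegral_mono_set hI0) _

/-- The energy bound for a force in `L¹(0,∞; L²)`. -/
theorem RegularityClass.exists_energy_bound (R : RegularityClass γ d ρ u η Du v Dη D2η)
    (hγ : 1 < γ) (hμ : 0 < μ) (hlam : 0 ≤ lam) (hv₀ : MemLp d.v₀ 2)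
    {Dη₀ : Torus L₁ L₂ → Fin 2 → ℝ} {D2η₀ : Torus L₁ L₂ → Fin 2 → Fin 2 → ℝ}
    (h₀ : IsH2 d.η₀ Dη₀ D2η₀) {F : ℝ → Torus L₁ L₂ → ℝ} (hF : MemL1L2 F)
    (hE : ∀ᵐ t ∂(volume.restrict (Ioi (0 : ℝ))),
      EnergyInequality μ lam γ d D2η₀ ρ u η Du v D2η
        (∫ q in Ioo 0 t ×ˢ (univ : Set (Torus L₁ L₂)), F q.1 q.2 * v q.1 q.2) t) :
    ∃ E, ∀ᵐ t ∂(volume.restrict (Ioi (0 : ℝ))),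
      reducedEnergy μ lam γ ρ u η Du v D2η t ≤ E := by
  set Φ := (∫⁻ s in Ioi (0 : ℝ), eLpNorm (F s) 2 volume).toReal with hΦ
  have hΦ0 : 0 ≤ Φ := ENNReal.toReal_nonneg
  set e₀ := |initialEnergy γ d (lapSq D2η₀)| with he₀
  have he0 : 0 ≤ e₀ := abs_nonneg _
  refine ⟨e₀ + (Φ + √(2 * e₀ + Φ ^ 2)) * Φ, ae_of_forall_Ioo fun T hT => ?_⟩
  have hsub : Ioo 0 T ⊆ Ioi (0 : ℝ) := fun s hs => hs.1
  -- The regularity class makes this supremum finite for each `T`, with no uniformity. Finiteness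
  -- permits absorption, and the quadratic inequality below then gives a bound free of `T`.
  set Y := essSup (fun s => eLpNorm (v s) 2 volume) (volume.restrict (Ioo 0 T)) with hY
  have hYt : Y ≠ ⊤ := by
    obtain ⟨C, hC⟩ := R.v_bound T hT
    exact ne_top_of_le_ne_top ENNReal.coe_ne_top (essSup_le_of_ae_le _ hC)
  set y := Y.toReal with hy
  have hy0 : 0 ≤ y := ENNReal.toReal_nonneg
  have hvY : ∀ᵐ s ∂(volume.restrict (Ioo 0 T)), AEStronglyMeasurable (v s) volume ∧
      eLpNorm (v s) 2 volume ≤ ENNReal.ofReal y := by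
    filter_upwards [ae_restrict_of_ae_restrict_of_subset hsub (R.slice hγ),
      ENNReal.ae_le_essSup (μ := volume.restrict (Ioo 0 T)) fun s => eLpNorm (v s) 2 volume]
      with s h1 h2
    rw [hy, ENNReal.ofReal_toReal hYt]
    exact ⟨h1.1, h2⟩
  have hmain : ∀ᵐ t ∂(volume.restrict (Ioo 0 T)),
      reducedEnergy μ lam γ ρ u η Du v D2η t ≤ e₀ + y * Φ := by
    filter_upwards [ae_restrict_of_ae_restrict_of_subset hsub (R.reducedEnergy_le hγ hv₀ h₀ hE),
      ae_restrict_mem measurableSet_Ioo] with t h1 ht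
    have h2 := (abs_le.1 (hF.abs_integral_mul_le hy0 (ae_restrict_of_ae_restrict_of_subset
      (Ioo_subset_Ioo_right ht.2.le) hvY))).2
    have h3 := lapSq_nonneg (D2η t)
    have h4 := le_abs_self (initialEnergy γ d (lapSq D2η₀))
    linarith
  have hYle : Y ≤ ENNReal.ofReal √(2 * (e₀ + y * Φ)) := by
    refine essSup_le_of_ae_le _ ?_
    filter_upwards [hmain, ae_restrict_of_ae_restrict_of_subset hsub
      ((R.slice hγ).and (R.plate_le_reducedEnergy (lam := lam) hγ hμ hlam))] with t h1 h2
    have h3 : ∫ p, v t p ^ 2 ≤ 2 * (e₀ + y * Φ) := by linarith [h2.2]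
    have h4 : eLpNorm (v t) 2 volume ^ 2 = ENNReal.ofReal (∫ p, v t p ^ 2) :=
      (eLpNorm_two_sq _ _).trans (lintegral_enorm_sq_eq h2.1.2.2.2.2.2)
    have h5 := IsSlice.le_rpow_half (h4.le.trans (ENNReal.ofReal_le_ofReal h3))
    rwa [ENNReal.ofReal_rpow_of_nonneg (by positivity) (by norm_num), ← Real.sqrt_eq_rpow] at h5
  have hyle : y ≤ √(2 * (e₀ + y * Φ)) := by
    have := ENNReal.toReal_mono ENNReal.ofReal_ne_top hYle
    rwa [ENNReal.toReal_ofReal (Real.sqrt_nonneg _)] at this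
  have hysq : y ^ 2 ≤ 2 * (e₀ + y * Φ) := by
    have := pow_le_pow_left₀ hy0 hyle 2
    rwa [Real.sq_sqrt (by positivity)] at this
  -- The larger root of y² = 2(e₀ + yΦ), by completing the square.
  have hyb : y ≤ Φ + √(2 * e₀ + Φ ^ 2) := by
    have := Real.le_sqrt_of_sq_le (show (y - Φ) ^ 2 ≤ 2 * e₀ + Φ ^ 2 by nlinarith)
    linarith
  filter_upwards [hmain] with t ht
  exact ht.trans (by gcongr)

/-- The energy bound for a static force under contact. -/
theorem RegularityClass.static_energy_bound (R : RegularityClass γ d ρ u η Du v Dη D2η)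
    (hγ : 1 < γ) (hv₀ : MemLp d.v₀ 2) (hη₀ : Continuous d.η₀)
    {Dη₀ : Torus L₁ L₂ → Fin 2 → ℝ} {D2η₀ : Torus L₁ L₂ → Fin 2 → Fin 2 → ℝ}
    (h₀ : IsH2 d.η₀ Dη₀ D2η₀) {F : Torus L₁ L₂ → ℝ} {M C : ℝ} (hF : Integrable F)
    (hM : ∫ p, |F p| ≤ M) (hC : ∀ p, |d.η₀ p| ≤ C) (hcon : ∀ t, 0 < t → ∃ p, η t p ≤ 0)
    (hE : ∀ᵐ t ∂(volume.restrict (Ioi (0 : ℝ))),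
      EnergyInequality μ lam γ d D2η₀ ρ u η Du v D2η
        ((∫ p, F p * η t p) - ∫ p, F p * d.η₀ p) t) :
    ∀ᵐ t ∂(volume.restrict (Ioi (0 : ℝ))), reducedEnergy μ lam γ ρ u η Du v D2η t
      ≤ initialEnergy γ d (lapSq D2η₀) + (M * oscConst L₁ L₂) ^ 2 + M * C := by
  have hC0 : 0 ≤ C := (abs_nonneg _).trans (hC 0)
  have hb : ∀ {k : Torus L₁ L₂ → ℝ} {c : ℝ}, Continuous k → 0 ≤ c → (∀ p, |k p| ≤ c) →
      |∫ p, F p * k p| ≤ M * c := fun {k c} _ hc0 hc => by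
    have h1 : |∫ p, F p * k p| ≤ ∫ p, |F p| * c := by
      rw [← Real.norm_eq_abs]
      refine norm_integral_le_of_norm_le (hF.abs.mul_const c) (Eventually.of_forall fun p => ?_)
      rw [norm_mul]
      exact mul_le_mul_of_nonneg_left (hc p) (norm_nonneg _)
    rw [integral_mul_const] at h1
    exact h1.trans (mul_le_mul_of_nonneg_right hM hc0)
  filter_upwards [R.reducedEnergy_le hγ hv₀ h₀ hE, R.η_H2, ae_restrict_mem measurableSet_Ioi]
    with t h1 hh ht
  have ht : 0 < t := ht
  have hc := continuous_slice R.η_cont ht.le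
  have hn := nonneg_of_ae_pos hc (R.η_pos t ht.le)
  obtain ⟨p, hp⟩ := hcon t ht
  -- Under contact η is bounded by its oscillation, so the work of the force is at most linear in
  -- the root of the elastic energy.
  have h2 := (abs_le.1 (hb (c := oscConst L₁ L₂ * √(lapSq (D2η t))) hc
    (mul_nonneg oscConst_nonneg (Real.sqrt_nonneg _)) fun q => by
      rw [abs_of_nonneg (hn q)]
      linarith [(abs_le.1 (hh.abs_sub_le hc p q)).2])).2
  have h3 := (abs_le.1 (hb hη₀ hC0 hC)).1
  have h4 := Real.sq_sqrt (lapSq_nonneg (D2η t))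
  -- This square bounds the work at time `t` by the reserved quarter of `lapSq` plus `(M * oscConst
  -- L₁ L₂) ^ 2`.
  nlinarith [sq_nonneg (1 / 2 * √(lapSq (D2η t)) - M * oscConst L₁ L₂)]

end Weak

end

end FluidPlate

/-! ### Conclusion for both kinds of force -/

theorem theorem2 (L₁ L₂ : ℝ) [Fact (0 < L₁)] [Fact (0 < L₂)] (γ : ℝ) (hγ : 3 < γ)
    (d : FluidPlate.InitialData L₁ L₂) (hd : d.Admissible γ) :
    (∀ μ lam : ℝ, 0 < μ → 0 ≤ lam →
      ∀ F : ℝ → FluidPlate.Torus L₁ L₂ → ℝ, FluidPlate.MemL1L2 F →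
      ∀ (ρ : ℝ → FluidPlate.Space L₁ L₂ → ℝ) (u : ℝ → FluidPlate.Space L₁ L₂ → Fin 3 → ℝ)
        (η : ℝ → FluidPlate.Torus L₁ L₂ → ℝ),
        FluidPlate.IsWeakSolution μ lam γ d F ρ u η →
        ∃ T : ℝ, 0 < T ∧ ∀ p, 0 < η T p) ∧
    (∀ M : ℝ, ∃ A : ℝ, 0 < A ∧
      ∀ μ lam : ℝ, 0 < μ → 0 ≤ lam →
      ∀ F : FluidPlate.Torus L₁ L₂ → ℝ, Integrable F volume → ∫ p, |F p| ≤ M →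
        -A < ∫ p, F p →
      ∀ (ρ : ℝ → FluidPlate.Space L₁ L₂ → ℝ) (u : ℝ → FluidPlate.Space L₁ L₂ → Fin 3 → ℝ)
        (η : ℝ → FluidPlate.Torus L₁ L₂ → ℝ),
        FluidPlate.IsWeakSolutionStatic μ lam γ d F ρ u η →
        ∃ T : ℝ, 0 < T ∧ ∀ p, 0 < η T p) := by
  have hγ1 : 1 < γ := by linarith
  refine ⟨fun μ lam hμ hlam F hF ρ u η hsol => ?_, fun M => ?_⟩
  · by_contra! hcon
    obtain ⟨Du, v, Dη, D2η, Dη₀, D2η₀, R, h₀, -, -, hCI, hE⟩ := hsol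
    obtain ⟨E, hEb⟩ := R.exists_energy_bound hγ1 hμ hlam hd.v_L2 h₀ hF hE
    -- Tested with the constant one, the work estimate bounds the total impulse of the force. It is
    -- finite, so the force contributes no linear growth and the rate is `a = 0`.
    have hone : ∀ t : ℝ, ∀ᵐ s ∂(volume.restrict (Ioo 0 t)),
        AEStronglyMeasurable (fun _ : FluidPlate.Torus L₁ L₂ => (1 : ℝ)) volume ∧
        eLpNorm (fun _ : FluidPlate.Torus L₁ L₂ => (1 : ℝ)) 2 volume ≤ ENNReal.ofReal
          (eLpNorm (fun _ : FluidPlate.Torus L₁ L₂ => (1 : ℝ)) 2 volume).toReal := fun t =>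
      Eventually.of_forall fun s => ⟨aestronglyMeasurable_const, by
        rw [ENNReal.ofReal_toReal (memLp_const (1 : ℝ)).eLpNorm_ne_top]⟩
    refine FluidPlate.contact_absurd hγ hd hμ hlam R hcon hEb hCI (a := 0)
      (B := (eLpNorm (fun _ : FluidPlate.Torus L₁ L₂ => (1 : ℝ)) 2 volume).toReal
        * (∫⁻ s in Ioi (0 : ℝ), eLpNorm (F s) 2 volume).toReal) (fun t _ => ?_)
      (FluidPlate.IsSlice.pressureRate_pos hd.mass_pos (FluidPlate.contactHeight_pos E))
    have h1 := (abs_le.1 (hF.abs_integral_mul_le (k := fun _ _ => 1) ENNReal.toReal_nonneg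
      (hone t))).1
    simp only [mul_one] at h1
    linarith
  · obtain ⟨Dη₀', D2η₀', h₀'⟩ := hd.η_H2
    obtain ⟨C, -, hC⟩ := FluidPlate.exists_bound_of_continuous hd.η_cont
    -- Fixed before the viscosities, the force and the solution; the threshold derived from it
    -- therefore depends only on the geometry, γ, the data and `M`.
    set E := FluidPlate.initialEnergy γ d (FluidPlate.lapSq D2η₀')
      + (M * FluidPlate.oscConst L₁ L₂) ^ 2 + M * C
    have hc₀ := FluidPlate.IsSlice.pressureRate_pos (L₁ := L₁) (L₂ := L₂) (γ := γ) hd.mass_pos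
      (FluidPlate.contactHeight_pos (L₁ := L₁) (L₂ := L₂) E)
    -- Half of the pressure rate: a downward force of this size grows linearly in time at a rate
    -- strictly below that of the pressure.
    refine ⟨_, half_pos hc₀, fun μ lam hμ hlam F hF hM hA ρ u η hsol => ?_⟩
    by_contra! hcon
    obtain ⟨Du, v, Dη, D2η, Dη₀, D2η₀, R, h₀, -, -, hCI, hE⟩ := hsol
    have hEb := R.static_energy_bound hγ1 hd.v_L2 hd.η_cont h₀ hF hM hC hcon hE
    rw [h₀.lapSq_unique h₀'] at hEb
    refine FluidPlate.contact_absurd hγ hd hμ hlam R hcon (E := E) hEb hCI (B := 0)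
      (fun t ht => ?_) (half_lt_self hc₀)
    have e : ∫ q in Ioo 0 t ×ˢ (univ : Set (FluidPlate.Torus L₁ L₂)), F q.2 = t * ∫ p, F p := by
      have h1 := setIntegral_prod_mul (μ := (volume : Measure ℝ))
        (ν := (volume : Measure (FluidPlate.Torus L₁ L₂))) (fun _ : ℝ => (1 : ℝ)) F (Ioo 0 t) univ
      simp only [one_mul, integral_const, smul_eq_mul, mul_one, Measure.restrict_univ] at h1
      refine h1.trans ?_
      simp [ht.le]
    rw [e]
    nlinarith
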